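/- **Theorem (local eigenvalue bound).** Let $n\ge 0$ and consider the local model of a compatible chart centred at a critical point $p$ of index $m$, $0\le m\le 2n$: the space $\mathbb R^{2n}$ with $$\omega=\sum_{i=1}^n dx_i\wedge dx_{i+n},\qquad g_{ij}=\delta_{ij},\qquad f=f(p)+\tfrac12\big(-x_1^2-\dots-x_m^2+x_{m+1}^2+\dots+x_{2n}^2\big).$$ For $t>0$ let $d_t=d+t\,df\wedge$ and $d_t^*=d^*+t\,\iota_{\nabla f}$, let $\Lambda=\sum_{i=1}^n\iota_{\partial_{i+n}}\iota_{\partial_i}$ be the adjoint of $\omega\wedge$, and let $$d_{C,t}=\begin{pmatrix} d_t&\omega\\0&-d_t\end{pmatrix},\qquad d_{C,t}^*=\begin{pmatrix} d_t^*&0\\ \Lambda&-d_t^*\end{pmatrix},\qquad \Delta_{C,t}=d_{C,t}d_{C,t}^*+d_{C,t}^*d_{C,t}$$ act on cone forms $\sigma=\binom{\eta}{\xi}$, where $\eta,\xi$ are smooth real differential forms on $\mathbb R^{2n}$, possibly of mixed degree; $\sigma$ has cone degree $k$ if $\eta$ is a $k$-form and $\xi$ a $(k-1)$-form. Let $\langle\sigma,\sigma'\rangle=\int\eta\wedge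 *\eta'+\int\xi\wedge *\xi'$ be the $L^2$ inner product. Put $\zeta_m=e^{-t|x|^2/2}dx_1\wedge\dots\wedge dx_m$, $$\tau=-\sum_{i=1}^{m}x_{i+n}dx_i+\tfrac12\sum_{i=m+1}^{n}(x_idx_{i+n}-x_{i+n}dx_i)\ \text{ if } m<n,\qquad \tau=0\ \text{ if } m\ge n,$$ $$Z=\tfrac12\sum_{i=1}^{m-n}(x_i\partial_{i+n}-x_{i+n}\partial_i)\ \text{ if } m>n,\qquad Z=0\ \text{ if } m\le n,$$ and let $$\sigma_1=\begin{pmatrix}\zeta_m\\ \iota_Z\zeta_m\end{pmatrix},\qquad \sigma_2=\begin{pmatrix}-\tau\wedge\zeta_m\\ \zeta_m\end{pmatrix}.$$ 1. There are constants $c>0$ and $C$ depending only on $n$ such that for every $m$, every such $f$, every $t>0$ and every smooth cone form $\sigma=\binom{\eta}{\xi}$ with $\sigma$ and $\Delta_{C,t}\sigma$ in $L^2$ that is orthogonal to $\sigma_1$ and $\sigma_2$, $$\langle\Delta_{C,t}\sigma,\sigma\rangle\ \ge\ c\,t\,\|\sigma\|^2-C\big(\|\eta\|^2+\|\xi\|^2\big).$$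 2. There are constants $c'>0$ and $t_0>0$ depending only on $n$ such that for every $m$, every such $f$ and every $t\ge t_0$: every eigenvalue $\lambda$ of $\Delta_{C,t}$ with a smooth $L^2$ eigenform $\sigma$ that is not harmonic ($\Delta_{C,t}\sigma=\lambda\sigma\neq0$) satisfies $\lambda>c't$; and the space of smooth $L^2$ cone forms $\sigma$ with $\Delta_{C,t}\sigma=0$ is exactly the span of $\sigma_1$ and $\sigma_2$ and has dimension 2. Here $\sigma_1$ has cone degree $m$ and $\sigma_2$ has cone degree $m+1$. -/

import Mathlib

open MeasureTheory
open scoped ContDiff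

noncomputable section

namespace ConeLaplacian

/-! ### Differential forms on the coordinate space `ℝ²ⁿ` -/

/-- The coordinate space `ℝ²ⁿ`.  The coordinate `x_{i+1}` of the mathematics (`0 ≤ i < n`) is
`x (Fin.castAdd n i)`, and its conjugate coordinate `x_{i+1+n}` is `x (Fin.natAdd n i)`. -/
abbrev Coord (n : ℕ) := EuclideanSpace ℝ (Fin (n + n))

/-- Differential forms of mixed degree on `ℝ²ⁿ`: the component of degree `k` of `η` is `η k`.
(All components of degree `k > 2n` vanish, since alternating maps of that degree do.) -/
abbrev Form (n : ℕ) := (k : ℕ) → Coord n → Coord n [⋀^Fin k]→L[ℝ] ℝ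

variable {n : ℕ}

/-- The coordinate covector `dx_l`. -/
def dx (l : Fin (n + n)) : Coord n →L[ℝ] ℝ := EuclideanSpace.proj l

/-- The coordinate vector `∂/∂x_l`. -/
def ee (l : Fin (n + n)) : Coord n := EuclideanSpace.single l 1

/-- Exterior multiplication `α ∧ η` by a one-form `α`, i.e.
`(α ∧ η)(v₀, …, v_k) = ∑ i, (-1)^i α(v_i) η(v₀, …, v̂_i, …, v_k)`;
the normalization agrees with that of `extDeriv`. -/
def wedge (α : Coord n → Coord n →L[ℝ] ℝ) (η : Form n) : Form n
  | 0 => fun _ => 0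
  | k + 1 => fun x =>
      ContinuousAlternatingMap.alternatizeUncurryFin ((α x).smulRight (η k x))

/-- Interior multiplication `ι_Z η` by a vector field `Z`. -/
def contract (Z : Coord n → Coord n) (η : Form n) : Form n :=
  fun k x => (η (k + 1) x).curryLeft (Z x)

/-- The exterior derivative. -/
def extD (η : Form n) : Form n
  | 0 => fun _ => 0
  | k + 1 => extDeriv (η k)

/-- The codifferential of the flat metric, `d^* = -∑_j ι_{∂_j} ∂_j`. -/
def coD (η : Form n) : Form n :=
  fun k x => -∑ j, (fderiv ℝ (η (k + 1)) x (ee j)).curryLeft (ee j)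

/-- Exterior multiplication by the symplectic form `ω = ∑ i, dx_i ∧ dx_{i+n}`. -/
def omegaWedge (η : Form n) : Form n :=
  ∑ i : Fin n,
    wedge (fun _ => dx (Fin.castAdd n i)) (wedge (fun _ => dx (Fin.natAdd n i)) η)

/-- The adjoint `Λ = ∑ i, ι_{∂_{i+n}} ι_{∂_i}` of `ω ∧ ·`. -/
def Lam (η : Form n) : Form n :=
  ∑ i : Fin n,
    contract (fun _ => ee (Fin.natAdd n i)) (contract (fun _ => ee (Fin.castAdd n i)) η)

/-- The deformed differential `d_t = d + t df ∧ ·`. -/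
def dT (f : Coord n → ℝ) (t : ℝ) (η : Form n) : Form n :=
  extD η + t • wedge (fun x => fderiv ℝ f x) η

/-- The deformed codifferential `d_t^* = d^* + t ι_{∇f}`. -/
def dTstar (f : Coord n → ℝ) (t : ℝ) (η : Form n) : Form n :=
  coD η + t • contract (fun x => gradient f x) η

/-! ### Cone forms and the deformed cone Laplacian -/

/-- Cone forms `η + θ ξ`, written as pairs `(η, ξ)`. -/
abbrev ConeForm (n : ℕ) := Form n × Form n

/-- `σ = (η, ξ)` has cone degree `k`: `η` is a `k`-form and `ξ` is a `(k-1)`-form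
(so `ξ = 0` if `k = 0`). -/
def HasConeDegree (k : ℕ) (σ : ConeForm n) : Prop :=
  (∀ j, j ≠ k → σ.1 j = 0) ∧ (∀ j, j + 1 ≠ k → σ.2 j = 0)

/-- `d_{C,t} (η, ξ) = (d_t η + ω ∧ ξ, - d_t ξ)`. -/
def coneD (f : Coord n → ℝ) (t : ℝ) (σ : ConeForm n) : ConeForm n :=
  (dT f t σ.1 + omegaWedge σ.2, -dT f t σ.2)

/-- `d_{C,t}^* (η, ξ) = (d_t^* η, Λ η - d_t^* ξ)`. -/
def coneDstar (f : Coord n → ℝ) (t : ℝ) (σ : ConeForm n) : ConeForm n :=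
  (dTstar f t σ.1, Lam σ.1 - dTstar f t σ.2)

/-- The deformed cone Laplacian `Δ_{C,t} = d_{C,t} d_{C,t}^* + d_{C,t}^* d_{C,t}`. -/
def coneLap (f : Coord n → ℝ) (t : ℝ) (σ : ConeForm n) : ConeForm n :=
  coneD f t (coneDstar f t σ) + coneDstar f t (coneD f t σ)

/-! ### The `L²` inner product and the space of local forms -/

/-- The pointwise inner product of `k`-covectors for which the `dx_{i₁} ∧ … ∧ dx_{i_k}`,
`i₁ < … < i_k`, are orthonormal: `⟨a, b⟩ vol = a ∧ * b`. -/
def covInner {k : ℕ} (a b : Coord n [⋀^Fin k]→L[ℝ] ℝ) : ℝ :=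
  ∑ I : Fin k ↪o Fin (n + n), a (fun i => ee (I i)) * b (fun i => ee (I i))

/-- The `L²` inner product of forms, `∫ η ∧ * η'`; forms of different degrees are orthogonal. -/
def formInner (η η' : Form n) : ℝ :=
  ∫ x, ∑ k ∈ Finset.range (n + n + 1), covInner (η k x) (η' k x)

/-- The cone inner product `⟨(η, ξ), (η', ξ')⟩ = ⟨η, η'⟩ + ⟨ξ, ξ'⟩`. -/
def coneInner (σ σ' : ConeForm n) : ℝ :=
  formInner σ.1 σ'.1 + formInner σ.2 σ'.2

/-- All components of `η` and `ξ` are smooth. -/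
def IsSmooth (σ : ConeForm n) : Prop :=
  ∀ k, ContDiff ℝ ∞ (σ.1 k) ∧ ContDiff ℝ ∞ (σ.2 k)

/-- All components of `η` and `ξ` are square integrable. -/
def IsL2 (σ : ConeForm n) : Prop :=
  ∀ k, MemLp (σ.1 k) 2 volume ∧ MemLp (σ.2 k) 2 volume

/-! ### The Morse function and the harmonic generators -/

/-- `f = f(p) + ½ (-x_1² - … - x_m² + x_{m+1}² + … + x_{2n}²)`, where the critical point `p` of
index `m` is the origin of the coordinates. -/
def IsMorseForm (m : ℕ) (f : Coord n → ℝ) : Prop :=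
  ∀ x, f x = f 0 + (1 / 2 : ℝ) * ∑ l : Fin (n + n), (if (l : ℕ) < m then -1 else 1) * x l ^ 2

/-- The constant function `1`, a form of degree `0`. -/
def unitForm : Form n
  | 0 => fun _ => ContinuousAlternatingMap.constOfIsEmpty ℝ (Coord n) (Fin 0) (1 : ℝ)
  | _ + 1 => fun _ => 0

/-- `dx_{l₁} ∧ (dx_{l₂} ∧ …)` for a list `l₁, l₂, …` of indices. -/
def dxList (L : List (Fin (n + n))) : Form n :=
  L.foldr (fun l η => wedge (fun _ => dx l) η) unitForm

/-- `ζ_m = e^{-t|x|²/2} dx_1 ∧ … ∧ dx_m`. -/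
def zeta (t : ℝ) (m : ℕ) : Form n :=
  fun k x => Real.exp (-t * ‖x‖ ^ 2 / 2) • dxList ((List.finRange (n + n)).take m) k x

/-- The one-form `τ = ∑_{i ≤ m} -x_{i+n} dx_i + ½ ∑_{m < i ≤ n} (x_i dx_{i+n} - x_{i+n} dx_i)`
for `m < n`, and `τ = 0` for `m ≥ n`. -/
def tau (m : ℕ) (x : Coord n) : Coord n →L[ℝ] ℝ :=
  if m < n then
    ∑ i : Fin n,
      if (i : ℕ) < m then -x (Fin.natAdd n i) • dx (Fin.castAdd n i)
      else (1 / 2 : ℝ) •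
        (x (Fin.castAdd n i) • dx (Fin.natAdd n i) - x (Fin.natAdd n i) • dx (Fin.castAdd n i))
  else 0

/-- The vector field `Z = ½ ∑_{1 ≤ i ≤ m - n} (x_i ∂_{i+n} - x_{i+n} ∂_i)`; it is `0` for
`m ≤ n`. -/
def vecZ (m : ℕ) (x : Coord n) : Coord n :=
  ∑ i : Fin n,
    if (i : ℕ) + n < m then
      (1 / 2 : ℝ) •
        (x (Fin.castAdd n i) • ee (Fin.natAdd n i) - x (Fin.natAdd n i) • ee (Fin.castAdd n i))
    else 0

/-- The generator `(ζ_m, ι_Z ζ_m)`. -/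
def gen₁ (t : ℝ) (m : ℕ) : ConeForm n := (zeta t m, contract (vecZ m) (zeta t m))

/-- The generator `(-τ ∧ ζ_m, ζ_m)`. -/
def gen₂ (t : ℝ) (m : ℕ) : ConeForm n := (-wedge (tau m) (zeta t m), zeta t m)

end ConeLaplacian

end

open MeasureTheory
open scoped ContDiff

noncomputable section

namespace ConeLaplacian

/-! ### The Gaussian Poincaré inequality, by rotating a pair of independent points. -/

section Gaussian

open Real

/-! In coordinates the cone differential is a first-order operator `∑ A_j (∂_j + t s_j x_j) + W` on
functions with values in a finite-dimensional Euclidean space. Here `A_j` is multiplication by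
`dx_j`, with opposite signs on the two components, `s_j = ±1` is the sign of the Hessian, and `W`,
multiplication by `ω`, is bounded independently of `t`. Because `|a + b|² ≥ |a|²/2 - |b|²`, `W`
costs only a constant, and half of the energy of the uncoupled Witten complex survives.

The Weitzenböck formula `integral_sq_norm_firstOrder` splits that energy into an oscillator energy,
which after normalization is the same in every direction, and `2t` times a diagonal operator on
covectors. The eigenvalues of the latter count the indices at which a multi-index differs from `{1,
…, m}`, so it has gap 1 above `dx_1 ∧ … ∧ dx_m` (`fermion_gap`). The oscillator has a gap
proportional to `t` above the Gaussian (`harmonic_gap`), which is the Gaussian Poincaré inequality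
after dividing by the ground state. Together they bound the energy below by `c t - C` off the two
pure Gaussian states, one in each component of the cone (`IsConeModel.coercive`). Both constants
depend only on the dimension.

The coupling `ω` prevents these pure Gaussians from being harmonic in general. The generators add to
them a term linear in `x`: differentiating `-τ` produces `-ω`, and contracting with the derivative
of `Z` produces `-Λ`, which cancels the coupling, so the corrected states are closed and coclosed
(`hasGroundStates`). The correction has squared norm `O(1/t)` relative to the Gaussian. Trading
orthogonality to the Gaussians for orthogonality to the generators therefore costs `t · O(1/t)`,
again a constant (`IsConeModel.bound_of_orthogonal`).

Finally `Δσ` is orthogonal to every closed and coclosed `L²` form, so an eigenform with non-zero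
eigenvalue satisfies the orthogonality hypotheses. A harmonic form minus its projection to the
generators also satisfies them, and must vanish for large `t`. Only `σ` and `Δσ` are known to be
square integrable, not the first derivatives of `σ`; each integration by parts is done against a
cutoff at scale `R`, whose commutator with the operators is `O(1/R)`. -/

lemma sin_cos_smul_cancel {E : Type*} [AddCommGroup E] [Module ℝ E] (θ : ℝ) (x : E) :
    (cos θ * cos θ) • x + (sin θ * sin θ) • x = x := by
  rw [← add_smul, ← sq, ← sq, cos_sq_add_sin_sq, one_smul]

lemma rotation_neg_rotation {E : Type*} [NormedAddCommGroup E] [NormedSpace ℝ E] (θ : ℝ)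
    (p : E × E) :
    ContinuousLinearMap.rotation θ (ContinuousLinearMap.rotation (-θ) p) = p := by
  have h1 := sin_cos_smul_cancel θ p.1
  have h2 := sin_cos_smul_cancel θ p.2
  ext
  · simp only [ContinuousLinearMap.rotation_apply, cos_neg, sin_neg]
    nth_rw 3 [← h1]
    module
  · simp only [ContinuousLinearMap.rotation_apply, cos_neg, sin_neg]
    nth_rw 3 [← h2]
    module

/-- Half of the exponential pays for the quadratic weight: `u ≤ e^{u/2}` with `u = t‖x‖²`. -/
lemma sq_norm_mul_exp_le {t : ℝ} (ht : 0 < t) {E : Type*} [NormedAddCommGroup E] (x : E) :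
    ‖x‖ ^ 2 * exp (-t * ‖x‖ ^ 2) ≤ t⁻¹ * exp (-(t / 2) * ‖x‖ ^ 2) := by
  have h1 : t * ‖x‖ ^ 2 ≤ exp (t / 2 * ‖x‖ ^ 2) := by
    have := quadratic_le_exp_of_nonneg (x := t / 2 * ‖x‖ ^ 2) (by positivity)
    nlinarith [sq_nonneg (t / 2 * ‖x‖ ^ 2 - 1)]
  have h2 : exp (-(t / 2) * ‖x‖ ^ 2) = exp (t / 2 * ‖x‖ ^ 2) * exp (-t * ‖x‖ ^ 2) := by
    rw [← exp_add]; congr 1; ring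
  rw [h2, ← mul_assoc]
  refine mul_le_mul_of_nonneg_right ?_ (exp_pos _).le
  rw [inv_mul_eq_div, le_div_iff₀ ht]; linarith

variable {E : Type*} [NormedAddCommGroup E] [InnerProductSpace ℝ E]

lemma norm_rotation_sq (θ : ℝ) (p : E × E) :
    ‖(ContinuousLinearMap.rotation θ p).1‖ ^ 2 + ‖(ContinuousLinearMap.rotation θ p).2‖ ^ 2
      = ‖p.1‖ ^ 2 + ‖p.2‖ ^ 2 := by
  have := sin_sq_add_cos_sq θ
  simp only [ContinuousLinearMap.rotation_apply, norm_add_sq_real, norm_smul, inner_smul_left,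
    inner_smul_right, mul_pow, norm_neg, norm_eq_abs, sq_abs, neg_smul, inner_neg_left,
    RCLike.conj_to_real]
  linear_combination (‖p.1‖ ^ 2 + ‖p.2‖ ^ 2) * this

/-- Cauchy–Schwarz against the constant 1, read off from `∫ (g - c)² ≥ 0` with `c` the mean of `g`.
-/
lemma sq_intervalIntegral_le {g : ℝ → ℝ} (hg : Continuous g) {a : ℝ} (ha : 0 < a) :
    (∫ s in (0 : ℝ)..a, g s) ^ 2 ≤ a * ∫ s in (0 : ℝ)..a, g s ^ 2 := by
  set c := (∫ s in (0 : ℝ)..a, g s) / a with hc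
  have h0 : 0 ≤ ∫ s in (0 : ℝ)..a, (g s - c) ^ 2 :=
    intervalIntegral.integral_nonneg ha.le fun _ _ => sq_nonneg _
  have h1 : ∫ s in (0 : ℝ)..a, (g s - c) ^ 2
      = (∫ s in (0 : ℝ)..a, g s ^ 2) - 2 * c * (∫ s in (0 : ℝ)..a, g s) + c ^ 2 * a := by
    have : ∀ s, (g s - c) ^ 2 = g s ^ 2 - 2 * c * g s + c ^ 2 := fun s => by ring
    simp_rw [this]
    rw [intervalIntegral.integral_add, intervalIntegral.integral_sub,
      intervalIntegral.integral_const_mul, intervalIntegral.integral_const]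
    · simp; ring
    all_goals exact Continuous.intervalIntegrable (by fun_prop) _ _
  have h2 : (∫ s in (0 : ℝ)..a, g s) = c * a := by rw [hc]; field_simp
  rw [h1, h2] at h0
  rw [h2]
  nlinarith

/-- The quarter circle `θ ↦ cos θ • p.1 + sin θ • p.2` leads from `p.1` to `p.2`, and its velocity
is the second component of the rotated pair. The increment of `h` is thus an integral of a function
of the rotated pair alone, and that pair has the same Gaussian law as `p`. -/
lemma sq_sub_le_integral_rotation {h : E → ℝ} (hh : ContDiff ℝ 1 h) (p : E × E) :
    (h p.2 - h p.1) ^ 2 ≤ π / 2 * ∫ θ in (0 : ℝ)..(π / 2),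
      (fderiv ℝ h (ContinuousLinearMap.rotation θ p).1 (ContinuousLinearMap.rotation θ p).2) ^ 2 := by
  have hcont : Continuous fun θ : ℝ =>
      fderiv ℝ h (ContinuousLinearMap.rotation θ p).1 (ContinuousLinearMap.rotation θ p).2 := by
    have h1 : Continuous fun θ : ℝ => (ContinuousLinearMap.rotation θ p).1 := by
      simp only [ContinuousLinearMap.rotation_apply]; fun_prop
    have h2 : Continuous fun θ : ℝ => (ContinuousLinearMap.rotation θ p).2 := by
      simp only [ContinuousLinearMap.rotation_apply]; fun_prop
    exact ((hh.continuous_fderiv one_ne_zero).comp h1).clm_apply h2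
  have hderiv : ∀ θ : ℝ, HasDerivAt (fun θ : ℝ => h (ContinuousLinearMap.rotation θ p).1)
      (fderiv ℝ h (ContinuousLinearMap.rotation θ p).1 (ContinuousLinearMap.rotation θ p).2) θ := by
    intro θ
    have h1 : HasDerivAt (fun θ : ℝ => (ContinuousLinearMap.rotation θ p).1)
        (ContinuousLinearMap.rotation θ p).2 θ := by
      simp only [ContinuousLinearMap.rotation_apply]
      exact ((hasDerivAt_cos θ).smul_const p.1).add ((hasDerivAt_sin θ).smul_const p.2)
    exact ((hh.differentiable one_ne_zero _).hasFDerivAt).comp_hasDerivAt θ h1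
  have hint := intervalIntegral.integral_eq_sub_of_hasDerivAt (a := 0) (b := π / 2)
    (fun θ _ => hderiv θ) (hcont.intervalIntegrable _ _)
  simp only [ContinuousLinearMap.rotation_apply, cos_zero, sin_zero, cos_pi_div_two,
    sin_pi_div_two] at hint
  have := sq_intervalIntegral_le hcont (a := π / 2) (by positivity)
  simp only [ContinuousLinearMap.rotation_apply] at this ⊢
  rw [hint] at this
  simpa using this

/-- A dimensional constant bounding the second moment of Gaussians. -/
def momentConst (E : Type*) [NormedAddCommGroup E] [InnerProductSpace ℝ E] : ℝ :=
  2 ^ (Module.finrank ℝ E / 2 : ℝ)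

lemma momentConst_pos : 0 < momentConst E := by unfold momentConst; positivity

variable [FiniteDimensional ℝ E] [MeasurableSpace E] [BorelSpace E]

/-- Swapping the two factors conjugates the rotation by `θ` into the rotation by `-θ`. The two
determinants are therefore equal, while their product is 1, so the determinant is `±1`. -/
lemma measurePreserving_rotation (θ : ℝ) :
    MeasurePreserving (ContinuousLinearMap.rotation θ : E × E → E × E) volume volume := by
  refine ⟨(ContinuousLinearMap.continuous _).measurable, ?_⟩
  set R : ℝ → (E × E →ₗ[ℝ] E × E) := fun θ => (ContinuousLinearMap.rotation θ : E × E →L[ℝ] E × E)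
    with hR
  have hRR : ∀ θ, R θ ∘ₗ R (-θ) = LinearMap.id := fun θ =>
    LinearMap.ext fun p => rotation_neg_rotation θ p
  have hconj : R (-θ) = ((LinearEquiv.prodComm ℝ E E : E × E →ₗ[ℝ] E × E) ∘ₗ R θ) ∘ₗ
      ((LinearEquiv.prodComm ℝ E E).symm : E × E →ₗ[ℝ] E × E) := by
    refine LinearMap.ext fun p => ?_
    ext <;> simp [hR, ContinuousLinearMap.rotation_apply, add_comm]
  have hdet : LinearMap.det (R (-θ)) = LinearMap.det (R θ) := by
    rw [hconj]; exact LinearMap.det_conj (R θ) (LinearEquiv.prodComm ℝ E E)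
  have hsq : LinearMap.det (R θ) * LinearMap.det (R θ) = 1 := by
    have := congrArg LinearMap.det (hRR θ)
    rwa [LinearMap.det_comp, hdet, LinearMap.det_id] at this
  have hne : LinearMap.det (R θ) ≠ 0 := fun h => by simp [h] at hsq
  have habs : |(LinearMap.det (R θ))⁻¹| = 1 := by
    rw [abs_inv, inv_eq_one]
    have : |LinearMap.det (R θ)| * |LinearMap.det (R θ)| = 1 := by rw [abs_mul_abs_self, hsq]
    nlinarith [abs_nonneg (LinearMap.det (R θ))]
  have hHaar : (volume : Measure (E × E)).IsAddHaarMeasure := by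
    rw [Measure.volume_eq_prod]; infer_instance
  have := Measure.map_linearMap_addHaar_eq_smul_addHaar (volume : Measure (E × E)) hne
  rwa [habs, ENNReal.ofReal_one, one_smul] at this

lemma integrable_exp_neg_mul_sq_norm {b : ℝ} (hb : 0 < b) :
    Integrable (fun x : E => exp (-b * ‖x‖ ^ 2)) := by
  have := (GaussianFourier.integrable_cexp_neg_mul_sq_norm_add (V := E) (b := b)
    (by simpa using hb) 0 0).re
  refine this.congr (Filter.Eventually.of_forall fun x => ?_)
  simp only [zero_mul, add_zero]
  rw [← Complex.exp_ofReal_re (-b * ‖x‖ ^ 2)]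
  simp

/-- The mass `∫ e^{-t|x|²}` of the Gaussian. -/
def gaussMass (E : Type*) [NormedAddCommGroup E] [InnerProductSpace ℝ E] [FiniteDimensional ℝ E]
    [MeasurableSpace E] [BorelSpace E] (t : ℝ) : ℝ := ∫ x : E, exp (-t * ‖x‖ ^ 2)

lemma gaussMass_eq {t : ℝ} (ht : 0 < t) :
    gaussMass E t = (π / t) ^ (Module.finrank ℝ E / 2 : ℝ) :=
  GaussianFourier.integral_rexp_neg_mul_sq_norm ht

lemma gaussMass_pos {t : ℝ} (ht : 0 < t) : 0 < gaussMass E t := by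
  rw [gaussMass_eq ht]; positivity

lemma integrable_sq_norm_mul_exp {t : ℝ} (ht : 0 < t) :
    Integrable (fun x : E => ‖x‖ ^ 2 * exp (-t * ‖x‖ ^ 2)) := by
  refine ((integrable_exp_neg_mul_sq_norm (half_pos ht)).const_mul t⁻¹).mono'
    (by fun_prop) (Filter.Eventually.of_forall fun x => ?_)
  rw [norm_of_nonneg (by positivity)]
  exact sq_norm_mul_exp_le ht x

/-- The factor `2 ^ (dim / 2)` is the ratio of the masses of `e^{-t|x|²/2}` and `e^{-t|x|²}`. It is
not sharp; any bound of order `1/t` suffices. -/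
lemma integral_sq_norm_mul_exp_le {t : ℝ} (ht : 0 < t) :
    ∫ x : E, ‖x‖ ^ 2 * exp (-t * ‖x‖ ^ 2) ≤ momentConst E / t * gaussMass E t := by
  calc ∫ x : E, ‖x‖ ^ 2 * exp (-t * ‖x‖ ^ 2)
      ≤ ∫ x : E, t⁻¹ * exp (-(t / 2) * ‖x‖ ^ 2) :=
        integral_mono (integrable_sq_norm_mul_exp ht)
          ((integrable_exp_neg_mul_sq_norm (half_pos ht)).const_mul t⁻¹)
          (fun x => sq_norm_mul_exp_le ht x)
    _ = momentConst E / t * gaussMass E t := by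
        rw [integral_const_mul, GaussianFourier.integral_rexp_neg_mul_sq_norm (half_pos ht),
          gaussMass_eq ht, show π / (t / 2) = 2 * (π / t) by field_simp,
          mul_rpow (by norm_num) (by positivity), momentConst]
        ring

/-- The Gaussian **Poincaré inequality**, with a constant that depends on the dimension. -/
theorem gaussian_poincare {t : ℝ} (ht : 0 < t) {h : E → ℝ} (hh : ContDiff ℝ 1 h)
    (hc : HasCompactSupport h) :
    gaussMass E t * (∫ x, h x ^ 2 * exp (-t * ‖x‖ ^ 2)) - (∫ x, h x * exp (-t * ‖x‖ ^ 2)) ^ 2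
      ≤ π ^ 2 / 8 * (momentConst E / t * gaussMass E t) *
        ∫ x, ‖fderiv ℝ h x‖ ^ 2 * exp (-t * ‖x‖ ^ 2) := by
  set w : E → ℝ := fun x => exp (-t * ‖x‖ ^ 2) with hw
  have hwc : Continuous w := by fun_prop
  have hwi : Integrable w := integrable_exp_neg_mul_sq_norm ht
  have hwi2 : Integrable fun x => ‖x‖ ^ 2 * w x := integrable_sq_norm_mul_exp ht
  have hhc := hh.continuous
  have hdc := hh.continuous_fderiv one_ne_zero
  have i1 : Integrable fun x => h x * w x :=
    (hhc.mul hwc).integrable_of_hasCompactSupport hc.mul_right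
  have i2 : Integrable fun x => h x ^ 2 * w x := by
    refine Continuous.integrable_of_hasCompactSupport (by fun_prop) ?_
    simp only [sq]; exact (hc.mul_right).mul_right
  have i3 : Integrable fun x => ‖fderiv ℝ h x‖ ^ 2 * w x := by
    refine Continuous.integrable_of_hasCompactSupport (by fun_prop) ?_
    have : HasCompactSupport fun x => ‖fderiv ℝ h x‖ := (hc.fderiv (𝕜 := ℝ)).norm
    simp only [sq]; exact (this.mul_right).mul_right
  -- the double integral
  have j0 : ∀ {f g : E → ℝ}, Integrable f → Integrable g →
      Integrable fun p : E × E => f p.1 * g p.2 := fun hf hg => hf.mul_prod hg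
  have e0 : ∀ f g : E → ℝ, ∫ p : E × E, f p.1 * g p.2 = (∫ x, f x) * ∫ x, g x := fun f g =>
    integral_prod_mul f g
  -- Twice the unnormalized variance, written as the mean square difference of two independent
  -- copies.
  have hleft : ∫ p : E × E, (h p.2 - h p.1) ^ 2 * (w p.1 * w p.2)
      = 2 * (gaussMass E t * (∫ x, h x ^ 2 * w x) - (∫ x, h x * w x) ^ 2) := by
    have : ∀ p : E × E, (h p.2 - h p.1) ^ 2 * (w p.1 * w p.2)
        = (w p.1 * (h p.2 ^ 2 * w p.2) + (h p.1 ^ 2 * w p.1) * w p.2)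
          - 2 * ((h p.1 * w p.1) * (h p.2 * w p.2)) := fun p => by ring
    simp_rw [this]
    have hsum : Integrable fun p : E × E =>
        w p.1 * (h p.2 ^ 2 * w p.2) + (h p.1 ^ 2 * w p.1) * w p.2 := (j0 hwi i2).add (j0 i2 hwi)
    rw [integral_sub hsum ((j0 i1 i1).const_mul 2), integral_add (j0 hwi i2) (j0 i2 hwi), integral_const_mul, e0 w (fun x => h x ^ 2 * w x),
      e0 (fun x => h x ^ 2 * w x) w, e0 (fun x => h x * w x) (fun x => h x * w x)]
    simp only [gaussMass, hw]
    ring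
  -- The squared velocity of `h` along the quarter circle at angle zero; at any other angle it is
  -- `F` of the rotated pair, because the product of Gaussians is rotation invariant.
  set F : E × E → ℝ := fun p => (fderiv ℝ h p.1 p.2) ^ 2 * (w p.1 * w p.2) with hF
  have hFc : Continuous F := by
    have : Continuous fun p : E × E => fderiv ℝ h p.1 p.2 :=
      (hdc.comp continuous_fst).clm_apply continuous_snd
    fun_prop
  have hFle : ∀ p, F p ≤ (‖fderiv ℝ h p.1‖ ^ 2 * w p.1) * (‖p.2‖ ^ 2 * w p.2) := by
    intro p
    have h1 : (fderiv ℝ h p.1 p.2) ^ 2 ≤ (‖fderiv ℝ h p.1‖ * ‖p.2‖) ^ 2 := by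
      rw [← sq_abs]; gcongr; exact (fderiv ℝ h p.1).le_opNorm p.2
    have h2 : 0 ≤ w p.1 * w p.2 := by positivity
    calc F p ≤ (‖fderiv ℝ h p.1‖ * ‖p.2‖) ^ 2 * (w p.1 * w p.2) :=
          mul_le_mul_of_nonneg_right h1 h2
      _ = _ := by ring
  have hF0 : ∀ p, 0 ≤ F p := fun p => by positivity
  have hFi : Integrable F := (j0 i3 hwi2).mono' hFc.aestronglyMeasurable
    (Filter.Eventually.of_forall fun p => by rw [norm_of_nonneg (hF0 p)]; exact hFle p)
  have hFint : ∫ p, F p ≤ (∫ x, ‖fderiv ℝ h x‖ ^ 2 * w x) *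
      (momentConst E / t * gaussMass E t) := by
    calc ∫ p, F p ≤ ∫ p : E × E, (‖fderiv ℝ h p.1‖ ^ 2 * w p.1) * (‖p.2‖ ^ 2 * w p.2) :=
          integral_mono hFi (j0 i3 hwi2) hFle
      _ = (∫ x, ‖fderiv ℝ h x‖ ^ 2 * w x) * ∫ x, ‖x‖ ^ 2 * w x :=
          e0 (fun x => ‖fderiv ℝ h x‖ ^ 2 * w x) (fun x => ‖x‖ ^ 2 * w x)
      _ ≤ _ := mul_le_mul_of_nonneg_left (integral_sq_norm_mul_exp_le ht)
          (integral_nonneg fun x => by positivity)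
  have hrot : ∀ θ : ℝ, ∫ p, F (ContinuousLinearMap.rotation θ p) = ∫ p, F p := by
    intro θ
    have hmp := measurePreserving_rotation (E := E) θ
    have := integral_map (f := F) hmp.measurable.aemeasurable
      (hFc.aestronglyMeasurable (μ := Measure.map _ volume))
    rwa [hmp.map_eq, eq_comm] at this
  have hFrot : ∀ (θ : ℝ) (p : E × E), F (ContinuousLinearMap.rotation θ p)
      = (fderiv ℝ h (ContinuousLinearMap.rotation θ p).1
          (ContinuousLinearMap.rotation θ p).2) ^ 2 * (w p.1 * w p.2) := by
    intro θ p
    simp only [hF, hw]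
    rw [← exp_add, ← exp_add, ← mul_add, ← mul_add, norm_rotation_sq]
  -- integrability on the product with the angle
  have hcomp : Continuous fun q : ℝ × (E × E) => F (ContinuousLinearMap.rotation q.1 q.2) := by
    refine hFc.comp ?_
    simp only [ContinuousLinearMap.rotation_apply]
    fun_prop
  have hpi : (0 : ℝ) ≤ π / 2 := by positivity
  -- Integrability for Fubini: the integral of `F` over each rotated copy does not depend on the
  -- angle, and the range of angles is finite.
  have hjoint : Integrable (fun q : ℝ × (E × E) => F (ContinuousLinearMap.rotation q.1 q.2))
      ((volume.restrict (Set.Ioc 0 (π / 2))).prod volume) := by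
    rw [integrable_prod_iff hcomp.aestronglyMeasurable]
    refine ⟨Filter.Eventually.of_forall fun θ => ?_, ?_⟩
    · exact ((measurePreserving_rotation (E := E) θ).integrable_comp
        hFc.aestronglyMeasurable).mpr hFi
    · have : ∀ θ : ℝ, ∫ p : E × E, ‖F (ContinuousLinearMap.rotation θ p)‖ = ∫ p, F p := by
        intro θ
        rw [← hrot θ]
        exact integral_congr_ae (Filter.Eventually.of_forall fun p => norm_of_nonneg (hF0 _))
      simp only [this]
      exact integrable_const _
  have hle : ∫ p : E × E, (h p.2 - h p.1) ^ 2 * (w p.1 * w p.2)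
      ≤ ∫ p : E × E, π / 2 * ∫ θ in Set.Ioc 0 (π / 2), F (ContinuousLinearMap.rotation θ p) := by
    refine integral_mono ?_ (hjoint.integral_prod_right.const_mul _) fun p => ?_
    · have : ∀ p : E × E, (h p.2 - h p.1) ^ 2 * (w p.1 * w p.2)
          = (w p.1 * (h p.2 ^ 2 * w p.2) + (h p.1 ^ 2 * w p.1) * w p.2)
            - 2 * ((h p.1 * w p.1) * (h p.2 * w p.2)) := fun p => by ring
      simp_rw [this]
      exact ((j0 hwi i2).add (j0 i2 hwi)).sub ((j0 i1 i1).const_mul 2)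
    · simp only [hFrot]
      rw [integral_mul_const, ← intervalIntegral.integral_of_le hpi, ← mul_assoc (π / 2)]
      have hw0 : 0 ≤ w p.1 * w p.2 := mul_nonneg (exp_pos _).le (exp_pos _).le
      exact mul_le_mul_of_nonneg_right (sq_sub_le_integral_rotation hh p) hw0
  rw [hleft, integral_const_mul, ← integral_integral_swap hjoint] at hle
  simp only [hrot] at hle
  rw [integral_const] at hle
  simp only [measureReal_restrict_apply MeasurableSet.univ, Set.univ_inter, smul_eq_mul,
    Real.volume_real_Ioc_of_le hpi, sub_zero] at hle
  -- One factor `π / 2` comes from Cauchy–Schwarz, the other from the length of the range of angles.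
  -- With the 2 in `hleft` they give `π² / 8`.
  have h4 : π / 2 * (π / 2 * ∫ p, F p) ≤ π / 2 * (π / 2 * ((∫ x, ‖fderiv ℝ h x‖ ^ 2 * w x) *
      (momentConst E / t * gaussMass E t))) := by gcongr
  linarith

end Gaussian

end ConeLaplacian

end

open MeasureTheory
open scoped ContDiff

noncomputable section

namespace ConeLaplacian

/-! ### Operators `∂_j + c x_j`, their commutators and the Weitzenböck formula. -/

section FirstOrder

open scoped RealInnerProductSpace

variable {n : ℕ} {V : Type*} [NormedAddCommGroup V] [InnerProductSpace ℝ V]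

/-- The operator `∂_j + c x_j` on vector-valued functions. -/
def twist (c : ℝ) (j : Fin (n + n)) (u : Coord n → V) : Coord n → V :=
  fun x => fderiv ℝ u x (ee j) + (c * x j) • u x

lemma contDiff_coord (j : Fin (n + n)) : ContDiff ℝ ∞ fun x : Coord n => x j :=
  (dx j).contDiff

lemma fderiv_coord (j k : Fin (n + n)) (x : Coord n) :
    fderiv ℝ (fun x : Coord n => x j) x (ee k) = if j = k then 1 else 0 := by
  have : HasFDerivAt (fun x : Coord n => x j) (dx j) x := (dx j).hasFDerivAt
  rw [this.fderiv]
  simp [ee, dx]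

lemma contDiff_partial {u : Coord n → V} (hu : ContDiff ℝ ∞ u) (v : Coord n) :
    ContDiff ℝ ∞ fun x => fderiv ℝ u x v :=
  (hu.fderiv_right (m := ∞) (by simp)).clm_apply contDiff_const

lemma contDiff_twist {u : Coord n → V} (hu : ContDiff ℝ ∞ u) (c : ℝ) (j : Fin (n + n)) :
    ContDiff ℝ ∞ (twist c j u) :=
  (contDiff_partial hu _).add ((contDiff_const.mul (contDiff_coord j)).smul hu)

lemma hasCompactSupport_partial {u : Coord n → V} (hu : HasCompactSupport u) (v : Coord n) :
    HasCompactSupport fun x => fderiv ℝ u x v :=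
  hu.fderiv_apply (𝕜 := ℝ) v

lemma hasCompactSupport_twist {u : Coord n → V} (hu : HasCompactSupport u) (c : ℝ)
    (j : Fin (n + n)) : HasCompactSupport (twist c j u) :=
  (hasCompactSupport_partial hu _).add (hu.smul_left)

lemma integrable_inner_left {u v : Coord n → V} (hu : Continuous u) (hv : Continuous v)
    (hc : HasCompactSupport u) : Integrable fun x => ⟪u x, v x⟫ := by
  refine (hu.inner hv).integrable_of_hasCompactSupport (hc.mono fun x hx => ?_)
  contrapose! hx
  simp only [Function.mem_support, not_not] at hx ⊢
  rw [hx, inner_zero_left]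

lemma integrable_inner_right {u v : Coord n → V} (hu : Continuous u) (hv : Continuous v)
    (hc : HasCompactSupport v) : Integrable fun x => ⟪u x, v x⟫ := by
  simpa only [real_inner_comm] using integrable_inner_left hv hu hc

/-- Integration by parts: `∂_j + c x_j` and `-(∂_j - c x_j)` are formally adjoint. -/
lemma integral_inner_twist {u v : Coord n → V} (hu : ContDiff ℝ ∞ u) (hv : ContDiff ℝ ∞ v)
    (hc : HasCompactSupport v) (c : ℝ) (j : Fin (n + n)) :
    ∫ x, ⟪twist c j u x, v x⟫ = -∫ x, ⟪u x, twist (-c) j v x⟫ := by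
  have h1 := (contDiff_partial hu (ee j)).continuous
  have h2 := (contDiff_partial hv (ee j)).continuous
  have key := integral_bilinear_hasLineDerivAt_right_eq_neg_left_of_integrable (μ := volume)
    (f := u) (f' := fun x => fderiv ℝ u x (ee j)) (g := v)
    (g' := fun x => fderiv ℝ v x (ee j)) (v := ee j) (B := innerSL ℝ)
    (integrable_inner_right h1 hv.continuous hc)
    (integrable_inner_right hu.continuous h2 (hasCompactSupport_partial hc _))
    (integrable_inner_right hu.continuous hv.continuous hc)
    (fun x _ => ((hu.differentiable (by simp) x).hasFDerivAt).hasLineDerivAt _)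
    (fun x _ => ((hv.differentiable (by simp) x).hasFDerivAt).hasLineDerivAt _)
  replace key : ∫ x, ⟪u x, fderiv ℝ v x (ee j)⟫ = -∫ x, ⟪fderiv ℝ u x (ee j), v x⟫ := key
  have hcu : Continuous fun x : Coord n => (c * x j) • u x :=
    ((contDiff_const.mul (contDiff_coord j)).smul hu).continuous
  have hcv : Continuous fun x : Coord n => (-c * x j) • v x :=
    ((contDiff_const.mul (contDiff_coord j)).smul hv).continuous
  simp only [twist, inner_add_left, inner_add_right]
  rw [integral_add (integrable_inner_right h1 hv.continuous hc)
      (integrable_inner_right hcu hv.continuous hc),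
    integral_add (integrable_inner_right hu.continuous h2 (hasCompactSupport_partial hc _))
      (integrable_inner_right hu.continuous hcv hc.smul_left), key]
  have : ∀ x : Coord n, ⟪(c * x j) • u x, v x⟫ = -⟪u x, (-c * x j) • v x⟫ := fun x => by
    rw [real_inner_smul_left, real_inner_smul_right]; ring
  simp only [this, integral_neg]
  ring

lemma twist_clm {V' : Type*} [NormedAddCommGroup V'] [InnerProductSpace ℝ V']
    {u : Coord n → V} (hu : ContDiff ℝ ∞ u) (B : V →L[ℝ] V') (c : ℝ) (j : Fin (n + n)) :
    twist c j (fun x => B (u x)) = fun x => B (twist c j u x) := by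
  funext x
  have := (B.hasFDerivAt.comp x (hu.differentiable (by simp) x).hasFDerivAt).fderiv
  simp only [twist, map_add, map_smul]
  congr 1
  exact DFunLike.congr_fun this (ee j)

lemma twist_smul {u : Coord n → V} (hu : ContDiff ℝ ∞ u) {χ : Coord n → ℝ}
    (hχ : ContDiff ℝ ∞ χ) (c : ℝ) (j : Fin (n + n)) (x : Coord n) :
    twist c j (fun x => χ x • u x) x = χ x • twist c j u x + fderiv ℝ χ x (ee j) • u x := by
  have := fderiv_fun_smul (hχ.differentiable (by simp) x) (hu.differentiable (by simp) x)
  simp only [twist, this]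
  simp only [_root_.add_apply, _root_.smul_apply,
    ContinuousLinearMap.smulRight_apply]
  module

lemma fderiv_partial_comm {u : Coord n → V} (hu : ContDiff ℝ ∞ u) (x v w : Coord n) :
    fderiv ℝ (fun y => fderiv ℝ u y v) x w = fderiv ℝ (fun y => fderiv ℝ u y w) x v := by
  have hd : DifferentiableAt ℝ (fderiv ℝ u) x :=
    (hu.fderiv_right (m := ∞) (by simp)).differentiable (by simp) x
  have h : ∀ v w : Coord n, fderiv ℝ (fun y => fderiv ℝ u y v) x w
      = fderiv ℝ (fderiv ℝ u) x w v := fun v w => by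
    have := (hd.hasFDerivAt.clm_apply (hasFDerivAt_const v x)).fderiv
    rw [this]; simp
  rw [h, h]
  exact (hu.contDiffAt.isSymmSndFDerivAt (n := ∞)
    (by rw [minSmoothness_of_isRCLikeNormedField]; exact ENat.LEInfty.out)) _ _

/-- The commutation relation `[∂_k + c x_k, ∂_j + d x_j] = (d - c) δ_{jk}`. -/
lemma twist_comm {u : Coord n → V} (hu : ContDiff ℝ ∞ u) (c d : ℝ) (j k : Fin (n + n))
    (x : Coord n) :
    twist c k (twist d j u) x
      = twist d j (twist c k u) x + (if j = k then d - c else 0) • u x := by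
  have hud := hu.differentiable (by simp) x
  have expand : ∀ (d : ℝ) (j k : Fin (n + n)), fderiv ℝ (twist d j u) x (ee k)
      = fderiv ℝ (fun y => fderiv ℝ u y (ee j)) x (ee k) + (d * x j) • fderiv ℝ u x (ee k)
        + (d * if j = k then 1 else 0) • u x := by
    intro d j k
    have h1 : DifferentiableAt ℝ (fun y => fderiv ℝ u y (ee j)) x :=
      (contDiff_partial hu _).differentiable (by simp) x
    have h2 : DifferentiableAt ℝ (fun y : Coord n => d * y j) x :=
      (contDiff_const.mul (contDiff_coord j)).differentiable (by simp) x
    have h3 : fderiv ℝ (fun y : Coord n => d * y j) x (ee k) = d * if j = k then 1 else 0 := by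
      rw [fderiv_const_mul ((contDiff_coord j).differentiable (by simp) x),
        _root_.smul_apply, fderiv_coord, smul_eq_mul]
    unfold twist
    rw [fderiv_fun_add h1 (h2.fun_smul hud), fderiv_fun_smul h2 hud]
    simp only [_root_.add_apply, _root_.smul_apply,
      ContinuousLinearMap.smulRight_apply, h3, add_assoc]
  have e1 := expand d j k
  have e2 := expand c k j
  have e3 := fderiv_partial_comm hu x (ee j) (ee k)
  change fderiv ℝ (twist d j u) x (ee k) + (c * x k) • (fderiv ℝ u x (ee j) + (d * x j) • u x)
    = fderiv ℝ (twist c k u) x (ee j) + (d * x j) • (fderiv ℝ u x (ee k) + (c * x k) • u x) + _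
  rw [e1, e2, e3]
  by_cases h : j = k
  · subst h; simp only [if_true]; module
  · simp only [h, Ne.symm h, if_false]; module

/-- Commuting `∂_j - c_j x_j` and `∂_k + c_k x_k` under the integral sign. -/
lemma integral_inner_twist_twist {u : Coord n → V} (hu : ContDiff ℝ ∞ u)
    (hc : HasCompactSupport u) (B : V →L[ℝ] V) (c : Fin (n + n) → ℝ) (j k : Fin (n + n)) :
    ∫ x, ⟪B (twist (-c j) j u x), twist (-c k) k u x⟫
      = (∫ x, ⟪B (twist (c k) k u x), twist (c j) j u x⟫)
        + (if j = k then 2 * c j else 0) * ∫ x, ⟪B (u x), u x⟫ := by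
  have hB : ∀ {v : Coord n → V}, ContDiff ℝ ∞ v → ContDiff ℝ ∞ fun x => B (v x) :=
    fun hv => B.contDiff.comp hv
  have h1 : ∫ x, ⟪B (twist (-c j) j u x), twist (-c k) k u x⟫
      = -∫ x, ⟪B (twist (c k) k (twist (-c j) j u) x), u x⟫ := by
    have := integral_inner_twist (hB (contDiff_twist hu (-c j) j)) hu hc (c k) k
    rw [twist_clm (contDiff_twist hu _ _)] at this
    rw [this, neg_neg]
  have h2 : ∫ x, ⟪B (twist (c k) k u x), twist (c j) j u x⟫
      = -∫ x, ⟪B (twist (-c j) j (twist (c k) k u) x), u x⟫ := by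
    have := integral_inner_twist (hB (contDiff_twist hu (c k) k)) hu hc (-c j) j
    rw [twist_clm (contDiff_twist hu _ _), neg_neg] at this
    rw [this, neg_neg]
  have h3 : ∀ x, ⟪B (twist (c k) k (twist (-c j) j u) x), u x⟫
      = ⟪B (twist (-c j) j (twist (c k) k u) x), u x⟫
        + (if j = k then -c j - c k else 0) * ⟪B (u x), u x⟫ := fun x => by
    rw [twist_comm hu, map_add, inner_add_left, map_smul, real_inner_smul_left]
  have i1 : Integrable fun x => ⟪B (twist (-c j) j (twist (c k) k u) x), u x⟫ :=
    integrable_inner_right (hB (contDiff_twist (contDiff_twist hu _ _) _ _)).continuous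
      hu.continuous hc
  have i2 : Integrable fun x => ⟪B (u x), u x⟫ :=
    integrable_inner_right (hB hu).continuous hu.continuous hc
  rw [h1, h2]
  simp only [h3]
  rw [integral_add i1 (i2.const_mul _), integral_const_mul]
  by_cases h : j = k
  · subst h; simp only [if_true]; ring
  · simp only [h, if_false]; ring

/-- Creation and annihilation operators differ by their commutator `2c`. This exchanges the sign of
the oscillator in a direction of negative Hessian for a multiple of `‖u‖²`. -/
lemma integral_sq_norm_twist_neg {u : Coord n → V} (hu : ContDiff ℝ ∞ u)
    (hc : HasCompactSupport u) (c : ℝ) (j : Fin (n + n)) :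
    ∫ x, ‖twist (-c) j u x‖ ^ 2 = (∫ x, ‖twist c j u x‖ ^ 2) + 2 * c * ∫ x, ‖u x‖ ^ 2 := by
  have := integral_inner_twist_twist hu hc (ContinuousLinearMap.id ℝ V) (fun _ => c) j j
  simpa using this

/-- The first-order operator `∑_j A_j (∂_j + c_j x_j) + W`. -/
def firstOrder (c : Fin (n + n) → ℝ) (A : Fin (n + n) → V →L[ℝ] V) (W : V →L[ℝ] V)
    (u : Coord n → V) : Coord n → V :=
  fun x => ∑ j, A j (twist (c j) j u x) + W (u x)

variable {A A' : Fin (n + n) → V →L[ℝ] V} {W W' : V →L[ℝ] V} {c : Fin (n + n) → ℝ}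

lemma contDiff_firstOrder {u : Coord n → V} (hu : ContDiff ℝ ∞ u) :
    ContDiff ℝ ∞ (firstOrder c A W u) :=
  (ContDiff.sum fun j _ => (A j).contDiff.comp (contDiff_twist hu _ _)).add (W.contDiff.comp hu)

lemma hasCompactSupport_firstOrder {u : Coord n → V} (hu : HasCompactSupport u) :
    HasCompactSupport (firstOrder c A W u) := by
  refine HasCompactSupport.add ?_ (hu.comp_left (map_zero W))
  have : ∀ s : Finset (Fin (n + n)),
      HasCompactSupport fun x => ∑ j ∈ s, A j (twist (c j) j u x) := by
    intro s
    induction s using Finset.cons_induction with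
    | empty => exact HasCompactSupport.zero
    | cons a s ha ih =>
      simp only [Finset.sum_cons]
      exact ((hasCompactSupport_twist hu _ _).comp_left (map_zero (A a))).add ih
  exact this _

lemma firstOrder_add_apply (u : Coord n → V) (x : Coord n) :
    firstOrder c A W u x = firstOrder c A 0 u x + W (u x) := by
  simp [firstOrder]

/-- The principal symbol `∑_j (∂_j χ) A_j`, applied to `u`. -/
def symbolAct (A : Fin (n + n) → V →L[ℝ] V) (χ : Coord n → ℝ) (u : Coord n → V) : Coord n → V :=
  fun x => ∑ j, fderiv ℝ χ x (ee j) • A j (u x)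

lemma firstOrder_smul {u : Coord n → V} (hu : ContDiff ℝ ∞ u) {χ : Coord n → ℝ}
    (hχ : ContDiff ℝ ∞ χ) (x : Coord n) :
    firstOrder c A W (fun x => χ x • u x) x
      = χ x • firstOrder c A W u x + symbolAct A χ u x := by
  simp only [firstOrder, symbolAct, twist_smul hu hχ, map_add, map_smul, Finset.sum_add_distrib,
    Finset.smul_sum, smul_add]
  abel

lemma continuous_symbolAct {χ : Coord n → ℝ} (hχ : ContDiff ℝ ∞ χ) {u : Coord n → V}
    (hu : Continuous u) : Continuous (symbolAct A χ u) :=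
  continuous_finsetSum _ fun j _ =>
    (contDiff_partial hχ _).continuous.smul ((A j).continuous.comp hu)

lemma integral_inner_firstOrder (hA : ∀ j v w, ⟪A j v, w⟫ = ⟪v, A' j w⟫)
    (hW : ∀ v w, ⟪W v, w⟫ = ⟪v, W' w⟫) {u v : Coord n → V} (hu : ContDiff ℝ ∞ u)
    (hv : ContDiff ℝ ∞ v) (hc : HasCompactSupport v) :
    ∫ x, ⟪firstOrder c A W u x, v x⟫
      = ∫ x, ⟪u x, firstOrder (fun j => -c j) (fun j => -A' j) W' v x⟫ := by
  have hvA : ∀ j, ContDiff ℝ ∞ fun x => A' j (v x) := fun j => (A' j).contDiff.comp hv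
  have hcA : ∀ j, HasCompactSupport fun x => A' j (v x) := fun j => hc.comp_left (map_zero (A' j))
  have key : ∀ j, ∫ x, ⟪A j (twist (c j) j u x), v x⟫
      = ∫ x, ⟪u x, -A' j (twist (-c j) j v x)⟫ := by
    intro j
    simp only [hA, inner_neg_right, integral_neg]
    rw [integral_inner_twist hu (hvA j) (hcA j), twist_clm hv]
  simp only [firstOrder, inner_add_left, inner_add_right, sum_inner, inner_sum, hW,
    _root_.neg_apply]
  have i1 : ∀ j, Integrable fun x => ⟪A j (twist (c j) j u x), v x⟫ := fun j =>
    integrable_inner_right ((A j).continuous.comp (contDiff_twist hu _ _).continuous)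
      hv.continuous hc
  have i2 : ∀ j, Integrable fun x => ⟪u x, -A' j (twist (-c j) j v x)⟫ := fun j =>
    integrable_inner_right hu.continuous
      ((A' j).continuous.comp (contDiff_twist hv _ _).continuous).neg
      (((hasCompactSupport_twist hc _ _).comp_left (map_zero (A' j))).comp_left neg_zero)
  have i3 : Integrable fun x => ⟪u x, W' (v x)⟫ :=
    integrable_inner_right hu.continuous (W'.continuous.comp hv.continuous)
      (hc.comp_left (map_zero W'))
  rw [integral_add (integrable_finsetSum _ fun j _ => i1 j) i3,
    integral_add (integrable_finsetSum _ fun j _ => i2 j) i3,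
    integral_finsetSum _ fun j _ => i1 j, integral_finsetSum _ fun j _ => i2 j]
  simp only [key]

/-- The **Weitzenböck formula** for the Witten Laplacian of a diagonal quadratic function. -/
lemma integral_sq_norm_firstOrder (hA : ∀ j v w, ⟪A j v, w⟫ = ⟪v, A' j w⟫)
    (hCAR : ∀ j k v, A j (A' k v) + A' k (A j v) = if j = k then v else 0)
    {u : Coord n → V} (hu : ContDiff ℝ ∞ u) (hc : HasCompactSupport u) :
    (∫ x, ‖firstOrder c A 0 u x‖ ^ 2)
        + ∫ x, ‖firstOrder (fun j => -c j) (fun j => -A' j) 0 u x‖ ^ 2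
      = ∑ j, ((∫ x, ‖twist (c j) j u x‖ ^ 2) + 2 * c j * ∫ x, ‖A' j (u x)‖ ^ 2) := by
  have hA2 : ∀ j v w, ⟪A' j v, w⟫ = ⟪v, A j w⟫ := fun j v w => by
    rw [real_inner_comm, ← hA, real_inner_comm]
  have hi : ∀ (B : V →L[ℝ] V) (d : Fin (n + n) → ℝ) (j k : Fin (n + n)),
      Integrable fun x => ⟪B (twist (d j) j u x), twist (d k) k u x⟫ := fun B d j k =>
    integrable_inner_right (B.continuous.comp (contDiff_twist hu _ _).continuous)
      (contDiff_twist hu _ _).continuous (hasCompactSupport_twist hc _ _)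
  have e1 : ∫ x, ‖firstOrder c A 0 u x‖ ^ 2
      = ∑ j, ∑ k, ∫ x, ⟪(A' k ∘L A j) (twist (c j) j u x), twist (c k) k u x⟫ := by
    have : ∀ x, ‖firstOrder c A 0 u x‖ ^ 2
        = ∑ j, ∑ k, ⟪(A' k ∘L A j) (twist (c j) j u x), twist (c k) k u x⟫ := fun x => by
      simp only [firstOrder, _root_.zero_apply, add_zero,
        ← real_inner_self_eq_norm_sq, sum_inner, inner_sum, ContinuousLinearMap.comp_apply, hA2]
      exact Finset.sum_comm
    simp only [this]
    rw [integral_finsetSum _ fun j _ => integrable_finsetSum _ fun k _ => hi _ c j k]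
    simp only [integral_finsetSum _ fun k _ => hi _ c _ k]
  have e2 : ∫ x, ‖firstOrder (fun j => -c j) (fun j => -A' j) 0 u x‖ ^ 2
      = ∑ j, ∑ k, ∫ x, ⟪(A k ∘L A' j) (twist (-c j) j u x), twist (-c k) k u x⟫ := by
    have : ∀ x, ‖firstOrder (fun j => -c j) (fun j => -A' j) 0 u x‖ ^ 2
        = ∑ j, ∑ k, ⟪(A k ∘L A' j) (twist (-c j) j u x), twist (-c k) k u x⟫ := fun x => by
      simp only [firstOrder, _root_.zero_apply, add_zero,
        _root_.neg_apply, Finset.sum_neg_distrib, norm_neg,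
        ← real_inner_self_eq_norm_sq, sum_inner, inner_sum, ContinuousLinearMap.comp_apply, hA]
      exact Finset.sum_comm
    simp only [this]
    rw [integral_finsetSum _ fun j _ => integrable_finsetSum _ fun k _ =>
      hi _ (fun j => -c j) j k]
    simp only [integral_finsetSum _ fun k _ => hi _ (fun j => -c j) _ k]
  -- Moving the two derivatives past each other turns the terms of the adjoint into terms in the
  -- operators `∂_j + c_j x_j`, at the cost of the diagonal commutator `2 c_j`.
  have e3 : ∀ j k, ∫ x, ⟪(A k ∘L A' j) (twist (-c j) j u x), twist (-c k) k u x⟫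
      = (∫ x, ⟪(A k ∘L A' j) (twist (c k) k u x), twist (c j) j u x⟫)
        + (if j = k then 2 * c j else 0) * ∫ x, ⟪(A k ∘L A' j) (u x), u x⟫ := fun j k =>
    integral_inner_twist_twist hu hc _ c j k
  have e4 : ∀ j, ∫ x, ⟪(A j ∘L A' j) (u x), u x⟫ = ∫ x, ‖A' j (u x)‖ ^ 2 := fun j => by
    simp only [ContinuousLinearMap.comp_apply, hA, real_inner_self_eq_norm_sq]
  -- Once the indices of the second double sum are exchanged, the two products of `A` and `A'` form
  -- an anticommutator, which kills all off-diagonal terms.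
  have e5 : ∀ j k, (∫ x, ⟪(A' k ∘L A j) (twist (c j) j u x), twist (c k) k u x⟫)
      + ∫ x, ⟪(A j ∘L A' k) (twist (c j) j u x), twist (c k) k u x⟫
      = if j = k then ∫ x, ‖twist (c j) j u x‖ ^ 2 else 0 := fun j k => by
    rw [← integral_add (hi _ c j k) (hi _ c j k)]
    have : ∀ x, ⟪(A' k ∘L A j) (twist (c j) j u x), twist (c k) k u x⟫
        + ⟪(A j ∘L A' k) (twist (c j) j u x), twist (c k) k u x⟫
        = if j = k then ‖twist (c j) j u x‖ ^ 2 else 0 := fun x => by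
      rw [← inner_add_left, ContinuousLinearMap.comp_apply, ContinuousLinearMap.comp_apply,
        add_comm, hCAR]
      split_ifs with h
      · subst h; exact real_inner_self_eq_norm_sq _
      · exact inner_zero_left _
    simp only [this]
    split_ifs <;> simp
  rw [e1, e2]
  simp only [e3, Finset.sum_add_distrib]
  rw [← add_assoc, Finset.sum_comm (f := fun j k =>
      ∫ x, ⟪(A k ∘L A' j) (twist (c k) k u x), twist (c j) j u x⟫)]
  simp only [← Finset.sum_add_distrib, e5, ite_mul, zero_mul, Finset.sum_ite_eq,
    Finset.mem_univ, if_true, e4]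

end FirstOrder

end ConeLaplacian

end

open MeasureTheory
open scoped ContDiff

noncomputable section

namespace ConeLaplacian

/-! ### Spectral gaps combined: coercivity for compactly supported functions. -/

section Coercivity

open scoped RealInnerProductSpace
open Filter Topology

variable {n : ℕ}

lemma sq_norm_eq_sum_sq_apply (l : Coord n →L[ℝ] ℝ) : ‖l‖ ^ 2 = ∑ j, l (ee j) ^ 2 := by
  set y := (InnerProductSpace.toDual ℝ (Coord n)).symm l with hy
  have h1 : ‖l‖ = ‖y‖ := by rw [hy, LinearIsometryEquiv.norm_map]
  have h2 : ∀ j, l (ee j) = y j := fun j => by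
    have : ⟪y, ee j⟫ = l (ee j) := InnerProductSpace.toDual_symm_apply
    rw [← this, ee, EuclideanSpace.inner_single_right]; simp
  rw [h1, EuclideanSpace.norm_sq_eq]
  simp [h2]

/-- The Gaussian `e^{-t|x|²/2}`. -/
def gauss (t : ℝ) (x : Coord n) : ℝ := Real.exp (-t * ‖x‖ ^ 2 / 2)

lemma contDiff_gauss (t : ℝ) : ContDiff ℝ ∞ (gauss (n := n) t) := by
  unfold gauss
  exact ((contDiff_const.mul (contDiff_norm_sq ℝ)).div_const _).exp

lemma fderiv_gauss (t : ℝ) (x : Coord n) (j : Fin (n + n)) :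
    fderiv ℝ (gauss t) x (ee j) = -(t * x j) * gauss t x := by
  have h1 : HasFDerivAt (fun x : Coord n => -t * ‖x‖ ^ 2 / 2)
      ((-t / 2) • ((2 : ℕ) • innerSL ℝ x)) x := by
    have h := ((hasStrictFDerivAt_norm_sq x).hasFDerivAt).const_mul (-t / 2)
    rw [show (fun y : Coord n => -t * ‖y‖ ^ 2 / 2) = fun y => -t / 2 * ‖y‖ ^ 2 by
      funext y; ring]
    exact h
  have h2 : HasFDerivAt (gauss (n := n) t) _ x := h1.exp
  rw [h2.fderiv]
  have : ⟪x, ee j⟫ = x j := by rw [ee, EuclideanSpace.inner_single_right]; simp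
  simp only [_root_.smul_apply, innerSL_apply_apply, this, smul_eq_mul, nsmul_eq_mul, gauss]
  push_cast
  ring

lemma gauss_mul_self (t : ℝ) (x : Coord n) : gauss t x * gauss t x = Real.exp (-t * ‖x‖ ^ 2) := by
  rw [gauss, ← Real.exp_add]; congr 1; ring

lemma gauss_neg_mul (t : ℝ) (x : Coord n) : gauss (-t) x * gauss t x = 1 := by
  rw [gauss, gauss, ← Real.exp_add, ← Real.exp_zero]; congr 1; ring

/-- The constant in the Poincaré inequality on `ℝ²ⁿ`. -/
def poincareConst (n : ℕ) : ℝ := Real.pi ^ 2 / 8 * momentConst (Coord n)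

lemma poincareConst_pos : 0 < poincareConst n := by
  have := momentConst_pos (E := Coord n)
  have := Real.pi_pos
  unfold poincareConst; positivity

/-- The spectral gap of the harmonic oscillator on compactly supported functions. -/
lemma harmonic_gap {t : ℝ} (ht : 0 < t) {v : Coord n → ℝ} (hv : ContDiff ℝ ∞ v)
    (hc : HasCompactSupport v) :
    (∫ x, v x ^ 2) - (∫ x, v x * gauss t x) ^ 2 / gaussMass (Coord n) t
      ≤ poincareConst n / t * ∑ j, ∫ x, twist t j v x ^ 2 := by
  -- Ground state substitution `v = h e^{-t|x|²/2}`: the derivative `∂_j h` is `e^{t|x|²/2} (∂_j + t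
  -- x_j) v`, so the Dirichlet form of `h` for the Gaussian weight is the oscillator energy of `v`.
  set h : Coord n → ℝ := fun x => gauss (-t) x * v x with hh
  have hhs : ContDiff ℝ ∞ h := (contDiff_gauss _).mul hv
  have hhc : HasCompactSupport h := hc.mul_left
  have key := gaussian_poincare ht (hhs.of_le (by exact_mod_cast le_top)) hhc
  have e1 : ∀ x, h x ^ 2 * Real.exp (-t * ‖x‖ ^ 2) = v x ^ 2 := fun x => by
    rw [← gauss_mul_self, hh]
    linear_combination (v x ^ 2 * (gauss (-t) x * gauss t x + 1)) * gauss_neg_mul t x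
  have e2 : ∀ x, h x * Real.exp (-t * ‖x‖ ^ 2) = v x * gauss t x := fun x => by
    rw [← gauss_mul_self, hh]
    linear_combination (v x * gauss t x) * gauss_neg_mul t x
  have e3 : ∀ x, ‖fderiv ℝ h x‖ ^ 2 * Real.exp (-t * ‖x‖ ^ 2) = ∑ j, twist t j v x ^ 2 := fun x => by
    rw [sq_norm_eq_sum_sq_apply, Finset.sum_mul]
    refine Finset.sum_congr rfl fun j _ => ?_
    have : fderiv ℝ h x (ee j) = gauss (-t) x * twist t j v x := by
      have := twist_smul hv (contDiff_gauss (-t)) 0 j x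
      simp only [twist, zero_mul, add_zero, smul_eq_mul, fderiv_gauss] at this ⊢
      rw [hh, this]; ring
    rw [this, ← gauss_mul_self]
    linear_combination (twist t j v x ^ 2 * (gauss (-t) x * gauss t x + 1)) * gauss_neg_mul t x
  simp only [e1, e2, e3] at key
  rw [integral_finsetSum _ fun j _ => by
    have : Continuous fun x => twist t j v x ^ 2 := (contDiff_twist hv t j).continuous.pow 2
    refine this.integrable_of_hasCompactSupport ?_
    simp only [sq]; exact (hasCompactSupport_twist hc t j).mul_right] at key
  have hZ := gaussMass_pos (E := Coord n) ht
  rw [sub_le_iff_le_add, ← sub_le_iff_le_add', poincareConst]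
  have : (∫ x, v x ^ 2) - Real.pi ^ 2 / 8 * momentConst (Coord n) / t *
      ∑ j, ∫ x, twist t j v x ^ 2 ≤ (∫ x, v x * gauss t x) ^ 2 / gaussMass (Coord n) t := by
    rw [le_div_iff₀ hZ]
    calc _ = gaussMass (Coord n) t * (∫ x, v x ^ 2) -
          Real.pi ^ 2 / 8 * (momentConst (Coord n) / t * gaussMass (Coord n) t) *
            ∑ j, ∫ x, twist t j v x ^ 2 := by ring
      _ ≤ _ := by linarith
  linarith

variable {V : Type*} [NormedAddCommGroup V] [InnerProductSpace ℝ V]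

/-- The algebraic data of a deformed cone complex: `A j` is exterior multiplication by `dx_j` with
adjoint `A' j`, `s j` is the sign of the `j`-th Hessian eigenvalue, `W` is a zeroth-order term with
adjoint `W'`, and the orthonormal vectors `p i` span the ground states of the fermionic part. -/
structure IsConeModel (s : Fin (n + n) → ℝ) (A A' : Fin (n + n) → V →L[ℝ] V) (W W' : V →L[ℝ] V)
    (C : ℝ) (p : Fin 2 → V) : Prop where
  sign : ∀ j, s j = 1 ∨ s j = -1
  adj : ∀ j v w, ⟪A j v, w⟫ = ⟪v, A' j w⟫
  adjW : ∀ v w, ⟪W v, w⟫ = ⟪v, W' w⟫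
  car : ∀ j k v, A j (A' k v) + A' k (A j v) = if j = k then v else 0
  bound : ∀ v, ‖W v‖ ^ 2 + ‖W' v‖ ^ 2 ≤ C * ‖v‖ ^ 2
  orthonormal : Orthonormal ℝ p
  gap : ∀ v, ‖v‖ ^ 2 - ∑ i, ⟪p i, v⟫ ^ 2
    ≤ ∑ j, ((1 - s j) / 2 * ‖v‖ ^ 2 + s j * ‖A' j v‖ ^ 2)

/-- The deformed differential of a model. -/
def modelD (s : Fin (n + n) → ℝ) (A : Fin (n + n) → V →L[ℝ] V) (W : V →L[ℝ] V) (t : ℝ) :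
    (Coord n → V) → Coord n → V := firstOrder (fun j => t * s j) A W

/-- The formal adjoint of the deformed differential of a model. -/
def modelDstar (s : Fin (n + n) → ℝ) (A' : Fin (n + n) → V →L[ℝ] V) (W' : V →L[ℝ] V) (t : ℝ) :
    (Coord n → V) → Coord n → V := firstOrder (fun j => -(t * s j)) (fun j => -A' j) W'

/-- The constant in the coercivity estimate. -/
def gapConst (n : ℕ) : ℝ := min 1 (1 / (2 * poincareConst n))

lemma gapConst_pos : 0 < gapConst n := by
  have := poincareConst_pos (n := n)
  unfold gapConst; positivity

/-- The difference of the two sides is `‖a + 2b‖² / 2`. With `b` the zeroth-order term, this removes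
the coupling `W` at the price of half the principal energy. -/
lemma half_sq_norm_sub_le (a b : V) : ‖a‖ ^ 2 / 2 - ‖b‖ ^ 2 ≤ ‖a + b‖ ^ 2 := by
  have h1 := norm_add_sq_real a b
  have h2 : 0 ≤ ‖a + (2 : ℝ) • b‖ ^ 2 := sq_nonneg _
  rw [norm_add_sq_real, real_inner_smul_right, norm_smul, Real.norm_ofNat] at h2
  nlinarith

variable {s : Fin (n + n) → ℝ} {A A' : Fin (n + n) → V →L[ℝ] V} {W W' : V →L[ℝ] V}
  {C : ℝ} {p : Fin 2 → V}

lemma integrable_sq_norm {u : Coord n → V} (hu : Continuous u) (hc : HasCompactSupport u) :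
    Integrable fun x => ‖u x‖ ^ 2 := by
  simpa only [real_inner_self_eq_norm_sq] using integrable_inner_left hu hu hc

lemma integral_sq_norm_firstOrder_ge {c : Fin (n + n) → ℝ} {u : Coord n → V}
    (hu : ContDiff ℝ ∞ u) (hc : HasCompactSupport u) :
    (∫ x, ‖firstOrder c A 0 u x‖ ^ 2) / 2 - ∫ x, ‖W (u x)‖ ^ 2
      ≤ ∫ x, ‖firstOrder c A W u x‖ ^ 2 := by
  have i1 := integrable_sq_norm (contDiff_firstOrder (A := A) (W := 0) (c := c) hu).continuous
    (hasCompactSupport_firstOrder hc)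
  have i2 : Integrable fun x => ‖W (u x)‖ ^ 2 :=
    integrable_sq_norm (W.continuous.comp hu.continuous) (hc.comp_left (map_zero W))
  have i3 := integrable_sq_norm (contDiff_firstOrder (A := A) (W := W) (c := c) hu).continuous
    (hasCompactSupport_firstOrder hc)
  rw [← integral_div, ← integral_sub (i1.div_const 2) i2]
  refine integral_mono ((i1.div_const 2).sub i2) i3 fun x => ?_
  change _ ≤ ‖firstOrder c A W u x‖ ^ 2
  rw [firstOrder_add_apply (W := W)]
  exact half_sq_norm_sub_le (firstOrder c A 0 u x) (W (u x))

/-- Coercivity on compactly supported functions. -/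
lemma IsConeModel.coercive_of_hasCompactSupport (hM : IsConeModel s A A' W W' C p) {t : ℝ}
    (ht : 0 < t) {u : Coord n → V} (hu : ContDiff ℝ ∞ u) (hc : HasCompactSupport u) :
    gapConst n * t * ((∫ x, ‖u x‖ ^ 2)
          - ∑ i, (∫ x, ⟪p i, u x⟫ * gauss t x) ^ 2 / gaussMass (Coord n) t)
        - C * ∫ x, ‖u x‖ ^ 2
      ≤ (∫ x, ‖modelD s A W t u x‖ ^ 2) + ∫ x, ‖modelDstar s A' W' t u x‖ ^ 2 := by
  have h1 := integral_sq_norm_firstOrder_ge (A := A) (W := W) (c := fun j => t * s j) hu hc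
  have h2 := integral_sq_norm_firstOrder_ge (A := fun j => -A' j) (W := W')
    (c := fun j => -(t * s j)) hu hc
  have h3 := integral_sq_norm_firstOrder (c := fun j => t * s j) hM.adj hM.car hu hc
  have iu := integrable_sq_norm hu.continuous hc
  have iA : ∀ j, Integrable fun x => ‖A' j (u x)‖ ^ 2 := fun j =>
    integrable_sq_norm ((A' j).continuous.comp hu.continuous) (hc.comp_left (map_zero (A' j)))
  have iW : Integrable fun x => ‖W (u x)‖ ^ 2 :=
    integrable_sq_norm (W.continuous.comp hu.continuous) (hc.comp_left (map_zero W))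
  have iW' : Integrable fun x => ‖W' (u x)‖ ^ 2 :=
    integrable_sq_norm (W'.continuous.comp hu.continuous) (hc.comp_left (map_zero W'))
  have ip : ∀ i, ContDiff ℝ ∞ fun x => ⟪p i, u x⟫ := fun i => contDiff_const.inner ℝ hu
  have ipc : ∀ i, HasCompactSupport fun x => ⟪p i, u x⟫ := fun i =>
    hc.comp_left (g := fun v => ⟪p i, v⟫) (inner_zero_right _)
  have ip2 : ∀ i, Integrable fun x => ⟪p i, u x⟫ ^ 2 := fun i => by
    simpa using integrable_sq_norm (ip i).continuous (ipc i)
  have h4 : (∫ x, ‖W (u x)‖ ^ 2) + ∫ x, ‖W' (u x)‖ ^ 2 ≤ C * ∫ x, ‖u x‖ ^ 2 := by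
    rw [← integral_add iW iW', ← integral_const_mul]
    exact integral_mono (iW.add iW') (iu.const_mul _) fun x => hM.bound _
  -- Directions with `s j = -1` are rewritten with the oscillator of sign `+t`. The commutator
  -- produces `2t ∫ ‖u‖²`, which becomes the term `(1 - s j) / 2` of the fermionic energy.
  have h5 : ∑ j, ((∫ x, ‖twist (t * s j) j u x‖ ^ 2) + 2 * (t * s j) * ∫ x, ‖A' j (u x)‖ ^ 2)
      = (∑ j, ∫ x, ‖twist t j u x‖ ^ 2)
        + 2 * t * ∑ j, ((1 - s j) / 2 * (∫ x, ‖u x‖ ^ 2) + s j * ∫ x, ‖A' j (u x)‖ ^ 2) := by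
    rw [Finset.mul_sum, ← Finset.sum_add_distrib]
    refine Finset.sum_congr rfl fun j _ => ?_
    rcases hM.sign j with h | h
    · simp only [h, mul_one]; ring
    · have := integral_sq_norm_twist_neg hu hc t j
      simp only [h, mul_neg, mul_one, this]; ring
  have h6 : (∫ x, ‖u x‖ ^ 2) - ∑ i, ∫ x, ⟪p i, u x⟫ ^ 2
      ≤ ∑ j, ((1 - s j) / 2 * (∫ x, ‖u x‖ ^ 2) + s j * ∫ x, ‖A' j (u x)‖ ^ 2) := by
    have iS : ∀ j, Integrable fun x => (1 - s j) / 2 * ‖u x‖ ^ 2 + s j * ‖A' j (u x)‖ ^ 2 :=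
      fun j => (iu.const_mul _).add ((iA j).const_mul _)
    have e1 : (∫ x, ‖u x‖ ^ 2) - ∑ i, ∫ x, ⟪p i, u x⟫ ^ 2
        = ∫ x, (‖u x‖ ^ 2 - ∑ i, ⟪p i, u x⟫ ^ 2) := by
      rw [integral_sub iu (integrable_finsetSum _ fun i _ => ip2 i),
        integral_finsetSum _ fun i _ => ip2 i]
    have e2 : ∑ j, ((1 - s j) / 2 * (∫ x, ‖u x‖ ^ 2) + s j * ∫ x, ‖A' j (u x)‖ ^ 2)
        = ∫ x, ∑ j, ((1 - s j) / 2 * ‖u x‖ ^ 2 + s j * ‖A' j (u x)‖ ^ 2) := by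
      rw [integral_finsetSum _ fun j _ => iS j]
      refine Finset.sum_congr rfl fun j _ => ?_
      rw [integral_add (iu.const_mul _) ((iA j).const_mul _), integral_const_mul,
        integral_const_mul]
    rw [e1, e2]
    exact integral_mono (iu.sub (integrable_finsetSum _ fun i _ => ip2 i))
      (integrable_finsetSum _ fun j _ => iS j) fun x => hM.gap _
  have hbessel : ∀ v : V, ∑ i, ⟪p i, v⟫ ^ 2 ≤ ‖v‖ ^ 2 := fun v => by
    have := hM.orthonormal.sum_inner_products_le v (s := Finset.univ)
    simpa using this
  have h7 : ∑ i, ∫ x, ⟪p i, u x⟫ ^ 2 ≤ ∫ x, ‖u x‖ ^ 2 := by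
    rw [← integral_finsetSum _ fun i _ => ip2 i]
    exact integral_mono (integrable_finsetSum _ fun i _ => ip2 i) iu fun x => hbessel _
  -- Bessel's inequality: projecting to the constant vectors `p i` commutes with `twist` and does
  -- not increase the oscillator energy.
  have h8 : ∑ i, ∑ j, ∫ x, twist t j (fun x => ⟪p i, u x⟫) x ^ 2
      ≤ ∑ j, ∫ x, ‖twist t j u x‖ ^ 2 := by
    rw [Finset.sum_comm]
    refine Finset.sum_le_sum fun j _ => ?_
    have e : ∀ i, twist t j (fun x => ⟪p i, u x⟫) = fun x => ⟪p i, twist t j u x⟫ := fun i =>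
      twist_clm hu (innerSL ℝ (p i)) t j
    have i1 : ∀ i, Integrable fun x => ⟪p i, twist t j u x⟫ ^ 2 := fun i => by
      have := integrable_sq_norm (contDiff_twist (ip i) t j).continuous
        (hasCompactSupport_twist (ipc i) t j)
      rw [e] at this
      simpa using this
    simp only [e]
    rw [← integral_finsetSum _ fun i _ => i1 i]
    exact integral_mono (integrable_finsetSum _ fun i _ => i1 i)
      (integrable_sq_norm (contDiff_twist hu t j).continuous (hasCompactSupport_twist hc t j))
      fun x => hbessel _
  have h9 : (∑ i, ∫ x, ⟪p i, u x⟫ ^ 2)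
        - ∑ i, (∫ x, ⟪p i, u x⟫ * gauss t x) ^ 2 / gaussMass (Coord n) t
      ≤ poincareConst n / t * ∑ j, ∫ x, ‖twist t j u x‖ ^ 2 := by
    have hK := poincareConst_pos (n := n)
    refine le_trans ?_ (mul_le_mul_of_nonneg_left h8 (by positivity))
    rw [← Finset.sum_sub_distrib, Finset.mul_sum]
    exact Finset.sum_le_sum fun i _ => harmonic_gap ht (ip i) (ipc i)
  have hT : 0 ≤ ∑ j, ∫ x, ‖twist t j u x‖ ^ 2 :=
    Finset.sum_nonneg fun j _ => integral_nonneg fun x => sq_nonneg _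
  rw [h5] at h3
  unfold modelD modelDstar
  set a := ∫ x, ‖u x‖ ^ 2
  set b := ∑ i, ∫ x, ⟪p i, u x⟫ ^ 2
  set d := ∑ i, (∫ x, ⟪p i, u x⟫ * gauss t x) ^ 2 / gaussMass (Coord n) t
  set T := ∑ j, ∫ x, ‖twist t j u x‖ ^ 2
  have hK := poincareConst_pos (n := n)
  have hg := gapConst_pos (n := n)
  -- Below, `a - b` is the mass of `u` off the span of the `p i`, controlled by the fermionic gap 1.
  -- The mass `b - d` lies in that span but off the Gaussian and is controlled by half the
  -- oscillator energy. The two entries of the minimum in `gapConst` serve these two parts.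
  have g1 : gapConst n ≤ 1 := min_le_left _ _
  have g2 : gapConst n * (2 * poincareConst n) ≤ 1 := by
    rw [← le_div_iff₀ (by positivity)]; exact min_le_right _ _
  have k1 : gapConst n * t * (b - d) ≤ T / 2 := by
    have : t * (b - d) ≤ poincareConst n * T := by
      calc t * (b - d) ≤ t * (poincareConst n / t * T) := mul_le_mul_of_nonneg_left h9 ht.le
        _ = _ := by field_simp
    nlinarith
  have k2 : gapConst n * t * (a - b) ≤ t * (a - b) := by
    have : 0 ≤ t * (a - b) := mul_nonneg ht.le (by linarith)
    nlinarith
  have k3 := mul_le_mul_of_nonneg_left h6 ht.le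
  have k4 : gapConst n * t * (a - d) = gapConst n * t * (a - b) + gapConst n * t * (b - d) := by
    ring
  linarith

end Coercivity

end ConeLaplacian

end

open MeasureTheory
open scoped ContDiff

noncomputable section

namespace ConeLaplacian

/-! ### Cutoffs: from compact support to smooth square-integrable functions. -/

section Cutoff

open scoped RealInnerProductSpace
open Filter Topology

variable {n : ℕ}

/-- One bump function rescaled by `R + 1`: it equals 1 on the ball of radius `R + 1`, and its
derivative shrinks by the same factor. The shift by 1 makes `R = 0` harmless. -/
lemma exists_cutoff (n : ℕ) : ∃ (χ : ℕ → Coord n → ℝ) (M : ℝ), 0 ≤ M ∧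
    (∀ R, ContDiff ℝ ∞ (χ R)) ∧ (∀ R, HasCompactSupport (χ R)) ∧
    (∀ R x, 0 ≤ χ R x ∧ χ R x ≤ 1) ∧
    (∀ R x j, |fderiv ℝ (χ R) x (ee j)| ≤ M / ((R : ℝ) + 1)) ∧
    ∀ x, Tendsto (fun R => χ R x) atTop (𝓝 1) := by
  let f : ContDiffBump (0 : Coord n) := ⟨1, 2, one_pos, one_lt_two⟩
  have hf : ContDiff ℝ ∞ f := f.contDiff
  obtain ⟨M, hM⟩ := (f.hasCompactSupport.fderiv (𝕜 := ℝ)).exists_bound_of_continuous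
    (hf.continuous_fderiv (by simp))
  have hM0 : 0 ≤ M := (norm_nonneg _).trans (hM 0)
  have hpos : ∀ R : ℕ, (0 : ℝ) < (R : ℝ) + 1 := fun R => by positivity
  refine ⟨fun R x => f (((R : ℝ) + 1)⁻¹ • x), M, hM0, fun R => hf.comp (by fun_prop),
    fun R => ?_, fun R x => ⟨f.nonneg, f.le_one⟩, fun R x j => ?_, fun x => ?_⟩
  · exact f.hasCompactSupport.comp_smul (inv_ne_zero (hpos R).ne')
  · have h1 : HasFDerivAt (fun x : Coord n => ((R : ℝ) + 1)⁻¹ • x)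
        (((R : ℝ) + 1)⁻¹ • ContinuousLinearMap.id ℝ (Coord n)) x :=
      (((R : ℝ) + 1)⁻¹ • ContinuousLinearMap.id ℝ (Coord n)).hasFDerivAt
    have h2 := ((hf.differentiable (by simp) _).hasFDerivAt.comp x h1).fderiv
    have h3 : fderiv ℝ (fun x => f (((R : ℝ) + 1)⁻¹ • x)) x (ee j)
        = ((R : ℝ) + 1)⁻¹ * fderiv ℝ f (((R : ℝ) + 1)⁻¹ • x) (ee j) := by
      refine (DFunLike.congr_fun h2 (ee j)).trans ?_
      simp
    have h4 : ‖ee j‖ = 1 := by simp [ee]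
    rw [h3, abs_mul, abs_of_pos (inv_pos.2 (hpos R)), inv_mul_eq_div]
    gcongr
    calc |fderiv ℝ f (((R : ℝ) + 1)⁻¹ • x) (ee j)|
        ≤ ‖fderiv ℝ f (((R : ℝ) + 1)⁻¹ • x)‖ * ‖ee j‖ :=
          (fderiv ℝ f (((R : ℝ) + 1)⁻¹ • x)).le_opNorm _
      _ ≤ M := by rw [h4, mul_one]; exact hM _
  · refine tendsto_const_nhds.congr' ?_
    filter_upwards [eventually_ge_atTop ⌈‖x‖⌉₊] with R hR
    refine (f.one_of_mem_closedBall ?_).symm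
    rw [mem_closedBall_zero_iff, norm_smul, norm_inv, Real.norm_of_nonneg (hpos R).le]
    change _ ≤ (1 : ℝ)
    rw [inv_mul_le_one₀ (hpos R)]
    have : ‖x‖ ≤ R := (Nat.le_ceil _).trans (by exact_mod_cast hR)
    linarith

lemma tendsto_integral_cutoff {χ : ℕ → Coord n → ℝ} (hs : ∀ R, ContDiff ℝ ∞ (χ R))
    (h01 : ∀ R x, 0 ≤ χ R x ∧ χ R x ≤ 1) (h1 : ∀ x, Tendsto (fun R => χ R x) atTop (𝓝 1))
    {g : Coord n → ℝ} (hg : Integrable g) (k : ℕ) :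
    Tendsto (fun R => ∫ x, χ R x ^ k * g x) atTop (𝓝 (∫ x, g x)) := by
  refine tendsto_integral_of_dominated_convergence (fun x => ‖g x‖)
    (fun R => ((hs R).continuous.pow k).aestronglyMeasurable.mul hg.aestronglyMeasurable) hg.norm
    (fun R => Eventually.of_forall fun x => ?_) (Eventually.of_forall fun x => ?_)
  · rw [norm_mul, norm_pow, Real.norm_of_nonneg (h01 R x).1]
    exact mul_le_of_le_one_left (norm_nonneg _) (pow_le_one₀ (h01 R x).1 (h01 R x).2)
  · simpa using ((h1 x).pow k).mul_const (g x)

variable {V : Type*} [NormedAddCommGroup V] [InnerProductSpace ℝ V]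

lemma integrable_inner_of_memLp {u v : Coord n → V} (hu : MemLp u 2) (hv : MemLp v 2) :
    Integrable fun x => ⟪u x, v x⟫ := by
  refine (MemLp.integrable_mul hu.norm hv.norm).mono'
    (hu.aestronglyMeasurable.inner hv.aestronglyMeasurable)
    (Eventually.of_forall fun x => norm_inner_le_norm _ _)

lemma integrable_sq_norm_of_memLp {u : Coord n → V} (hu : MemLp u 2) :
    Integrable fun x => ‖u x‖ ^ 2 := by
  simpa only [real_inner_self_eq_norm_sq] using integrable_inner_of_memLp hu hu

lemma sq_norm_symbolAct_le (A : Fin (n + n) → V →L[ℝ] V) {χ : Coord n → ℝ} {ε : ℝ}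
    (hχ : ∀ x j, |fderiv ℝ χ x (ee j)| ≤ ε) (u : Coord n → V) (x : Coord n) :
    ‖symbolAct A χ u x‖ ^ 2 ≤ ε ^ 2 * (∑ j, ‖A j‖) ^ 2 * ‖u x‖ ^ 2 := by
  have : ‖symbolAct A χ u x‖ ≤ ε * (∑ j, ‖A j‖) * ‖u x‖ := by
    rw [Finset.mul_sum, Finset.sum_mul]
    refine (norm_sum_le _ _).trans (Finset.sum_le_sum fun j _ => ?_)
    rw [norm_smul, mul_assoc]
    exact mul_le_mul (hχ x j) ((A j).le_opNorm _) (norm_nonneg _) ((abs_nonneg _).trans (hχ x j))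
  calc _ ≤ (ε * (∑ j, ‖A j‖) * ‖u x‖) ^ 2 := by gcongr
    _ = _ := by ring

lemma hasCompactSupport_symbolAct (A : Fin (n + n) → V →L[ℝ] V) {χ : Coord n → ℝ}
    (hc : HasCompactSupport χ) (u : Coord n → V) : HasCompactSupport (symbolAct A χ u) := by
  refine (hc.fderiv (𝕜 := ℝ)).mono fun x hx => ?_
  contrapose! hx
  simp only [Function.mem_support, not_not] at hx ⊢
  simp [symbolAct, hx]

lemma symbolAct_mul_self (A : Fin (n + n) → V →L[ℝ] V) {χ : Coord n → ℝ}
    (hχ : ContDiff ℝ ∞ χ) (u : Coord n → V) (x : Coord n) :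
    symbolAct A (fun x => χ x * χ x) u x = (2 * χ x) • symbolAct A χ u x := by
  have hd := hχ.differentiable (by simp) x
  simp only [symbolAct, fderiv_fun_mul hd hd, _root_.add_apply, _root_.smul_apply, smul_eq_mul,
    Finset.smul_sum, smul_smul]
  refine Finset.sum_congr rfl fun j _ => ?_
  congr 1; ring

variable {A A' : Fin (n + n) → V →L[ℝ] V} {W W' : V →L[ℝ] V} {c : Fin (n + n) → ℝ}

/-- Integration by parts against `χ² w`. -/
lemma integral_sq_cutoff_inner (hA : ∀ j v w, ⟪A j v, w⟫ = ⟪v, A' j w⟫)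
    (hW : ∀ v w, ⟪W v, w⟫ = ⟪v, W' w⟫) {χ : Coord n → ℝ} (hχ : ContDiff ℝ ∞ χ)
    (hc : HasCompactSupport χ) {ρ w : Coord n → V} (hρ : ContDiff ℝ ∞ ρ) (hw : ContDiff ℝ ∞ w) :
    ∫ x, χ x ^ 2 * ⟪firstOrder c A W ρ x, w x⟫
      = ∫ x, (χ x ^ 2 * ⟪ρ x, firstOrder (fun j => -c j) (fun j => -A' j) W' w x⟫
          + 2 * χ x * ⟪ρ x, symbolAct (fun j => -A' j) χ w x⟫) := by
  have hχ2 : ContDiff ℝ ∞ fun x => χ x * χ x := hχ.mul hχ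
  have key := integral_inner_firstOrder (c := c) (v := fun x => (χ x * χ x) • w x) hA hW hρ
    (hχ2.smul hw)
    (hc.mul_right (f' := χ)).smul_right
  have e1 : ∀ x, χ x ^ 2 * ⟪firstOrder c A W ρ x, w x⟫
      = ⟪firstOrder c A W ρ x, (χ x * χ x) • w x⟫ := fun x => by
    rw [real_inner_smul_right]; ring
  simp only [e1]
  refine key.trans (integral_congr_ae (Eventually.of_forall fun x => ?_))
  have := firstOrder_smul (c := fun j => -c j) (A := fun j => -A' j) (W := W') hw hχ2 x
  beta_reduce
  rw [this, symbolAct_mul_self _ hχ, inner_add_right, real_inner_smul_right,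
    real_inner_smul_right]
  ring

/-- The localization formula for `P P^*`. -/
lemma integral_sq_cutoff_inner_self (hA : ∀ j v w, ⟪A j v, w⟫ = ⟪v, A' j w⟫)
    (hW : ∀ v w, ⟪W v, w⟫ = ⟪v, W' w⟫) {χ : Coord n → ℝ} (hχ : ContDiff ℝ ∞ χ)
    (hc : HasCompactSupport χ) {σ : Coord n → V} (hσ : ContDiff ℝ ∞ σ) :
    ∫ x, χ x ^ 2 * ⟪firstOrder c A W (firstOrder (fun j => -c j) (fun j => -A' j) W' σ) x, σ x⟫
      = (∫ x, ‖firstOrder (fun j => -c j) (fun j => -A' j) W' (fun x => χ x • σ x) x‖ ^ 2)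
        - ∫ x, ‖symbolAct (fun j => -A' j) χ σ x‖ ^ 2 := by
  rw [integral_sq_cutoff_inner hA hW hχ hc (contDiff_firstOrder hσ) hσ, ← integral_sub]
  · refine integral_congr_ae (Eventually.of_forall fun x => ?_)
    beta_reduce
    -- Completing the square: with `Q` the adjoint operator and `q` its symbol at `dχ`, `χ²|Qσ|² +
    -- 2χ⟨Qσ, qσ⟩ = |Q(χσ)|² - |qσ|²`. The derivatives of `σ` thus enter only through `Q(χσ)`.
    rw [firstOrder_smul hσ hχ, norm_add_sq_real, norm_smul, mul_pow, Real.norm_eq_abs, sq_abs,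
      real_inner_smul_left, real_inner_self_eq_norm_sq]
    ring
  · exact integrable_sq_norm (contDiff_firstOrder (hχ.smul hσ)).continuous
      (hasCompactSupport_firstOrder hc.smul_right)
  · exact integrable_sq_norm (continuous_symbolAct hχ hσ.continuous)
      (hasCompactSupport_symbolAct _ hc _)

variable {s : Fin (n + n) → ℝ} {C : ℝ} {p : Fin 2 → V}

/-- The Laplacian of a model. -/
def modelLap (s : Fin (n + n) → ℝ) (A A' : Fin (n + n) → V →L[ℝ] V) (W W' : V →L[ℝ] V) (t : ℝ)
    (u : Coord n → V) : Coord n → V :=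
  modelD s A W t (modelDstar s A' W' t u) + modelDstar s A' W' t (modelD s A W t u)

lemma contDiff_modelD {t : ℝ} {u : Coord n → V} (hu : ContDiff ℝ ∞ u) :
    ContDiff ℝ ∞ (modelD s A W t u) := contDiff_firstOrder hu

lemma contDiff_modelDstar {t : ℝ} {u : Coord n → V} (hu : ContDiff ℝ ∞ u) :
    ContDiff ℝ ∞ (modelDstar s A' W' t u) := contDiff_firstOrder hu

lemma IsConeModel.adj' (hM : IsConeModel s A A' W W' C p) (j : Fin (n + n)) (v w : V) :
    ⟪(-A' j) v, w⟫ = ⟪v, (-A j) w⟫ := by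
  simp only [_root_.neg_apply, inner_neg_left, inner_neg_right]
  rw [real_inner_comm, ← hM.adj, real_inner_comm]

lemma IsConeModel.adjW' (hM : IsConeModel s A A' W W' C p) (v w : V) : ⟪W' v, w⟫ = ⟪v, W w⟫ := by
  rw [real_inner_comm, ← hM.adjW, real_inner_comm]

lemma integrable_sq_cutoff_inner {χ : Coord n → ℝ} (hχ : ContDiff ℝ ∞ χ)
    (hc : HasCompactSupport χ) {u v : Coord n → V} (hu : Continuous u) (hv : Continuous v) :
    Integrable fun x => χ x ^ 2 * ⟪u x, v x⟫ := by
  refine Continuous.integrable_of_hasCompactSupport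
    ((hχ.continuous.pow 2).mul (hu.inner hv)) ?_
  simp only [sq]
  exact hc.mul_right.mul_right

/-- The localization formula for the Laplacian. -/
lemma IsConeModel.integral_sq_cutoff_modelLap (hM : IsConeModel s A A' W W' C p) (t : ℝ)
    {χ : Coord n → ℝ} (hχ : ContDiff ℝ ∞ χ) (hc : HasCompactSupport χ) {σ : Coord n → V}
    (hσ : ContDiff ℝ ∞ σ) :
    ∫ x, χ x ^ 2 * ⟪modelLap s A A' W W' t σ x, σ x⟫
      = ((∫ x, ‖modelD s A W t (fun x => χ x • σ x) x‖ ^ 2)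
          + ∫ x, ‖modelDstar s A' W' t (fun x => χ x • σ x) x‖ ^ 2)
        - ((∫ x, ‖symbolAct A χ σ x‖ ^ 2) + ∫ x, ‖symbolAct (fun j => -A' j) χ σ x‖ ^ 2) := by
  have h1 := integral_sq_cutoff_inner_self (c := fun j => t * s j) hM.adj hM.adjW hχ hc hσ
  have h2 := integral_sq_cutoff_inner_self (c := fun j => -(t * s j)) hM.adj' hM.adjW' hχ hc hσ
  simp only [neg_neg] at h2
  simp only [modelLap, Pi.add_apply, inner_add_left, mul_add]
  rw [integral_add (integrable_sq_cutoff_inner hχ hc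
      (contDiff_modelD (contDiff_modelDstar hσ)).continuous hσ.continuous)
    (integrable_sq_cutoff_inner hχ hc
      (contDiff_modelDstar (contDiff_modelD hσ)).continuous hσ.continuous)]
  unfold modelD modelDstar
  rw [h1, h2]
  ring

/-- Coercivity of the Laplacian on smooth square-integrable functions. -/
theorem IsConeModel.coercive (hM : IsConeModel s A A' W W' C p) {t : ℝ} (ht : 0 < t)
    {σ : Coord n → V} (hσ : ContDiff ℝ ∞ σ) (hσ2 : MemLp σ 2)
    (hL2 : MemLp (modelLap s A A' W W' t σ) 2) :
    gapConst n * t * ((∫ x, ‖σ x‖ ^ 2)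
          - ∑ i, (∫ x, ⟪p i, σ x⟫ * gauss t x) ^ 2 / gaussMass (Coord n) t)
        - C * ∫ x, ‖σ x‖ ^ 2
      ≤ ∫ x, ⟪modelLap s A A' W W' t σ x, σ x⟫ := by
  obtain ⟨χ, M, hM0, hs, hc, h01, hb, h1⟩ := exists_cutoff n
  have iσ := integrable_sq_norm_of_memLp hσ2
  have iL := integrable_inner_of_memLp hL2 hσ2
  have ig : MemLp (fun x : Coord n => gauss t x) 2 := by
    rw [memLp_two_iff_integrable_sq (contDiff_gauss t).continuous.aestronglyMeasurable]
    simp only [sq (gauss t _), gauss_mul_self]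
    exact integrable_exp_neg_mul_sq_norm (E := Coord n) ht
  have ip : ∀ i, Integrable fun x => ⟪p i, σ x⟫ * gauss t x := fun i =>
    MemLp.integrable_mul (hσ2.const_inner (p i)) ig
  set B := (∑ j, ‖A j‖) ^ 2 + (∑ j, ‖-A' j‖) ^ 2 with hB
  have lim1 := tendsto_integral_cutoff hs h01 h1 iσ 2
  have lim2 := fun i => tendsto_integral_cutoff hs h01 h1 (ip i) 1
  have lim3 := tendsto_integral_cutoff hs h01 h1 iL 2
  have lim4 : Tendsto (fun R : ℕ => M / ((R : ℝ) + 1)) atTop (𝓝 0) := by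
    simpa [div_eq_mul_inv] using (tendsto_one_div_add_atTop_nhds_zero_nat (𝕜 := ℝ)).const_mul M
  have limL : Tendsto (fun R => gapConst n * t * ((∫ x, χ R x ^ 2 * ‖σ x‖ ^ 2)
          - ∑ i, (∫ x, χ R x ^ 1 * (⟪p i, σ x⟫ * gauss t x)) ^ 2 / gaussMass (Coord n) t)
        - C * ∫ x, χ R x ^ 2 * ‖σ x‖ ^ 2) atTop
      (𝓝 (gapConst n * t * ((∫ x, ‖σ x‖ ^ 2)
          - ∑ i, (∫ x, ⟪p i, σ x⟫ * gauss t x) ^ 2 / gaussMass (Coord n) t)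
        - C * ∫ x, ‖σ x‖ ^ 2)) :=
    ((lim1.sub (tendsto_finsetSum _ fun i _ => ((lim2 i).pow 2).div_const _)).const_mul _).sub
      (lim1.const_mul C)
  have limR : Tendsto (fun R : ℕ => (∫ x, χ R x ^ 2 * ⟪modelLap s A A' W W' t σ x, σ x⟫)
      + (M / ((R : ℝ) + 1)) ^ 2 * B * ∫ x, ‖σ x‖ ^ 2) atTop
      (𝓝 (∫ x, ⟪modelLap s A A' W W' t σ x, σ x⟫)) := by
    simpa using lim3.add (((lim4.pow 2).mul_const B).mul_const (∫ x, ‖σ x‖ ^ 2))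
  -- For fixed `R` the compactly supported estimate is applied to `χσ`. By the localization formula
  -- its energy exceeds the cut-off integral of `⟨Δσ, σ⟩` by at most `O(R⁻²) ‖σ‖²`, so integrability
  -- of the derivatives of `σ` is never used.
  refine le_of_tendsto_of_tendsto' limL limR fun R => ?_
  have k1 := hM.coercive_of_hasCompactSupport ht (u := fun x => χ R x • σ x) ((hs R).smul hσ)
    (hc R).smul_right
  have k2 := hM.integral_sq_cutoff_modelLap t (hs R) (hc R) hσ
  have k3 : ∀ A₀ : Fin (n + n) → V →L[ℝ] V, ∫ x, ‖symbolAct A₀ (χ R) σ x‖ ^ 2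
      ≤ (M / ((R : ℝ) + 1)) ^ 2 * (∑ j, ‖A₀ j‖) ^ 2 * ∫ x, ‖σ x‖ ^ 2 := fun A₀ => by
    rw [← integral_const_mul]
    exact integral_mono (integrable_sq_norm (continuous_symbolAct (hs R) hσ.continuous)
      (hasCompactSupport_symbolAct _ (hc R) _)) (iσ.const_mul _)
      fun x => sq_norm_symbolAct_le A₀ (hb R) σ x
  have e1 : ∀ x, ‖χ R x • σ x‖ ^ 2 = χ R x ^ 2 * ‖σ x‖ ^ 2 := fun x => by
    rw [norm_smul, mul_pow, Real.norm_eq_abs, sq_abs]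
  have e2 : ∀ i x, ⟪p i, χ R x • σ x⟫ * gauss t x = χ R x ^ 1 * (⟪p i, σ x⟫ * gauss t x) :=
    fun i x => by rw [real_inner_smul_right]; ring
  simp only [e1, e2] at k1
  have k4 := k3 A
  have k5 := k3 fun j => -A' j
  rw [hB]
  linarith

/-- The image of the Laplacian is orthogonal to the kernel of the complex. -/
theorem IsConeModel.integral_inner_modelLap_eq_zero (hM : IsConeModel s A A' W W' C p) (t : ℝ)
    {σ w : Coord n → V} (hσ : ContDiff ℝ ∞ σ) (hσ2 : MemLp σ 2)
    (hL2 : MemLp (modelLap s A A' W W' t σ) 2) (hw : ContDiff ℝ ∞ w) (hw2 : MemLp w 2)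
    (hD : modelD s A W t w = 0) (hDs : modelDstar s A' W' t w = 0) :
    ∫ x, ⟪modelLap s A A' W W' t σ x, w x⟫ = 0 := by
  obtain ⟨χ, M, hM0, hs, hc, h01, hb, h1⟩ := exists_cutoff n
  have iσ := integrable_sq_norm_of_memLp hσ2
  have iw := integrable_sq_norm_of_memLp hw2
  have iL := integrable_inner_of_memLp hL2 hσ2
  have iLw := integrable_inner_of_memLp hL2 hw2
  set B := (∑ j, ‖A j‖) ^ 2 + (∑ j, ‖-A' j‖) ^ 2 with hB
  -- A bound, uniform in `R`, for twice the total energy of `χσ` plus twice the symbol terms of `σ`.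
  -- The localization formula bounds the energy by `∫ ‖⟨Δσ, σ⟩‖` plus these symbol terms, whence the
  -- coefficient 4.
  set K := 2 * (∫ x, ‖⟪modelLap s A A' W W' t σ x, σ x⟫‖) + 4 * M ^ 2 * B * ∫ x, ‖σ x‖ ^ 2
    with hK
  have lim3 := tendsto_integral_cutoff hs h01 h1 iLw 2
  have lim4 : Tendsto (fun R : ℕ => 1 / ((R : ℝ) + 1) * (K + M ^ 2 * B * ∫ x, ‖w x‖ ^ 2)) atTop
      (𝓝 0) := by
    simpa using (tendsto_one_div_add_atTop_nhds_zero_nat (𝕜 := ℝ)).mul_const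
      (K + M ^ 2 * B * ∫ x, ‖w x‖ ^ 2)
  refine tendsto_nhds_unique lim3 (squeeze_zero_norm (fun R => ?_) lim4)
  -- As `w` is closed and coclosed, integration by parts against `χ² w` leaves only products of a
  -- first-order operator on `σ` with the symbol of `dχ` on `w`. They are split by the
  -- arithmetic–geometric mean with weight `ε`: the energy is bounded and carries `ε`, while the
  -- squared symbol is `O(ε²)` and carries `ε⁻¹`. The total is `O(ε)`.
  set ε : ℝ := 1 / ((R : ℝ) + 1) with hε
  have hε0 : 0 < ε := by positivity
  have hε1 : ε ≤ 1 := by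
    rw [hε, div_le_one (by positivity)]
    have : (0 : ℝ) ≤ R := R.cast_nonneg
    linarith
  have hMε : M / ((R : ℝ) + 1) = M * ε := by rw [hε]; ring
  have k3 : ∀ (A₀ : Fin (n + n) → V →L[ℝ] V) {u : Coord n → V}, Continuous u → MemLp u 2 →
      ∫ x, ‖symbolAct A₀ (χ R) u x‖ ^ 2
      ≤ (M * ε) ^ 2 * (∑ j, ‖A₀ j‖) ^ 2 * ∫ x, ‖u x‖ ^ 2 := fun A₀ {u} hu hu2 => by
    rw [← integral_const_mul]
    exact integral_mono (integrable_sq_norm (continuous_symbolAct (hs R) hu)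
      (hasCompactSupport_symbolAct _ (hc R) _)) ((integrable_sq_norm_of_memLp hu2).const_mul _)
      fun x => sq_norm_symbolAct_le A₀ (fun x j => (hb R x j).trans_eq hMε) u x
  -- one half of the Laplacian
  have half : ∀ {A₁ A₂ : Fin (n + n) → V →L[ℝ] V} {W₁ W₂ : V →L[ℝ] V} {c : Fin (n + n) → ℝ},
      (∀ j v w, ⟪A₁ j v, w⟫ = ⟪v, A₂ j w⟫) → (∀ v w, ⟪W₁ v, w⟫ = ⟪v, W₂ w⟫) →
      firstOrder (fun j => -c j) (fun j => -A₂ j) W₂ w = 0 →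
      |∫ x, χ R x ^ 2 *
          ⟪firstOrder c A₁ W₁ (firstOrder (fun j => -c j) (fun j => -A₂ j) W₂ σ) x, w x⟫|
        ≤ ε * (2 * (∫ x, ‖firstOrder (fun j => -c j) (fun j => -A₂ j) W₂
              (fun x => χ R x • σ x) x‖ ^ 2)
            + 2 * ∫ x, ‖symbolAct (fun j => -A₂ j) (χ R) σ x‖ ^ 2)
          + ε⁻¹ * ∫ x, ‖symbolAct (fun j => -A₂ j) (χ R) w x‖ ^ 2 := by
    intro A₁ A₂ W₁ W₂ c hA hW h0
    rw [integral_sq_cutoff_inner hA hW (hs R) (hc R) (contDiff_firstOrder hσ) hw, h0]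
    set Q := firstOrder (fun j => -c j) (fun j => -A₂ j) W₂ with hQ
    have i1 : Integrable fun x => ‖Q (fun x => χ R x • σ x) x‖ ^ 2 :=
      integrable_sq_norm (contDiff_firstOrder ((hs R).smul hσ)).continuous
        (hasCompactSupport_firstOrder (hc R).smul_right)
    have i2 : ∀ {u : Coord n → V}, ContDiff ℝ ∞ u →
        Integrable fun x => ‖symbolAct (fun j => -A₂ j) (χ R) u x‖ ^ 2 := fun hu =>
      integrable_sq_norm (continuous_symbolAct (hs R) hu.continuous)
        (hasCompactSupport_symbolAct _ (hc R) _)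
    simp only [Pi.zero_apply, inner_zero_right, mul_zero, zero_add]
    have i3 : Integrable fun x => ε * (2 * ‖Q (fun x => χ R x • σ x) x‖ ^ 2
          + 2 * ‖symbolAct (fun j => -A₂ j) (χ R) σ x‖ ^ 2)
        + ε⁻¹ * ‖symbolAct (fun j => -A₂ j) (χ R) w x‖ ^ 2 :=
      (((i1.const_mul 2).add ((i2 hσ).const_mul 2)).const_mul ε).add ((i2 hw).const_mul _)
    have e3 : ∫ x, (ε * (2 * ‖Q (fun x => χ R x • σ x) x‖ ^ 2
          + 2 * ‖symbolAct (fun j => -A₂ j) (χ R) σ x‖ ^ 2)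
        + ε⁻¹ * ‖symbolAct (fun j => -A₂ j) (χ R) w x‖ ^ 2)
        = ε * (2 * (∫ x, ‖Q (fun x => χ R x • σ x) x‖ ^ 2)
            + 2 * ∫ x, ‖symbolAct (fun j => -A₂ j) (χ R) σ x‖ ^ 2)
          + ε⁻¹ * ∫ x, ‖symbolAct (fun j => -A₂ j) (χ R) w x‖ ^ 2 := by
      have i4 : Integrable fun x => 2 * ‖Q (fun x => χ R x • σ x) x‖ ^ 2
          + 2 * ‖symbolAct (fun j => -A₂ j) (χ R) σ x‖ ^ 2 :=
        (i1.const_mul 2).add ((i2 hσ).const_mul 2)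
      rw [integral_add (i4.const_mul ε) ((i2 hw).const_mul _), integral_const_mul,
        integral_const_mul, integral_add (i1.const_mul 2) ((i2 hσ).const_mul 2),
        integral_const_mul, integral_const_mul]
    rw [← e3, ← Real.norm_eq_abs]
    refine norm_integral_le_of_norm_le i3 (Eventually.of_forall fun x => ?_)
    have hsm := firstOrder_smul (c := fun j => -c j) (A := fun j => -A₂ j) (W := W₂) hσ (hs R) x
    rw [← hQ] at hsm
    set a := symbolAct (fun j => -A₂ j) (χ R) σ x
    set b := symbolAct (fun j => -A₂ j) (χ R) w x
    set q := Q (fun x => χ R x • σ x) x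
    have hq : χ R x • Q σ x = q - a := by rw [hsm]; abel
    have h5 : ‖q - a‖ ^ 2 ≤ 2 * ‖q‖ ^ 2 + 2 * ‖a‖ ^ 2 := by
      have := parallelogram_law_with_norm ℝ q a
      nlinarith [sq_nonneg ‖q + a‖]
    have h6 : |2 * χ R x * ⟪Q σ x, b⟫| ≤ 2 * ‖q - a‖ * ‖b‖ := by
      rw [mul_assoc, ← real_inner_smul_left, hq, abs_mul, abs_two, mul_assoc]
      exact mul_le_mul_of_nonneg_left (abs_real_inner_le_norm _ _) zero_le_two
    have h7 : 2 * ‖q - a‖ * ‖b‖ ≤ ε * ‖q - a‖ ^ 2 + ε⁻¹ * ‖b‖ ^ 2 := by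
      have h8 : 0 ≤ ε⁻¹ * (ε * ‖q - a‖ - ‖b‖) ^ 2 := by positivity
      have h9 : ε⁻¹ * (ε * ‖q - a‖ - ‖b‖) ^ 2
          = ε * ‖q - a‖ ^ 2 + ε⁻¹ * ‖b‖ ^ 2 - 2 * ‖q - a‖ * ‖b‖ := by
        field_simp; ring
      linarith
    rw [Real.norm_eq_abs]
    calc _ ≤ ε * ‖q - a‖ ^ 2 + ε⁻¹ * ‖b‖ ^ 2 := h6.trans h7
      _ ≤ _ := by gcongr
  have b1 := half (c := fun j => t * s j) hM.adj hM.adjW hDs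
  have b2 := half (c := fun j => -(t * s j)) hM.adj' hM.adjW' (by simp only [neg_neg]; exact hD)
  simp only [neg_neg] at b2
  have e0 : ∫ x, χ R x ^ 2 * ⟪modelLap s A A' W W' t σ x, w x⟫
      = (∫ x, χ R x ^ 2 * ⟪modelD s A W t (modelDstar s A' W' t σ) x, w x⟫)
        + ∫ x, χ R x ^ 2 * ⟪modelDstar s A' W' t (modelD s A W t σ) x, w x⟫ := by
    simp only [modelLap, Pi.add_apply, inner_add_left, mul_add]
    exact integral_add (integrable_sq_cutoff_inner (hs R) (hc R)
        (contDiff_modelD (contDiff_modelDstar hσ)).continuous hw.continuous)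
      (integrable_sq_cutoff_inner (hs R) (hc R)
        (contDiff_modelDstar (contDiff_modelD hσ)).continuous hw.continuous)
  have k2 := hM.integral_sq_cutoff_modelLap t (hs R) (hc R) hσ
  have k6 : ∫ x, χ R x ^ 2 * ⟪modelLap s A A' W W' t σ x, σ x⟫
      ≤ ∫ x, ‖⟪modelLap s A A' W W' t σ x, σ x⟫‖ := by
    refine integral_mono (integrable_sq_cutoff_inner (hs R) (hc R)
      ((contDiff_modelD (contDiff_modelDstar hσ)).add
        (contDiff_modelDstar (contDiff_modelD hσ))).continuous hσ.continuous) iL.norm fun x => ?_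
    calc _ ≤ ‖χ R x ^ 2 * ⟪modelLap s A A' W W' t σ x, σ x⟫‖ := le_abs_self _
      _ ≤ _ := by
        rw [norm_mul, norm_pow, Real.norm_of_nonneg (h01 R x).1]
        exact mul_le_of_le_one_left (norm_nonneg _) (pow_le_one₀ (h01 R x).1 (h01 R x).2)
  have c1 := k3 A hσ.continuous hσ2
  have c2 := k3 (fun j => -A' j) hσ.continuous hσ2
  have c3 := k3 A hw.continuous hw2
  have c4 := k3 (fun j => -A' j) hw.continuous hw2
  rw [e0, Real.norm_eq_abs]
  refine (abs_add_le _ _).trans ((add_le_add b1 b2).trans ?_)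
  unfold modelD modelDstar at k2
  set x1 := ∫ x, ‖symbolAct A (χ R) σ x‖ ^ 2
  set x2 := ∫ x, ‖symbolAct (fun j => -A' j) (χ R) σ x‖ ^ 2
  set x3 := ∫ x, ‖symbolAct A (χ R) w x‖ ^ 2
  set x4 := ∫ x, ‖symbolAct (fun j => -A' j) (χ R) w x‖ ^ 2
  have iσ0 : 0 ≤ ∫ x, ‖σ x‖ ^ 2 := integral_nonneg fun x => sq_nonneg _
  have hB0 : 0 ≤ B := by positivity
  have d1 : x1 + x2 ≤ M ^ 2 * B * ∫ x, ‖σ x‖ ^ 2 := by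
    have : (M * ε) ^ 2 * B * (∫ x, ‖σ x‖ ^ 2) ≤ M ^ 2 * B * ∫ x, ‖σ x‖ ^ 2 := by
      rw [mul_pow]
      gcongr
      exact mul_le_of_le_one_right (sq_nonneg _) (pow_le_one₀ hε0.le hε1)
    rw [hB] at this ⊢
    linarith
  have d2 : ε⁻¹ * (x3 + x4) ≤ ε * (M ^ 2 * B * ∫ x, ‖w x‖ ^ 2) := by
    rw [inv_mul_le_iff₀ hε0, hB]
    calc _ ≤ _ := add_le_add c3 c4
      _ = _ := by ring
  have d3 := mul_le_mul_of_nonneg_left (a := ε) (show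
    2 * ((∫ x, ‖firstOrder (fun j => t * s j) A W (fun x => χ R x • σ x) x‖ ^ 2) +
      ∫ x, ‖firstOrder (fun j => -(t * s j)) (fun j => -A' j) W' (fun x => χ R x • σ x) x‖ ^ 2)
      + 2 * (x1 + x2) ≤ K by rw [hK]; linarith) hε0.le
  linarith

end Cutoff

end ConeLaplacian

end

open MeasureTheory
open scoped ContDiff

noncomputable section

namespace ConeLaplacian

/-! ### Gaussian ground states with linear correction, and the spectral consequences. -/

section GroundStates

open scoped RealInnerProductSpace
open Filter Topology

variable {n : ℕ} {V : Type*} [NormedAddCommGroup V] [InnerProductSpace ℝ V]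

/-- Cauchy–Schwarz, from the discriminant of the non-negative quadratic polynomial `s ↦ ∫ ‖u + s
v‖²`. -/
lemma sq_integral_inner_le {u v : Coord n → V} (hu : MemLp u 2) (hv : MemLp v 2) :
    (∫ x, ⟪u x, v x⟫) ^ 2 ≤ (∫ x, ‖u x‖ ^ 2) * ∫ x, ‖v x‖ ^ 2 := by
  have i1 := integrable_sq_norm_of_memLp hu
  have i2 := integrable_sq_norm_of_memLp hv
  have i3 := integrable_inner_of_memLp hu hv
  have h : ∀ s : ℝ, 0 ≤ (∫ x, ‖v x‖ ^ 2) * (s * s) + (2 * ∫ x, ⟪u x, v x⟫) * s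
      + ∫ x, ‖u x‖ ^ 2 := fun s => by
    have e : ∫ x, ‖u x + s • v x‖ ^ 2 = (∫ x, ‖v x‖ ^ 2) * (s * s)
        + (2 * ∫ x, ⟪u x, v x⟫) * s + ∫ x, ‖u x‖ ^ 2 := by
      have : ∀ x, ‖u x + s • v x‖ ^ 2
          = ‖v x‖ ^ 2 * (s * s) + ⟪u x, v x⟫ * (2 * s) + ‖u x‖ ^ 2 := fun x => by
        rw [norm_add_sq_real, real_inner_smul_right, norm_smul, mul_pow, Real.norm_eq_abs, sq_abs]
        ring
      simp only [this]
      have i4 : Integrable fun x => ‖v x‖ ^ 2 * (s * s) + ⟪u x, v x⟫ * (2 * s) :=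
        (i2.mul_const _).add (i3.mul_const _)
      rw [integral_add i4 i1,
        integral_add (i2.mul_const _) (i3.mul_const _), integral_mul_const, integral_mul_const]
      ring
    rw [← e]
    exact integral_nonneg fun x => sq_nonneg _
  have := discrim_le_zero h
  rw [discrim] at this
  nlinarith

lemma eq_zero_of_integral_sq_norm_eq_zero {u : Coord n → V} (hu : Continuous u) (hu2 : MemLp u 2)
    (h : ∫ x, ‖u x‖ ^ 2 ≤ 0) : u = 0 := by
  have h0 := le_antisymm h (integral_nonneg fun x => sq_nonneg _)
  rw [integral_eq_zero_iff_of_nonneg (fun x => sq_nonneg _) (integrable_sq_norm_of_memLp hu2)] at h0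
  have h1 := Continuous.ae_eq_iff_eq volume (hu.norm.pow 2) continuous_zero |>.1 h0
  funext x
  simpa using congrFun h1 x

variable {A A' : Fin (n + n) → V →L[ℝ] V} {W W' : V →L[ℝ] V} {c : Fin (n + n) → ℝ}

lemma firstOrder_sub {u v : Coord n → V} (hu : ContDiff ℝ ∞ u) (hv : ContDiff ℝ ∞ v) :
    firstOrder c A W (u - v) = firstOrder c A W u - firstOrder c A W v := by
  funext x
  have := fderiv_sub (hu.differentiable (by simp) x) (hv.differentiable (by simp) x)
  simp only [firstOrder, twist, this, Pi.sub_apply, _root_.sub_apply, map_sub, map_add, smul_sub,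
    Finset.sum_add_distrib, Finset.sum_sub_distrib]
  abel

lemma firstOrder_const_smul {u : Coord n → V} (hu : ContDiff ℝ ∞ u) (a : ℝ) :
    firstOrder c A W (a • u) = a • firstOrder c A W u := by
  funext x
  have := fderiv_const_smul (hu.differentiable (by simp) x) a
  simp only [firstOrder, twist, this, Pi.smul_apply, _root_.smul_apply, map_smul, map_add,
    Finset.smul_sum, smul_add, smul_comm a]

/-- The function `e^{-t|x|²/2} (p + L x)`. -/
def gaussAffine (t : ℝ) (p : V) (L : Coord n →L[ℝ] V) (x : Coord n) : V := gauss t x • (p + L x)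

lemma contDiff_gaussAffine (t : ℝ) (p : V) (L : Coord n →L[ℝ] V) :
    ContDiff ℝ ∞ (gaussAffine t p L) :=
  (contDiff_gauss t).smul (contDiff_const.add L.contDiff)

lemma twist_gaussAffine (t c : ℝ) (p : V) (L : Coord n →L[ℝ] V) (j : Fin (n + n)) (x : Coord n) :
    twist c j (gaussAffine t p L) x
      = gauss t x • (L (ee j) + ((c - t) * x j) • (p + L x)) := by
  have h1 : ContDiff ℝ ∞ fun x => p + L x := contDiff_const.add L.contDiff
  have h2 := twist_smul h1 (contDiff_gauss (n := n) t) c j x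
  have h3 : fderiv ℝ (fun x => p + L x) x = L := by
    rw [fderiv_const_add]; exact L.fderiv
  rw [fderiv_gauss] at h2
  refine h2.trans ?_
  rw [twist, h3]
  module

/-- Reduces closedness of a state to polynomial identities in `x`. The derivative of the linear part
and the coupling `W` appear directly, and the derivative of the Gaussian shifts each `c j` to `c j -
t`, which vanishes for every direction with `c j = t`. -/
lemma firstOrder_gaussAffine (t : ℝ) (p : V) (L : Coord n →L[ℝ] V) (x : Coord n) :
    firstOrder c A W (gaussAffine t p L) x
      = gauss t x • (∑ j, A j (L (ee j)) + ∑ j, ((c j - t) * x j) • A j (p + L x)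
          + W (p + L x)) := by
  have h : ∀ j, A j (gauss t x • (L (ee j) + ((c j - t) * x j) • (p + L x)))
      = gauss t x • (A j (L (ee j)) + ((c j - t) * x j) • A j (p + L x)) := fun j => by
    rw [map_smul, map_add, map_smul]
  simp only [firstOrder, twist_gaussAffine, h]
  rw [gaussAffine, map_smul, ← Finset.smul_sum, ← smul_add, Finset.sum_add_distrib]

/-- The linear correction is smaller than the Gaussian by a factor `1/t` in squared norm; multiplied
by the gap of order `t`, it contributes only a constant. -/
lemma integral_sq_norm_gauss_smul_le {t : ℝ} (ht : 0 < t) {L : Coord n →L[ℝ] V}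
    (hL : ∀ x, ‖L x‖ ≤ ‖x‖) :
    MemLp (fun x => gauss t x • L x) 2 ∧
      ∫ x, ‖gauss t x • L x‖ ^ 2 ≤ momentConst (Coord n) / t * gaussMass (Coord n) t := by
  have hc : Continuous fun x => gauss t x • L x :=
    (contDiff_gauss t).continuous.smul L.continuous
  have hle : ∀ x, ‖gauss t x • L x‖ ^ 2 ≤ ‖x‖ ^ 2 * Real.exp (-t * ‖x‖ ^ 2) := fun x => by
    rw [norm_smul, mul_pow, Real.norm_eq_abs, sq_abs, sq (gauss t x), gauss_mul_self, mul_comm]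
    gcongr
    exact hL x
  have hi : Integrable fun x => ‖gauss t x • L x‖ ^ 2 :=
    (integrable_sq_norm_mul_exp ht).mono' (hc.norm.pow 2).aestronglyMeasurable
      (Eventually.of_forall fun x => by
        rw [Real.norm_of_nonneg (sq_nonneg _)]; exact hle x)
  exact ⟨(memLp_two_iff_integrable_sq_norm hc.aestronglyMeasurable).2 hi,
    (integral_mono hi (integrable_sq_norm_mul_exp ht) hle).trans (integral_sq_norm_mul_exp_le ht)⟩

lemma memLp_gauss {t : ℝ} (ht : 0 < t) : MemLp (gauss (n := n) t) 2 := by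
  rw [memLp_two_iff_integrable_sq (contDiff_gauss t).continuous.aestronglyMeasurable]
  simp only [sq (gauss t _), gauss_mul_self]
  exact integrable_exp_neg_mul_sq_norm (E := Coord n) ht

lemma memLp_gauss_smul_const {t : ℝ} (ht : 0 < t) (p : V) :
    MemLp (fun x : Coord n => gauss t x • p) 2 := by
  refine ((memLp_gauss ht).norm.mul_const ‖p‖).of_le
    ((contDiff_gauss t).continuous.smul continuous_const).aestronglyMeasurable
    (Eventually.of_forall fun x => ?_)
  rw [norm_smul, norm_mul, norm_norm, norm_norm]

lemma memLp_gaussAffine {t : ℝ} (ht : 0 < t) (p : V) {L : Coord n →L[ℝ] V}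
    (hL : ∀ x, ‖L x‖ ≤ ‖x‖) : MemLp (gaussAffine t p L) 2 := by
  have := (memLp_gauss_smul_const ht p).add (integral_sq_norm_gauss_smul_le ht hL).1
  refine this.ae_eq (Eventually.of_forall fun x => ?_)
  simp [gaussAffine]

variable {s : Fin (n + n) → ℝ} {C : ℝ} {p : Fin 2 → V} {L : Fin 2 → Coord n →L[ℝ] V}

/-- The additive constant in the eigenvalue bound. -/
def lossConst (n : ℕ) (C : ℝ) : ℝ := C + 2 * gapConst n * momentConst (Coord n)

/-- The ground states `e^{-t|x|²/2} (p_i + L_i x)` of a model: linear perturbations of the Gaussians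
which are closed and coclosed and pointwise orthogonal to each other. -/
structure HasGroundStates (s : Fin (n + n) → ℝ) (A A' : Fin (n + n) → V →L[ℝ] V) (W W' : V →L[ℝ] V)
    (p : Fin 2 → V) (L : Fin 2 → Coord n →L[ℝ] V) : Prop where
  norm_le : ∀ i x, ‖L i x‖ ≤ ‖x‖
  closed : ∀ t i, modelD s A W t (gaussAffine t (p i) (L i)) = 0
  coclosed : ∀ t i, modelDstar s A' W' t (gaussAffine t (p i) (L i)) = 0
  orthogonal : ∀ x, ⟪p 0 + L 0 x, p 1 + L 1 x⟫ = 0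

/-- The bound on the orthogonal complement of the ground states. -/
theorem IsConeModel.bound_of_orthogonal (hM : IsConeModel s A A' W W' C p)
    (hG : HasGroundStates s A A' W W' p L) {t : ℝ} (ht : 0 < t)
    {σ : Coord n → V} (hσ : ContDiff ℝ ∞ σ) (hσ2 : MemLp σ 2)
    (hL2 : MemLp (modelLap s A A' W W' t σ) 2)
    (horth : ∀ i, ∫ x, ⟪σ x, gaussAffine t (p i) (L i) x⟫ = 0) :
    (gapConst n * t - lossConst n C) * ∫ x, ‖σ x‖ ^ 2
      ≤ ∫ x, ⟪modelLap s A A' W W' t σ x, σ x⟫ := by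
  have key := hM.coercive ht hσ hσ2 hL2
  have hZ := gaussMass_pos (E := Coord n) ht
  have hg := gapConst_pos (n := n)
  have hi : ∀ i, (∫ x, ⟪p i, σ x⟫ * gauss t x) ^ 2 / gaussMass (Coord n) t
      ≤ momentConst (Coord n) / t * ∫ x, ‖σ x‖ ^ 2 := fun i => by
    obtain ⟨h1, h2⟩ := integral_sq_norm_gauss_smul_le ht (hG.norm_le i)
    -- Orthogonality to `gauss • (p i + L i x)` replaces the component of `σ` along the pure
    -- Gaussian by its component along the small correction.
    have e : ∫ x, ⟪p i, σ x⟫ * gauss t x = -∫ x, ⟪gauss t x • L i x, σ x⟫ := by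
      rw [eq_neg_iff_add_eq_zero, ← horth i, ← integral_add]
      · refine integral_congr_ae (Eventually.of_forall fun x => ?_)
        beta_reduce
        rw [gaussAffine, real_inner_smul_left, real_inner_smul_right, inner_add_right,
          real_inner_comm (σ x), real_inner_comm (σ x)]
        ring
      · exact MemLp.integrable_mul (hσ2.const_inner (p i)) (memLp_gauss ht)
      · exact integrable_inner_of_memLp h1 hσ2
    rw [e, neg_sq, div_le_iff₀ hZ]
    calc _ ≤ _ := sq_integral_inner_le h1 hσ2
      _ ≤ momentConst (Coord n) / t * gaussMass (Coord n) t * ∫ x, ‖σ x‖ ^ 2 := by gcongr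
      _ = _ := by ring
  -- Each of the two ground states loses `gapConst * t * (momentConst / t)`, hence the summand `2 *
  -- gapConst * momentConst` of `lossConst`.
  have hs := add_le_add (hi 0) (hi 1)
  rw [Fin.sum_univ_two] at key
  have e2 : gapConst n * t * (momentConst (Coord n) / t * (∫ x, ‖σ x‖ ^ 2)
      + momentConst (Coord n) / t * ∫ x, ‖σ x‖ ^ 2)
      = 2 * gapConst n * momentConst (Coord n) * ∫ x, ‖σ x‖ ^ 2 := by
    field_simp; ring
  have h3 := mul_le_mul_of_nonneg_left hs (mul_pos hg ht).le
  rw [e2] at h3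
  rw [lossConst]
  linarith

/-- Non-zero eigenvalues are large. -/
theorem IsConeModel.eigenvalue_gt (hM : IsConeModel s A A' W W' C p)
    (hG : HasGroundStates s A A' W W' p L) {t : ℝ} (ht : 0 < t)
    (htC : 2 * lossConst n C < gapConst n * t)
    {σ : Coord n → V} {lam : ℝ} (hσ : ContDiff ℝ ∞ σ) (hσ2 : MemLp σ 2)
    (heig : modelLap s A A' W W' t σ = lam • σ) (hne : modelLap s A A' W W' t σ ≠ 0) :
    gapConst n / 2 * t < lam := by
  have hL2 : MemLp (modelLap s A A' W W' t σ) 2 := by rw [heig]; exact hσ2.const_smul lam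
  have hlam : lam ≠ 0 := fun h => hne (by rw [heig, h, zero_smul])
  have hσ0 : σ ≠ 0 := fun h => hne (by rw [heig, h, smul_zero])
  -- `lam ⟨σ, g⟩ = ⟨Δσ, g⟩ = 0` for each ground state `g`, and `lam ≠ 0`.
  have horth : ∀ i, ∫ x, ⟪σ x, gaussAffine t (p i) (L i) x⟫ = 0 := fun i => by
    have := hM.integral_inner_modelLap_eq_zero t hσ hσ2 hL2 (contDiff_gaussAffine t (p i) (L i))
      (memLp_gaussAffine ht _ (hG.norm_le i)) (hG.closed t i) (hG.coclosed t i)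
    rw [heig] at this
    simp only [Pi.smul_apply, real_inner_smul_left, integral_const_mul] at this
    exact (mul_eq_zero.1 this).resolve_left hlam
  have h1 := hM.bound_of_orthogonal hG ht hσ hσ2 hL2 horth
  rw [heig] at h1
  simp only [Pi.smul_apply, real_inner_smul_left, integral_const_mul,
    real_inner_self_eq_norm_sq] at h1
  have h2 : 0 < ∫ x, ‖σ x‖ ^ 2 := by
    by_contra h
    exact hσ0 (eq_zero_of_integral_sq_norm_eq_zero hσ.continuous hσ2 (not_lt.1 h))
  -- This gives `gapConst * t - lossConst ≤ lam`; by the hypothesis on `t` the loss is less than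
  -- half of the gap term.
  have h3 := le_of_mul_le_mul_right h1 h2
  linarith

/-- The kernel consists of the ground states. -/
theorem IsConeModel.mem_span_of_modelLap_eq_zero (hM : IsConeModel s A A' W W' C p)
    (hG : HasGroundStates s A A' W W' p L) {t : ℝ} (ht : 0 < t)
    (htC : lossConst n C < gapConst n * t)
    {σ : Coord n → V} (hσ : ContDiff ℝ ∞ σ) (hσ2 : MemLp σ 2)
    (hker : modelLap s A A' W W' t σ = 0) :
    ∃ a b : ℝ, σ = a • gaussAffine t (p 0) (L 0) + b • gaussAffine t (p 1) (L 1) := by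
  set g : Fin 2 → Coord n → V := fun i => gaussAffine t (p i) (L i) with hg
  have hgs : ∀ i, ContDiff ℝ ∞ (g i) := fun i => contDiff_gaussAffine _ _ _
  have hg2 : ∀ i, MemLp (g i) 2 := fun i => memLp_gaussAffine ht _ (hG.norm_le i)
  have hg01 : ∀ x, ⟪g 0 x, g 1 x⟫ = 0 := fun x => by
    simp only [hg, gaussAffine, real_inner_smul_left, real_inner_smul_right, hG.orthogonal,
      mul_zero]
  have hgpos : ∀ i, ∫ x, ‖g i x‖ ^ 2 ≠ 0 := fun i h => by
    have h0 := congrFun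
      (eq_zero_of_integral_sq_norm_eq_zero (hgs i).continuous (hg2 i) h.le) 0
    have : gauss t (0 : Coord n) ≠ 0 := (Real.exp_pos _).ne'
    simp only [hg, gaussAffine, map_zero, add_zero, Pi.zero_apply, smul_eq_zero, this,
      false_or] at h0
    simpa [h0] using hM.orthonormal.1 i
  set a : Fin 2 → ℝ := fun i => (∫ x, ⟪σ x, g i x⟫) / ∫ x, ‖g i x‖ ^ 2 with ha
  -- The two ground states are orthogonal, so subtracting the separate projections makes `ρ`
  -- orthogonal to both. It stays in the kernel, and the lower bound then has a positive coefficient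
  -- and forces `ρ = 0`.
  set ρ : Coord n → V := σ - a 0 • g 0 - a 1 • g 1 with hρ
  have hρs : ContDiff ℝ ∞ ρ :=
    (hσ.sub (contDiff_const.smul (hgs 0))).sub (contDiff_const.smul (hgs 1))
  have hρ2 : MemLp ρ 2 := (hσ2.sub ((hg2 0).const_smul _)).sub ((hg2 1).const_smul _)
  have hsub : ∀ {c : Fin (n + n) → ℝ} {A₀ : Fin (n + n) → V →L[ℝ] V} {W₀ : V →L[ℝ] V},
      firstOrder c A₀ W₀ (g 0) = 0 → firstOrder c A₀ W₀ (g 1) = 0 →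
      firstOrder c A₀ W₀ ρ = firstOrder c A₀ W₀ σ := by
    intro c A₀ W₀ h0 h1
    have s0 : ContDiff ℝ ∞ (a 0 • g 0) := contDiff_const.smul (hgs 0)
    have s1 : ContDiff ℝ ∞ (a 1 • g 1) := contDiff_const.smul (hgs 1)
    have s2 : ContDiff ℝ ∞ (σ - a 0 • g 0) := hσ.sub s0
    rw [hρ, firstOrder_sub s2 s1, firstOrder_sub hσ s0, firstOrder_const_smul (hgs 0),
      firstOrder_const_smul (hgs 1), h0, h1]
    simp
  have hLρ : modelLap s A A' W W' t ρ = 0 := by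
    rw [← hker]
    unfold modelLap modelD modelDstar
    rw [hsub (hG.closed t 0) (hG.closed t 1), hsub (hG.coclosed t 0) (hG.coclosed t 1)]
  have horth : ∀ i, ∫ x, ⟪ρ x, g i x⟫ = 0 := by
    have e : ∀ i, ∫ x, ⟪ρ x, g i x⟫ = (∫ x, ⟪σ x, g i x⟫) - a 0 * (∫ x, ⟪g 0 x, g i x⟫)
        - a 1 * ∫ x, ⟪g 1 x, g i x⟫ := fun i => by
      have i0 := integrable_inner_of_memLp hσ2 (hg2 i)
      have i1 := integrable_inner_of_memLp (hg2 0) (hg2 i)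
      have i2 := integrable_inner_of_memLp (hg2 1) (hg2 i)
      simp only [hρ, Pi.sub_apply, Pi.smul_apply, inner_sub_left, real_inner_smul_left]
      have i3 : Integrable fun x => ⟪σ x, g i x⟫ - a 0 * ⟪g 0 x, g i x⟫ := i0.sub (i1.const_mul _)
      rw [integral_sub i3 (i2.const_mul _), integral_sub i0 (i1.const_mul _), integral_const_mul, integral_const_mul]
    have z01 : ∫ x, ⟪g 0 x, g 1 x⟫ = 0 := by simp only [hg01, integral_zero]
    have z10 : ∫ x, ⟪g 1 x, g 0 x⟫ = 0 := by
      simp only [real_inner_comm (g 0 _), hg01, integral_zero]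
    intro i
    fin_cases i
    · simp only [Fin.zero_eta, e, z10, real_inner_self_eq_norm_sq, ha, div_mul_cancel₀ _ (hgpos 0)]
      simp
    · simp only [Fin.mk_one, e, z01, real_inner_self_eq_norm_sq, ha, div_mul_cancel₀ _ (hgpos 1)]
      simp
  have h1 := hM.bound_of_orthogonal hG ht hρs hρ2 (by rw [hLρ]; exact MemLp.zero) horth
  rw [hLρ] at h1
  simp only [Pi.zero_apply, inner_zero_left, integral_zero] at h1
  have h2 : ∫ x, ‖ρ x‖ ^ 2 ≤ 0 := by
    by_contra h
    have := mul_pos (sub_pos.2 htC) (not_le.1 h)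
    linarith
  have h3 := eq_zero_of_integral_sq_norm_eq_zero hρs.continuous hρ2 h2
  refine ⟨a 0, a 1, ?_⟩
  rw [hρ, sub_sub, sub_eq_zero] at h3
  exact h3

end GroundStates

end ConeLaplacian

end

open MeasureTheory
open scoped ContDiff

noncomputable section

namespace ConeLaplacian

/-! ### Exterior and interior multiplication on covectors, and their adjointness. -/

section Covectors

open scoped RealInnerProductSpace

variable {n : ℕ}

/-- The exterior algebra of the dual of `ℝ²ⁿ`. -/
abbrev Cov (n : ℕ) := (k : ℕ) → Coord n [⋀^Fin k]→L[ℝ] ℝ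

/-- Exterior multiplication by a covector. -/
def extCov (α : Coord n →L[ℝ] ℝ) : Cov n →ₗ[ℝ] Cov n where
  toFun a
    | 0 => 0
    | k + 1 => ContinuousAlternatingMap.alternatizeUncurryFin (α.smulRight (a k))
  map_add' a b := by
    funext k
    cases k with
    | zero => simp
    | succ k =>
      simp only [Pi.add_apply, ← ContinuousAlternatingMap.alternatizeUncurryFin_add]
      congr 1
      ext; simp
  map_smul' r a := by
    funext k
    cases k with
    | zero => simp
    | succ k =>
      simp only [Pi.smul_apply, RingHom.id_apply,
        ← ContinuousAlternatingMap.alternatizeUncurryFin_smul]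
      congr 1
      ext; simp [mul_left_comm]

/-- Interior multiplication by a vector. -/
def intCov (z : Coord n) : Cov n →ₗ[ℝ] Cov n where
  toFun a k := (a (k + 1)).curryLeft z
  map_add' a b := by funext k; simp
  map_smul' r a := by funext k; simp

lemma extCov_zero_apply (α : Coord n →L[ℝ] ℝ) (a : Cov n) : extCov α a 0 = 0 := rfl

lemma extCov_succ_apply (α : Coord n →L[ℝ] ℝ) (a : Cov n) (k : ℕ) (v : Fin (k + 1) → Coord n) :
    extCov α a (k + 1) v = ∑ i : Fin (k + 1), (-1 : ℝ) ^ (i : ℕ) * (α (v i) * a k (i.removeNth v)) := by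
  simp [extCov, ContinuousAlternatingMap.alternatizeUncurryFin_apply]

lemma intCov_apply (z : Coord n) (a : Cov n) (k : ℕ) (v : Fin k → Coord n) :
    intCov z a k v = a (k + 1) (Matrix.vecCons z v) := rfl

lemma cov_ext {a b : Cov n} (h : ∀ k v, a k v = b k v) : a = b := by
  funext k; ext v; exact h k v

lemma extCov_add (α β : Coord n →L[ℝ] ℝ) : extCov (α + β) = extCov α + extCov β := by
  refine LinearMap.ext fun a => cov_ext fun k v => ?_
  cases k with
  | zero => simp [extCov_zero_apply]
  | succ k =>
    simp only [LinearMap.add_apply, Pi.add_apply, ContinuousAlternatingMap.add_apply,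
      extCov_succ_apply, ← Finset.sum_add_distrib, _root_.add_apply]
    exact Finset.sum_congr rfl fun i _ => by ring

lemma extCov_smul (r : ℝ) (α : Coord n →L[ℝ] ℝ) : extCov (r • α) = r • extCov α := by
  refine LinearMap.ext fun a => cov_ext fun k v => ?_
  cases k with
  | zero => simp [extCov_zero_apply]
  | succ k =>
    simp only [LinearMap.smul_apply, Pi.smul_apply, ContinuousAlternatingMap.smul_apply,
      extCov_succ_apply, Finset.mul_sum, _root_.smul_apply, smul_eq_mul]
    exact Finset.sum_congr rfl fun i _ => by ring

lemma intCov_add (y z : Coord n) : intCov (y + z) = intCov y + intCov z := by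
  refine LinearMap.ext fun a => ?_
  funext k
  exact map_add (a (k + 1)).curryLeft y z

lemma intCov_smul (r : ℝ) (z : Coord n) : intCov (r • z) = r • intCov z := by
  refine LinearMap.ext fun a => ?_
  funext k
  exact map_smul (a (k + 1)).curryLeft r z

/-- Exterior multiplication as a linear map in the covector. -/
def extHom (n : ℕ) : (Coord n →L[ℝ] ℝ) →ₗ[ℝ] Module.End ℝ (Cov n) where
  toFun := extCov
  map_add' := extCov_add
  map_smul' := extCov_smul

/-- Interior multiplication as a linear map in the vector. -/
def intHom (n : ℕ) : Coord n →ₗ[ℝ] Module.End ℝ (Cov n) where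
  toFun := intCov
  map_add' := intCov_add
  map_smul' := intCov_smul

/-- In the alternating sum defining the wedge, the slot occupied by `z` contributes `α z`. The other
summands keep `z` in first place, and the shift of their index by one supplies the minus sign. -/
lemma intCov_extCov (z : Coord n) (α : Coord n →L[ℝ] ℝ) (a : Cov n) :
    intCov z (extCov α a) = α z • a - extCov α (intCov z a) := by
  refine cov_ext fun k v => ?_
  rw [intCov_apply, extCov_succ_apply, Fin.sum_univ_succ]
  have h0 : (0 : Fin (k + 1)).removeNth (Matrix.vecCons z v) = v := by
    funext i; simp [Fin.removeNth]
  simp only [Fin.val_zero, pow_zero, one_mul, Matrix.cons_val_zero, h0, Fin.val_succ,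
    Matrix.cons_val_succ, pow_succ, Pi.sub_apply, Pi.smul_apply,
    ContinuousAlternatingMap.sub_apply, ContinuousAlternatingMap.smul_apply, smul_eq_mul]
  rw [sub_eq_add_neg]
  congr 1
  cases k with
  | zero => simp [extCov_zero_apply]
  | succ k =>
    rw [extCov_succ_apply, ← Finset.sum_neg_distrib]
    refine Finset.sum_congr rfl fun i _ => ?_
    have : i.succ.removeNth (Matrix.vecCons z v) = Matrix.vecCons z (i.removeNth v) := by
      funext j
      refine Fin.cases ?_ (fun j => ?_) j <;> simp [Fin.removeNth]
    rw [intCov_apply, this]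
    ring

lemma intCov_intCov_self (z : Coord n) (a : Cov n) : intCov z (intCov z a) = 0 := by
  funext k
  exact ContinuousAlternatingMap.curryLeft_same _ _

lemma intCov_anticomm (y z : Coord n) (a : Cov n) :
    intCov y (intCov z a) = -intCov z (intCov y a) := by
  have := intCov_intCov_self (y + z) a
  simp only [intCov_add, LinearMap.add_apply, map_add, intCov_intCov_self, zero_add,
    add_zero] at this
  rwa [eq_neg_iff_add_eq_zero, add_comm]

lemma cov_eq_zero_of_intCov {k : ℕ} {a : Cov n} (h : ∀ z, intCov z a k = 0) : a (k + 1) = 0 := by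
  ext v
  have := DFunLike.congr_fun (h (v 0)) (Matrix.vecTail v)
  rw [intCov_apply] at this
  exact (congrArg (a (k + 1)) (Matrix.cons_head_tail v)).symm.trans this

/-- Induction on the degree: the anticommutator of two exterior multiplications commutes with every
contraction, and a covector of positive degree all of whose contractions vanish is zero. -/
lemma extCov_anticomm (α β : Coord n →L[ℝ] ℝ) (a : Cov n) :
    extCov α (extCov β a) = -extCov β (extCov α a) := by
  rw [eq_neg_iff_add_eq_zero]
  funext k
  induction k generalizing a with
  | zero => simp [extCov_zero_apply]
  | succ k ih =>
    refine cov_eq_zero_of_intCov fun z => ?_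
    have : intCov z (extCov α (extCov β a) + extCov β (extCov α a))
        = extCov α (extCov β (intCov z a)) + extCov β (extCov α (intCov z a)) := by
      simp only [map_add, intCov_extCov, map_sub, map_smul]
      abel
    rw [this, ih]; rfl

lemma extCov_self (α : Coord n →L[ℝ] ℝ) (a : Cov n) : extCov α (extCov α a) = 0 := by
  have h : (2 : ℝ) • extCov α (extCov α a) = 0 := by
    rw [two_smul]
    exact eq_neg_iff_add_eq_zero.1 (extCov_anticomm α α a)
  exact (smul_eq_zero.1 h).resolve_left two_ne_zero

/-! ### The inner product of covectors -/

/-- Every injective multi-index is a permutation of a unique increasing one, and the sign of the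
permutation cancels in the product; the non-injective ones give zero. Summing over all multi-indices
makes it possible to insert and remove a single slot without reordering. -/
lemma factorial_mul_covInner {k : ℕ} (a b : Coord n [⋀^Fin k]→L[ℝ] ℝ) :
    (k.factorial : ℝ) * covInner a b
      = ∑ v : Fin k → Fin (n + n), a (fun i => ee (v i)) * b (fun i => ee (v i)) := by
  have key : ∑ q : (Fin k ↪o Fin (n + n)) × Equiv.Perm (Fin k),
      a (fun i => ee (q.1 i)) * b (fun i => ee (q.1 i))
      = ∑ v : Fin k → Fin (n + n), a (fun i => ee (v i)) * b (fun i => ee (v i)) := by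
    refine Fintype.sum_of_injective (fun q i => q.1 (q.2 i)) ?_ _ _ ?_ ?_
    · rintro ⟨I, π⟩ ⟨J, ρ⟩ h
      have hIJ : I = J := by
        rw [← OrderEmbedding.range_inj]
        have := congrArg Set.range h
        change Set.range (I ∘ π) = Set.range (J ∘ ρ) at this
        rwa [Set.range_comp, Set.range_comp, π.surjective.range_eq, ρ.surjective.range_eq,
          Set.image_univ, Set.image_univ] at this
      subst hIJ
      congr 1
      exact Equiv.ext fun i => I.injective (congrFun h i)
    · intro v hv
      -- Sorting an injective multi-index exhibits it in the range of the map.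
      have hni : ¬ Function.Injective v := fun hinj => hv <| by
        have hm : StrictMono (v ∘ Tuple.sort v) :=
          (Tuple.monotone_sort v).strictMono_of_injective (hinj.comp (Tuple.sort v).injective)
        refine ⟨⟨OrderEmbedding.ofStrictMono _ hm, (Tuple.sort v).symm⟩, ?_⟩
        funext i
        simp
      have : ¬ Function.Injective fun i => (ee (v i) : Coord n) := fun h => hni fun i j hij =>
        h (by simp only [hij])
      rw [a.toAlternatingMap.map_eq_zero_of_not_injective _ this |> fun h => (show a _ = 0 from h),
        zero_mul]
    · rintro ⟨I, π⟩
      have ha := a.toAlternatingMap.map_perm (fun i => ee (I i)) π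
      have hb := b.toAlternatingMap.map_perm (fun i => ee (I i)) π
      change a (fun i => ee (I (π i))) = _ • a (fun i => ee (I i)) at ha
      change b (fun i => ee (I (π i))) = _ • b (fun i => ee (I i)) at hb
      simp only [ha, hb]
      rcases Int.units_eq_one_or (Equiv.Perm.sign π) with h | h <;> simp [h]
  rw [← key, Fintype.sum_prod_type]
  simp only [Finset.sum_const, Finset.card_univ, Fintype.card_perm, Fintype.card_fin,
    nsmul_eq_mul, covInner, Finset.mul_sum]

/-- In the sum over all multi-indices, each of the `k + 1` slots into which `l` can be inserted
contributes the same amount, since moving it to the front costs exactly the sign already present.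
The count `k + 1` turns `k!` into `(k + 1)!`. -/
lemma covInner_extCov (l : Fin (n + n)) (a b : Cov n) (k : ℕ) :
    covInner (extCov (dx l) a (k + 1)) (b (k + 1)) = covInner (a k) (intCov (ee l) b k) := by
  have hf : ((k + 1).factorial : ℝ) ≠ 0 := by positivity
  refine mul_left_cancel₀ hf ?_
  rw [factorial_mul_covInner]
  have e1 : ∀ v : Fin (k + 1) → Fin (n + n),
      extCov (dx l) a (k + 1) (fun i => ee (v i)) * b (k + 1) (fun i => ee (v i))
      = ∑ i, (if v i = l then 1 else 0) *
        (a k (fun j => ee (i.removeNth v j)) * ((-1) ^ (i : ℕ) * b (k + 1) (fun i => ee (v i)))) := by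
    intro v
    rw [extCov_succ_apply, Finset.sum_mul]
    refine Finset.sum_congr rfl fun i _ => ?_
    have : dx l (ee (v i)) = if v i = l then 1 else 0 := by
      simp [dx, ee, eq_comm]
    rw [this]
    change _ * (_ * a k (fun j => ee (i.removeNth v j))) * _ = _
    ring
  simp only [e1]
  rw [Finset.sum_comm]
  have e2 : ∀ i : Fin (k + 1), ∑ v : Fin (k + 1) → Fin (n + n), (if v i = l then 1 else 0) *
      (a k (fun j => ee (i.removeNth v j)) * ((-1) ^ (i : ℕ) * b (k + 1) (fun i => ee (v i))))
      = k.factorial * covInner (a k) (intCov (ee l) b k) := by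
    intro i
    rw [factorial_mul_covInner, ← (Fin.insertNthEquiv (fun _ => Fin (n + n)) i).sum_comp,
      Fintype.sum_prod_type, Finset.sum_eq_single l]
    · refine Finset.sum_congr rfl fun w _ => ?_
      have h1 : (fun j => (ee (i.insertNth (α := fun _ => Fin (n + n)) l w j) : Coord n))
          = i.insertNth (ee l) (fun j => ee (w j)) := by
        funext j
        refine i.succAboveCases ?_ (fun j => ?_) j <;> simp
      have h2 : (Fin.insertNthEquiv (fun _ => Fin (n + n)) i) (l, w)
          = i.insertNth (α := fun _ => Fin (n + n)) l w := rfl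
      have h3 : i.removeNth (i.insertNth (α := fun _ => Fin (n + n)) l w) = w :=
        Fin.removeNth_insertNth ..
      rw [h2, h3, Fin.insertNth_apply_same, if_pos rfl, one_mul]
      congr 1
      rw [h1, intCov_apply, ← ContinuousAlternatingMap.neg_one_pow_smul_map_insertNth _ i]
      simp
    · intro x _ hx
      simp [hx]
    · simp
  simp only [e2, Finset.sum_const, Finset.card_univ, Fintype.card_fin, nsmul_eq_mul,
    Nat.factorial_succ]
  push_cast
  ring

lemma covInner_comm {k : ℕ} (a b : Coord n [⋀^Fin k]→L[ℝ] ℝ) : covInner a b = covInner b a := by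
  simp only [covInner, mul_comm]

lemma eq_zero_of_covInner_self {k : ℕ} {a : Coord n [⋀^Fin k]→L[ℝ] ℝ} (h : covInner a a = 0) :
    a = 0 := by
  have h1 := factorial_mul_covInner a a
  rw [h, mul_zero, eq_comm, Finset.sum_eq_zero_iff_of_nonneg fun v _ => mul_self_nonneg _] at h1
  have h2 : a.toContinuousMultilinearMap.toMultilinearMap = 0 :=
    Module.Basis.ext_multilinear (fun _ => (EuclideanSpace.basisFun (Fin (n + n)) ℝ).toBasis)
      fun v => by
        have := mul_self_eq_zero.1 (h1 v (Finset.mem_univ v))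
        simpa [ee] using this
  ext v
  exact congrFun (congrArg DFunLike.coe h2) v

/-- The inner product of covectors of mixed degree. -/
def covPair (a b : Cov n) : ℝ := ∑ k ∈ Finset.range (n + n + 1), covInner (a k) (b k)

lemma isEmpty_orderEmbedding {k : ℕ} (hk : n + n < k) : IsEmpty (Fin k ↪o Fin (n + n)) :=
  ⟨fun I => by
    have := Fintype.card_le_of_injective I I.injective
    simp only [Fintype.card_fin] at this
    omega⟩

lemma cov_eq_zero_of_lt {k : ℕ} (hk : n + n < k) (a : Coord n [⋀^Fin k]→L[ℝ] ℝ) : a = 0 := by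
  have := isEmpty_orderEmbedding hk
  exact eq_zero_of_covInner_self (by simp [covInner])

lemma covPair_comm (a b : Cov n) : covPair a b = covPair b a := by
  simp only [covPair, covInner_comm]

lemma covPair_extCov (l : Fin (n + n)) (a b : Cov n) :
    covPair (extCov (dx l) a) b = covPair a (intCov (ee l) b) := by
  unfold covPair
  rw [Finset.sum_range_succ', Finset.sum_range_succ]
  have h0 : covInner (extCov (dx l) a 0) (b 0) = 0 := by simp [extCov_zero_apply, covInner]
  -- Top degree: this term equals a pairing in degree `2n + 1`, where there are no increasing
  -- multi-indices. Together with `h0` it lets the two sums match after a shift of degree by one.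
  have h1 : covInner (a (n + n)) (intCov (ee l) b (n + n)) = 0 := by
    rw [← covInner_extCov]
    have := isEmpty_orderEmbedding (n := n) (Nat.lt_succ_self (n + n))
    simp [covInner]
  rw [h0, h1]
  simp only [covInner_extCov]

end Covectors

end ConeLaplacian

end

open MeasureTheory
open scoped ContDiff

noncomputable section

namespace ConeLaplacian

/-! ### The fermionic energy and its ground covector. -/

section Fermions

open scoped RealInnerProductSpace

variable {n : ℕ}

/-! ### Bilinearity and the spectral gap of the fermionic part -/

/-- Increasing multi-indices. -/
abbrev Idx (n : ℕ) := Σ k : Fin (n + n + 1), (Fin k ↪o Fin (n + n))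

/-- The coefficient of a covector at an increasing multi-index. -/
def coeff (i : Idx n) : Cov n →ₗ[ℝ] ℝ where
  toFun a := a i.1 fun l => ee (i.2 l)
  map_add' a b := by simp
  map_smul' r a := by simp

lemma covPair_eq_sum (a b : Cov n) : covPair a b = ∑ i, coeff i a * coeff i b := by
  rw [covPair, Finset.sum_range, Fintype.sum_sigma]
  rfl

lemma covPair_add_left (a b c : Cov n) : covPair (a + b) c = covPair a c + covPair b c := by
  simp only [covPair_eq_sum, map_add, add_mul, Finset.sum_add_distrib]

lemma covPair_smul_left (r : ℝ) (a b : Cov n) : covPair (r • a) b = r * covPair a b := by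
  simp only [covPair_eq_sum, map_smul, smul_eq_mul, mul_assoc, Finset.mul_sum]

lemma covPair_add_right (a b c : Cov n) : covPair a (b + c) = covPair a b + covPair a c := by
  simp only [covPair_comm a, covPair_add_left]

lemma covPair_smul_right (r : ℝ) (a b : Cov n) : covPair a (r • b) = r * covPair a b := by
  simp only [covPair_comm a, covPair_smul_left]

lemma covPair_neg_left (a b : Cov n) : covPair (-a) b = -covPair a b := by
  rw [← neg_one_smul ℝ, covPair_smul_left, neg_one_mul]

lemma covPair_neg_right (a b : Cov n) : covPair a (-b) = -covPair a b := by
  rw [covPair_comm, covPair_neg_left, covPair_comm]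

lemma covPair_sub_right (a b c : Cov n) : covPair a (b - c) = covPair a b - covPair a c := by
  rw [sub_eq_add_neg, covPair_add_right, covPair_neg_right, sub_eq_add_neg]

lemma covPair_zero_left (a : Cov n) : covPair 0 a = 0 := by
  simp [covPair_eq_sum]

lemma covPair_zero_right (a : Cov n) : covPair a 0 = 0 := by
  simp [covPair_eq_sum]

lemma covPair_sum_left {ι : Type*} (S : Finset ι) (f : ι → Cov n) (b : Cov n) :
    covPair (∑ j ∈ S, f j) b = ∑ j ∈ S, covPair (f j) b := by
  classical
  induction S using Finset.induction_on with
  | empty => simp [covPair_zero_left]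
  | insert a S ha ih => rw [Finset.sum_insert ha, Finset.sum_insert ha, covPair_add_left, ih]

lemma covPair_sum_right {ι : Type*} (S : Finset ι) (f : ι → Cov n) (b : Cov n) :
    covPair b (∑ j ∈ S, f j) = ∑ j ∈ S, covPair b (f j) := by
  simp only [covPair_comm b, covPair_sum_left]

lemma covPair_self_nonneg (a : Cov n) : 0 ≤ covPair a a := by
  rw [covPair_eq_sum]; exact Finset.sum_nonneg fun i _ => mul_self_nonneg _

lemma eq_zero_of_covPair_self {a : Cov n} (h : covPair a a = 0) : a = 0 := by
  funext k
  by_cases hk : k < n + n + 1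
  · have h1 := (Finset.sum_eq_zero_iff_of_nonneg fun j _ =>
      Finset.sum_nonneg fun I _ => mul_self_nonneg _).1 h k (Finset.mem_range.2 hk)
    exact eq_zero_of_covInner_self h1
  · exact cov_eq_zero_of_lt (by omega) _

lemma dx_ee (j l : Fin (n + n)) : dx j (ee l) = if j = l then 1 else 0 := by
  simp [dx, ee]

lemma sum_smul_ee (z : Coord n) : ∑ j, z j • (ee j : Coord n) = z := by
  ext l
  simp [ee, Pi.single_apply]

/-- The covector dual to a vector. -/
def flat (z : Coord n) : Coord n →L[ℝ] ℝ := innerSL ℝ z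

lemma flat_apply_ee (z : Coord n) (j : Fin (n + n)) : flat z (ee j) = z j := by
  rw [flat, innerSL_apply_apply, ee, EuclideanSpace.inner_single_right]; simp

lemma flat_eq_sum (z : Coord n) : flat z = ∑ j, z j • dx j := by
  ext x
  simp [flat, dx, PiLp.inner_apply, mul_comm]

lemma covPair_extCov_flat (z : Coord n) (a b : Cov n) :
    covPair (extCov (flat z) a) b = covPair a (intCov z b) := by
  have h1 : extCov (flat z) a = ∑ j, z j • extCov (dx j) a := by
    change extHom n (flat z) a = _
    rw [flat_eq_sum, map_sum, LinearMap.sum_apply]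
    simp only [map_smul]; rfl
  have h2 : intCov z b = ∑ j, z j • intCov (ee j) b := by
    change intHom n z b = _
    conv_lhs => rw [← sum_smul_ee z]
    rw [map_sum, LinearMap.sum_apply]
    simp only [map_smul]; rfl
  rw [h1, h2, covPair_sum_left, covPair_sum_right]
  simp only [covPair_smul_left, covPair_smul_right, covPair_extCov]

/-- Adjointness and the anticommutator of `ι_z` with multiplication by the dual of `z`, which is
`‖z‖²`. Consequently each of the two operators has norm at most `‖z‖`. -/
lemma covPair_int_add_ext (z : Coord n) (a : Cov n) :
    covPair (intCov z a) (intCov z a) + covPair (extCov (flat z) a) (extCov (flat z) a)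
      = ‖z‖ ^ 2 * covPair a a := by
  have h : flat z z = ‖z‖ ^ 2 := by rw [flat, innerSL_apply_apply, real_inner_self_eq_norm_sq]
  rw [covPair_extCov_flat, intCov_extCov, covPair_sub_right, covPair_smul_right, h,
    covPair_comm a (extCov _ _), covPair_extCov_flat]
  ring

/-- `dx_l ∧ ι_l` is the projection to the multi-indices that contain `l`. All these operators are
diagonal in the same basis, which reduces the fermionic gap to counting. -/
lemma coeff_extCov_intCov (l : Fin (n + n)) (a : Cov n) (i : Idx n) :
    coeff i (extCov (dx l) (intCov (ee l) a)) = if l ∈ Set.range i.2 then coeff i a else 0 := by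
  obtain ⟨k, I⟩ := i
  split_ifs with hl
  · obtain ⟨p, hp⟩ := hl
    have h1 : extCov (dx l) (intCov (ee l) a) = a - intCov (ee l) (extCov (dx l) a) := by
      rw [intCov_extCov, dx_ee, if_pos rfl, one_smul, sub_sub_cancel]
    have h2 : coeff ⟨k, I⟩ (intCov (ee l) (extCov (dx l) a)) = 0 := by
      change extCov (dx l) a (k + 1) (Matrix.vecCons (ee l) fun j => ee (I j)) = 0
      refine (extCov (dx l) a (k + 1)).map_eq_zero_of_eq _ (i := 0) (j := p.succ) ?_
        (Fin.succ_ne_zero p).symm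
      simp only [Matrix.cons_val_zero, Matrix.cons_val_succ]
      exact congrArg ee hp.symm
    rw [h1, map_sub, h2, sub_zero]
  · obtain ⟨k, hk⟩ := k
    cases k with
    | zero => rfl
    | succ k =>
      change extCov (dx l) (intCov (ee l) a) (k + 1) (fun j => ee (I j)) = 0
      rw [extCov_succ_apply]
      refine Finset.sum_eq_zero fun j _ => ?_
      have : l ≠ I j := fun h => hl ⟨j, h.symm⟩
      simp [dx_ee, this]

lemma covPair_intCov_self (l : Fin (n + n)) (a : Cov n) :
    covPair (intCov (ee l) a) (intCov (ee l) a)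
      = ∑ i : Idx n, (if l ∈ Set.range i.2 then 1 else 0) * coeff i a ^ 2 := by
  rw [← covPair_extCov, covPair_eq_sum]
  refine Finset.sum_congr rfl fun i _ => ?_
  rw [coeff_extCov_intCov]
  split_ifs <;> ring

lemma idx_eq_of_range_eq {i i' : Idx n} (h : Set.range i.2 = Set.range i'.2) : i = i' := by
  obtain ⟨⟨k, hk⟩, I⟩ := i
  obtain ⟨⟨k', hk'⟩, I'⟩ := i'
  have hkk : k = k' := by
    have h1 := Set.ncard_range_of_injective I.injective
    have h2 := Set.ncard_range_of_injective I'.injective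
    change Set.range I = Set.range I' at h
    rw [h, h2] at h1
    simpa using h1.symm
  subst hkk
  congr 1
  exact OrderEmbedding.range_inj.1 h

/-- The spectral gap of the fermionic part of the Witten Laplacian, where `w` is its ground state. -/
lemma fermion_gap {s : Fin (n + n) → ℝ} (hs : ∀ j, s j = 1 ∨ s j = -1) {w : Cov n}
    (hw : covPair w w = 1) (hE : ∀ j, s j = -1 → extCov (dx j) w = 0)
    (hI : ∀ j, s j = 1 → intCov (ee j) w = 0) (a : Cov n) :
    covPair a a - covPair w a ^ 2
      ≤ ∑ j, ((1 - s j) / 2 * covPair a a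
          + s j * covPair (intCov (ee j) a) (intCov (ee j) a)) := by
  classical
  -- `γ j i` is 1 if `j` is excited in `i`, that is, present although `s j = 1` or absent although
  -- `s j = -1`, and 0 otherwise. The right side is diagonal, with the number of excited indices as
  -- eigenvalue.
  set γ : Fin (n + n) → Idx n → ℝ := fun j i =>
    (1 - s j) / 2 + s j * if j ∈ Set.range i.2 then 1 else 0 with hγ
  have hγ0 : ∀ j i, 0 ≤ γ j i := fun j i => by
    rcases hs j with h | h <;> simp only [hγ, h] <;> split_ifs <;> norm_num
  have hγ1 : ∀ j i, γ j i ≠ 0 → γ j i = 1 := fun j i => by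
    rcases hs j with h | h <;> simp only [hγ, h] <;> split_ifs <;> norm_num
  have hγmem : ∀ j i, γ j i = 0 → (j ∈ Set.range i.2 ↔ s j = -1) := fun j i h0 => by
    rcases hs j with h | h <;> simp only [hγ, h] at h0 <;> split_ifs at h0 with hm <;>
      norm_num at h0 <;> simp only [h, hm, false_iff] <;> norm_num
  have hterm : ∀ (b : Cov n) j, (1 - s j) / 2 * covPair b b
      + s j * covPair (intCov (ee j) b) (intCov (ee j) b) = ∑ i, γ j i * coeff i b ^ 2 := by
    intro b j
    rw [covPair_intCov_self, covPair_eq_sum, Finset.mul_sum, Finset.mul_sum,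
      ← Finset.sum_add_distrib]
    exact Finset.sum_congr rfl fun i _ => by simp only [hγ]; ring
  have hwj : ∀ j, (1 - s j) / 2 * covPair w w
      + s j * covPair (intCov (ee j) w) (intCov (ee j) w) = 0 := by
    intro j
    rcases hs j with h | h
    · rw [hI j h, h, covPair_zero_left]; ring
    · have : covPair (intCov (ee j) w) (intCov (ee j) w) = 1 := by
        rw [← covPair_extCov]
        have h1 : extCov (dx j) (intCov (ee j) w) = w := by
          have := intCov_extCov (ee j) (dx j) w
          rw [hE j h, map_zero, dx_ee, if_pos rfl, one_smul] at this
          exact (sub_eq_zero.1 this.symm).symm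
        rw [h1, hw]
      rw [this, h, hw]; norm_num
  -- `w` has zero energy in each direction, so it is supported on multi-indices without excitation.
  -- The vanishing of all `γ j i` determines the range of `i`, so there is only one of them; all
  -- others have energy at least 1.
  have hw0 : ∀ i j, coeff i w ≠ 0 → γ j i = 0 := by
    intro i j hi
    have h1 := hwj j
    rw [hterm, Finset.sum_eq_zero_iff_of_nonneg fun i _ =>
      mul_nonneg (hγ0 j i) (sq_nonneg _)] at h1
    exact (mul_eq_zero.1 (h1 i (Finset.mem_univ i))).resolve_right (pow_ne_zero 2 hi)
  obtain ⟨i₀, hi₀⟩ : ∃ i, coeff i w ≠ 0 := by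
    by_contra! h
    rw [covPair_eq_sum] at hw
    simp [h] at hw
  have huniq : ∀ i, (∀ j, γ j i = 0) → i = i₀ := fun i hi =>
    idx_eq_of_range_eq (Set.ext fun j => (hγmem j i (hi j)).trans (hγmem j i₀ (hw0 i₀ j hi₀)).symm)
  have hsingle : ∀ b, covPair w b = coeff i₀ w * coeff i₀ b := fun b => by
    rw [covPair_eq_sum]
    refine Finset.sum_eq_single i₀ (fun i _ hi => ?_) fun h => absurd (Finset.mem_univ _) h
    have : coeff i w = 0 := by
      by_contra h
      exact hi (huniq i fun j => hw0 i j h)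
    rw [this, zero_mul]
  have hsq : coeff i₀ w ^ 2 = 1 := by rw [sq, ← hsingle, hw]
  have hsum : ∑ j, ((1 - s j) / 2 * covPair a a
      + s j * covPair (intCov (ee j) a) (intCov (ee j) a))
      = ∑ i, (∑ j, γ j i) * coeff i a ^ 2 := by
    simp only [hterm, Finset.sum_mul]
    exact Finset.sum_comm
  have hone : ∀ i, i ≠ i₀ → 1 ≤ ∑ j, γ j i := fun i hi => by
    obtain ⟨j, hj⟩ : ∃ j, γ j i ≠ 0 := by
      by_contra! h
      exact hi (huniq i h)
    rw [← hγ1 j i hj]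
    exact Finset.single_le_sum (f := fun j => γ j i) (fun j _ => hγ0 j i) (Finset.mem_univ j)
  rw [hsum, hsingle, mul_pow, hsq, one_mul, covPair_eq_sum,
    ← Finset.add_sum_erase _ _ (Finset.mem_univ i₀),
    ← Finset.add_sum_erase (f := fun i => (∑ j, γ j i) * coeff i a ^ 2) _ (Finset.mem_univ i₀)]
  have h1 : 0 ≤ (∑ j, γ j i₀) * coeff i₀ a ^ 2 :=
    mul_nonneg (Finset.sum_nonneg fun j _ => hγ0 j i₀) (sq_nonneg _)
  have h2 : ∑ i ∈ Finset.univ.erase i₀, coeff i a * coeff i a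
      ≤ ∑ i ∈ Finset.univ.erase i₀, (∑ j, γ j i) * coeff i a ^ 2 := by
    refine Finset.sum_le_sum fun i hi => ?_
    rw [← sq]
    exact le_mul_of_one_le_left (sq_nonneg _) (hone i (Finset.ne_of_mem_erase hi))
  rw [← sq (coeff i₀ a)]
  linarith

/-! ### The ground state `dx_1 ∧ … ∧ dx_m` -/

/-- The unit of the exterior algebra. -/
def unitCov : Cov n
  | 0 => ContinuousAlternatingMap.constOfIsEmpty ℝ (Coord n) (Fin 0) (1 : ℝ)
  | _ + 1 => 0

/-- `dx_{l₁} ∧ (dx_{l₂} ∧ …)` for a list `l₁, l₂, …` of indices. -/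
def covList (L : List (Fin (n + n))) : Cov n := L.foldr (fun l a => extCov (dx l) a) unitCov

lemma covList_cons (l : Fin (n + n)) (L : List (Fin (n + n))) :
    covList (l :: L) = extCov (dx l) (covList L) := rfl

lemma intCov_covList {l : Fin (n + n)} {L : List (Fin (n + n))} (h : l ∉ L) :
    intCov (ee l) (covList L) = 0 := by
  induction L with
  | nil => rfl
  | cons j L ih =>
    rw [List.mem_cons, not_or] at h
    rw [covList_cons, intCov_extCov, ih h.2, dx_ee, if_neg (Ne.symm h.1), zero_smul, map_zero,
      sub_zero]

lemma extCov_covList {l : Fin (n + n)} {L : List (Fin (n + n))} (h : l ∈ L) :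
    extCov (dx l) (covList L) = 0 := by
  induction L with
  | nil => simp at h
  | cons j L ih =>
    rw [covList_cons]
    rcases List.mem_cons.1 h with rfl | h
    · exact extCov_self _ _
    · rw [extCov_anticomm, ih h, map_zero, neg_zero]

lemma covPair_unitCov : covPair (unitCov : Cov n) unitCov = 1 := by
  rw [covPair, Finset.sum_range_succ', Finset.sum_eq_zero]
  · have : Unique (Fin 0 ↪o Fin (n + n)) :=
      ⟨⟨OrderEmbedding.ofIsEmpty⟩, fun I => by ext i; exact i.elim0⟩
    simp [covInner, unitCov]
  · intro k _
    simp [covInner, unitCov]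

lemma covPair_covList {L : List (Fin (n + n))} (h : L.Nodup) :
    covPair (covList L) (covList L) = 1 := by
  induction L with
  | nil => exact covPair_unitCov
  | cons j L ih =>
    rw [List.nodup_cons] at h
    rw [covList_cons, covPair_extCov, intCov_extCov, intCov_covList h.1, dx_ee, if_pos rfl,
      one_smul, map_zero, sub_zero, ih h.2]

/-- The covector `dx_1 ∧ … ∧ dx_m`. -/
def lowCov (n m : ℕ) : Cov n := covList ((List.finRange (n + n)).take m)

lemma mem_take_finRange {m : ℕ} {l : Fin (n + n)} :
    l ∈ (List.finRange (n + n)).take m ↔ (l : ℕ) < m := by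
  rw [List.mem_take_iff_getElem]
  constructor
  · rintro ⟨i, hi, rfl⟩
    simp only [List.getElem_finRange]
    simp at hi ⊢
    omega
  · intro h
    refine ⟨l, ?_, by simp⟩
    simp [h]

lemma covPair_lowCov (m : ℕ) : covPair (lowCov n m) (lowCov n m) = 1 :=
  covPair_covList ((List.nodup_finRange _).sublist (List.take_sublist _ _))

lemma extCov_lowCov {m : ℕ} {l : Fin (n + n)} (h : (l : ℕ) < m) :
    extCov (dx l) (lowCov n m) = 0 := extCov_covList (mem_take_finRange.2 h)

lemma intCov_lowCov {m : ℕ} {l : Fin (n + n)} (h : m ≤ (l : ℕ)) :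
    intCov (ee l) (lowCov n m) = 0 :=
  intCov_covList fun hl => absurd (mem_take_finRange.1 hl) (not_lt.2 h)

end Fermions

end ConeLaplacian

end

open MeasureTheory
open scoped ContDiff

noncomputable section

namespace ConeLaplacian

/-! ### Cone covectors as a Euclidean model, and half-rotations of the symplectic planes. -/

section ConeAlgebra

open scoped RealInnerProductSpace

variable {n : ℕ}

/-! ### Cone covectors -/

/-- Pairs of covectors of mixed degree. -/
abbrev ConeCov (n : ℕ) := Cov n × Cov n

/-- Exterior multiplication by the symplectic form. -/
def omegaCov : Module.End ℝ (Cov n) :=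
  ∑ i : Fin n, extCov (dx (Fin.castAdd n i)) ∘ₗ extCov (dx (Fin.natAdd n i))

/-- The adjoint of exterior multiplication by the symplectic form. -/
def lamCov : Module.End ℝ (Cov n) :=
  ∑ i : Fin n, intCov (ee (Fin.natAdd n i)) ∘ₗ intCov (ee (Fin.castAdd n i))

lemma omegaCov_apply (a : Cov n) :
    omegaCov a = ∑ i : Fin n, extCov (dx (Fin.castAdd n i)) (extCov (dx (Fin.natAdd n i)) a) := by
  simp [omegaCov]

lemma lamCov_apply (a : Cov n) :
    lamCov a = ∑ i : Fin n, intCov (ee (Fin.natAdd n i)) (intCov (ee (Fin.castAdd n i)) a) := by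
  simp [lamCov]

lemma covPair_omegaCov (a b : Cov n) : covPair (omegaCov a) b = covPair a (lamCov b) := by
  rw [omegaCov_apply, lamCov_apply, covPair_sum_left, covPair_sum_right]
  simp only [covPair_extCov]

/-- The principal symbol of the cone differential. -/
def coneExt (j : Fin (n + n)) : Module.End ℝ (ConeCov n) :=
  (extCov (dx j)).prodMap (-extCov (dx j))

/-- The adjoint of the principal symbol of the cone differential. -/
def coneInt (j : Fin (n + n)) : Module.End ℝ (ConeCov n) :=
  (intCov (ee j)).prodMap (-intCov (ee j))

/-- The zeroth order part of the cone differential. -/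
def coneOmega : Module.End ℝ (ConeCov n) :=
  LinearMap.inl ℝ _ _ ∘ₗ omegaCov ∘ₗ LinearMap.snd ℝ _ _

/-- The zeroth order part of the cone codifferential. -/
def coneLam : Module.End ℝ (ConeCov n) :=
  LinearMap.inr ℝ _ _ ∘ₗ lamCov ∘ₗ LinearMap.fst ℝ _ _

lemma coneExt_apply (j : Fin (n + n)) (x : ConeCov n) :
    coneExt j x = (extCov (dx j) x.1, -extCov (dx j) x.2) := rfl

lemma coneInt_apply (j : Fin (n + n)) (x : ConeCov n) :
    coneInt j x = (intCov (ee j) x.1, -intCov (ee j) x.2) := rfl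

lemma coneOmega_apply (x : ConeCov n) : coneOmega x = (omegaCov x.2, 0) := rfl

lemma coneLam_apply (x : ConeCov n) : coneLam x = (0, lamCov x.1) := rfl

/-- The inner product of cone covectors. -/
def conePair (x y : ConeCov n) : ℝ := covPair x.1 y.1 + covPair x.2 y.2

lemma conePair_coneExt (j : Fin (n + n)) (x y : ConeCov n) :
    conePair (coneExt j x) y = conePair x (coneInt j y) := by
  simp only [conePair, coneExt_apply, coneInt_apply, covPair_neg_left, covPair_neg_right,
    covPair_extCov]

lemma conePair_coneOmega (x y : ConeCov n) :
    conePair (coneOmega x) y = conePair x (coneLam y) := by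
  simp only [conePair, coneOmega_apply, coneLam_apply, covPair_zero_left, covPair_zero_right,
    covPair_omegaCov, add_zero, zero_add]

lemma coneExt_coneInt (j k : Fin (n + n)) (x : ConeCov n) :
    coneExt j (coneInt k x) + coneInt k (coneExt j x) = if j = k then x else 0 := by
  have h : ∀ a : Cov n, extCov (dx j) (intCov (ee k) a) + intCov (ee k) (extCov (dx j) a)
      = if j = k then a else 0 := fun a => by
    rw [intCov_extCov, dx_ee, add_sub_cancel]
    split_ifs <;> simp
  simp only [coneExt_apply, coneInt_apply, map_neg, neg_neg, Prod.mk_add_mk, h]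
  split_ifs <;> rfl

/-- The coefficients of a cone covector. -/
def coneCoords (n : ℕ) : ConeCov n →ₗ[ℝ] EuclideanSpace ℝ (Idx n ⊕ Idx n) where
  toFun x := WithLp.toLp 2 (Sum.elim (fun i => coeff i x.1) fun i => coeff i x.2)
  map_add' x y := by ext (i | i) <;> simp
  map_smul' r x := by ext (i | i) <;> simp

lemma inner_coneCoords (x y : ConeCov n) :
    ⟪coneCoords n x, coneCoords n y⟫ = conePair x y := by
  simp [PiLp.inner_apply, coneCoords, conePair, covPair_eq_sum, mul_comm]

/-- Covectors of degree above `2n` vanish, so finitely many coefficients determine a cone covector.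
`ConeSpace` thereby inherits its inner product and finite dimension from a Euclidean space. -/
lemma coneCoords_injective : Function.Injective (coneCoords n) := by
  rw [← LinearMap.ker_eq_bot, LinearMap.ker_eq_bot']
  intro x hx
  have h : conePair x x = 0 := by rw [← inner_coneCoords, hx, inner_zero_left]
  have h1 := covPair_self_nonneg x.1
  have h2 := covPair_self_nonneg x.2
  unfold conePair at h
  exact Prod.ext (eq_zero_of_covPair_self (by linarith)) (eq_zero_of_covPair_self (by linarith))

/-- The space of cone covectors with its Euclidean structure. -/
abbrev ConeSpace (n : ℕ) := LinearMap.range (coneCoords n)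

/-- The identification of cone covectors with their coefficients. -/
def coneEquiv (n : ℕ) : ConeCov n ≃ₗ[ℝ] ConeSpace n :=
  LinearEquiv.ofInjective (coneCoords n) coneCoords_injective

lemma inner_coneEquiv (x y : ConeCov n) : ⟪coneEquiv n x, coneEquiv n y⟫ = conePair x y :=
  inner_coneCoords x y

lemma norm_sq_coneEquiv (x : ConeCov n) : ‖coneEquiv n x‖ ^ 2 = conePair x x := by
  rw [← inner_coneEquiv, real_inner_self_eq_norm_sq]

/-- An endomorphism of cone covectors as a continuous linear map. -/
def coneEnd (T : Module.End ℝ (ConeCov n)) : ConeSpace n →L[ℝ] ConeSpace n :=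
  LinearMap.toContinuousLinearMap ((coneEquiv n).conj T)

lemma coneEnd_coneEquiv (T : Module.End ℝ (ConeCov n)) (x : ConeCov n) :
    coneEnd T (coneEquiv n x) = coneEquiv n (T x) := by
  simp [coneEnd, LinearEquiv.conj_apply]

/-- The signs of the Hessian of the Morse function. -/
def morseSign (m : ℕ) (l : Fin (n + n)) : ℝ := if (l : ℕ) < m then -1 else 1

lemma morseSign_eq_neg_one {m : ℕ} {l : Fin (n + n)} : morseSign m l = -1 ↔ (l : ℕ) < m := by
  unfold morseSign; split_ifs with h <;> norm_num [h]

lemma morseSign_eq_one {m : ℕ} {l : Fin (n + n)} : morseSign m l = 1 ↔ m ≤ (l : ℕ) := by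
  unfold morseSign; split_ifs with h <;> norm_num [h]; omega

/-- The ground states at the critical point. -/
def groundCov (m : ℕ) : Fin 2 → ConeSpace n :=
  ![coneEquiv n (lowCov n m, 0), coneEquiv n (0, lowCov n m)]

/-- The bound of the zeroth order part of the cone differential. -/
def omegaBound (n : ℕ) : ℝ :=
  ‖coneEnd (n := n) coneOmega‖ ^ 2 + ‖coneEnd (n := n) coneLam‖ ^ 2

/-- The minus sign on the second component disappears in the anticommutators and in the norms, so
the gap is the sum of two copies of `fermion_gap`, one ground covector for each component. The bound
on the coupling depends on `n` only, which makes the final constants uniform in `m` and `t`. -/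
theorem isConeModel (m : ℕ) :
    IsConeModel (morseSign (n := n) m) (fun j => coneEnd (coneExt j)) (fun j => coneEnd (coneInt j))
      (coneEnd coneOmega) (coneEnd coneLam) (omegaBound n) (groundCov m) where
  sign j := by unfold morseSign; split_ifs <;> simp
  adj j v w := by
    obtain ⟨x, rfl⟩ := (coneEquiv n).surjective v
    obtain ⟨y, rfl⟩ := (coneEquiv n).surjective w
    simp only [coneEnd_coneEquiv, inner_coneEquiv, conePair_coneExt]
  adjW v w := by
    obtain ⟨x, rfl⟩ := (coneEquiv n).surjective v
    obtain ⟨y, rfl⟩ := (coneEquiv n).surjective w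
    simp only [coneEnd_coneEquiv, inner_coneEquiv, conePair_coneOmega]
  car j k v := by
    obtain ⟨x, rfl⟩ := (coneEquiv n).surjective v
    simp only [coneEnd_coneEquiv, ← map_add, coneExt_coneInt]
    split_ifs <;> simp
  bound v := by
    have h1 := pow_le_pow_left₀ (norm_nonneg _) ((coneEnd (n := n) coneOmega).le_opNorm v) 2
    have h2 := pow_le_pow_left₀ (norm_nonneg _) ((coneEnd (n := n) coneLam).le_opNorm v) 2
    rw [mul_pow] at h1 h2
    rw [omegaBound, add_mul]
    exact add_le_add h1 h2
  orthonormal := by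
    rw [orthonormal_iff_ite]
    intro i j
    have h : ∀ x y : ConeCov n, conePair x y = covPair x.1 y.1 + covPair x.2 y.2 := fun _ _ => rfl
    fin_cases i <;> fin_cases j <;>
      simp only [groundCov, Fin.zero_eta, Fin.mk_one, Matrix.cons_val_zero, Matrix.cons_val_one,
        inner_coneEquiv, h, covPair_lowCov, covPair_zero_left, covPair_zero_right] <;> norm_num
  gap v := by
    obtain ⟨x, rfl⟩ := (coneEquiv n).surjective v
    have hg := fermion_gap (s := morseSign (n := n) m) (fun j => by unfold morseSign; split_ifs <;> simp)
      (covPair_lowCov m) (fun j h => extCov_lowCov (morseSign_eq_neg_one.1 h))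
      (fun j h => intCov_lowCov (morseSign_eq_one.1 h))
    have h := add_le_add (hg x.1) (hg x.2)
    rw [← Finset.sum_add_distrib] at h
    refine le_trans (le_of_eq ?_) (h.trans (le_of_eq ?_))
    · simp only [Fin.sum_univ_two, groundCov, Matrix.cons_val_zero, Matrix.cons_val_one,
        inner_coneEquiv, norm_sq_coneEquiv, conePair, covPair_zero_left, add_zero, zero_add]
      ring
    · refine Finset.sum_congr rfl fun j _ => ?_
      rw [coneEnd_coneEquiv, norm_sq_coneEquiv, norm_sq_coneEquiv]
      simp only [conePair, coneInt_apply, covPair_neg_left, covPair_neg_right, neg_neg]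
      ring

/-! ### The linear terms of the ground states -/

/-- Half the rotation in those planes `(x_i, x_{i+n})` for which `P i` holds. -/
def skew (P : Fin n → Prop) [DecidablePred P] : Coord n →ₗ[ℝ] Coord n where
  toFun x := WithLp.toLp 2 (Fin.addCases
    (fun i => if P i then -(1 / 2) * x (Fin.natAdd n i) else 0)
    (fun i => if P i then 1 / 2 * x (Fin.castAdd n i) else 0))
  map_add' x y := by
    ext j
    refine Fin.addCases (fun i => ?_) (fun i => ?_) j <;>
      by_cases h : P i <;> simp [h, -Fin.natAdd_eq_addNat, mul_add]
  map_smul' r x := by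
    ext j
    refine Fin.addCases (fun i => ?_) (fun i => ?_) j <;>
      by_cases h : P i <;> simp [h, -Fin.natAdd_eq_addNat, mul_left_comm]

section Skew

variable (P : Fin n → Prop) [DecidablePred P]

lemma skew_castAdd (x : Coord n) (i : Fin n) :
    skew P x (Fin.castAdd n i) = if P i then -(1 / 2) * x (Fin.natAdd n i) else 0 := by
  simp [skew, -Fin.natAdd_eq_addNat]

lemma skew_natAdd (x : Coord n) (i : Fin n) :
    skew P x (Fin.natAdd n i) = if P i then 1 / 2 * x (Fin.castAdd n i) else 0 := by
  simp [skew, -Fin.natAdd_eq_addNat]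

lemma norm_skew_le (x : Coord n) : ‖skew P x‖ ≤ ‖x‖ := by
  refine le_of_sq_le_sq ?_ (norm_nonneg x)
  rw [EuclideanSpace.real_norm_sq_eq, EuclideanSpace.real_norm_sq_eq, Fin.sum_univ_add,
    Fin.sum_univ_add, add_comm]
  refine add_le_add (Finset.sum_le_sum fun i _ => ?_) (Finset.sum_le_sum fun i _ => ?_)
  · rw [skew_natAdd]
    split_ifs <;> nlinarith [sq_nonneg (x (Fin.castAdd n i))]
  · rw [skew_castAdd]
    split_ifs <;> nlinarith [sq_nonneg (x (Fin.natAdd n i))]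

lemma sum_mul_skew (x : Coord n) : ∑ j, x j * skew P x j = 0 := by
  rw [Fin.sum_univ_add, ← Finset.sum_add_distrib]
  refine Finset.sum_eq_zero fun i _ => ?_
  rw [skew_castAdd, skew_natAdd]
  split_ifs <;> ring

lemma castAdd_ne_natAdd (i k : Fin n) : Fin.castAdd n i ≠ Fin.natAdd n k := fun h => by
  have := congrArg Fin.val h
  simp at this
  omega

lemma ee_apply (j l : Fin (n + n)) : (ee j : Coord n) l = if l = j then 1 else 0 := by
  simp [ee]

lemma skew_ee_castAdd (i : Fin n) :
    skew P (ee (Fin.castAdd n i)) = if P i then (1 / 2 : ℝ) • ee (Fin.natAdd n i) else 0 := by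
  ext j
  refine Fin.addCases (fun k => ?_) (fun k => ?_) j
  · rw [skew_castAdd, ee_apply, if_neg (castAdd_ne_natAdd i k).symm]
    split_ifs <;> simp [ee_apply, castAdd_ne_natAdd, -Fin.natAdd_eq_addNat]
  · rw [skew_natAdd, ee_apply]
    by_cases hk : k = i
    · subst hk; rw [if_pos rfl]; split_ifs <;> simp [ee_apply]
    · split_ifs <;> simp_all [ee_apply, -Fin.natAdd_eq_addNat]

lemma skew_ee_natAdd (i : Fin n) :
    skew P (ee (Fin.natAdd n i)) = if P i then (-(1 / 2) : ℝ) • ee (Fin.castAdd n i) else 0 := by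
  ext j
  refine Fin.addCases (fun k => ?_) (fun k => ?_) j
  · rw [skew_castAdd, ee_apply]
    by_cases hk : k = i
    · subst hk; rw [if_pos rfl]; split_ifs <;> simp [ee_apply]
    · split_ifs <;> simp_all [ee_apply, -Fin.natAdd_eq_addNat]
  · rw [skew_natAdd, ee_apply, if_neg (castAdd_ne_natAdd k i)]
    split_ifs <;> simp [ee_apply, (castAdd_ne_natAdd _ _).symm, -Fin.natAdd_eq_addNat]

lemma skew_eq_zero (h : ∀ i, ¬ P i) : skew P = 0 := by
  refine LinearMap.ext fun x => ?_
  ext j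
  refine Fin.addCases (fun i => ?_) (fun i => ?_) j
  · rw [skew_castAdd, if_neg (h i)]; rfl
  · rw [skew_natAdd, if_neg (h i)]; rfl

lemma skew_ee_self (j : Fin (n + n)) : skew P (ee j) j = 0 := by
  refine Fin.addCases (fun i => ?_) (fun i => ?_) j
  · rw [skew_castAdd, ee_apply, if_neg (castAdd_ne_natAdd i i).symm, mul_zero, ite_self]
  · rw [skew_natAdd, ee_apply, if_neg (castAdd_ne_natAdd i i), mul_zero, ite_self]

end Skew

/-- The map `z ↦ ⟨z, ·⟩` as a linear map. -/
def flatHom (n : ℕ) : Coord n →ₗ[ℝ] Coord n →L[ℝ] ℝ where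
  toFun := flat
  map_add' y z := by simp [flat]
  map_smul' r z := by simp [flat]

lemma flat_ee (j : Fin (n + n)) : flat (ee j : Coord n) = dx j := by
  ext x
  rw [flat, innerSL_apply_apply, ee, EuclideanSpace.inner_single_left]
  simp [dx]

end ConeAlgebra

end ConeLaplacian

end

open MeasureTheory
open scoped ContDiff

noncomputable section

namespace ConeLaplacian

/-! ### Closedness, coclosedness and pointwise orthogonality of the ground states. -/

section GroundStates

open scoped RealInnerProductSpace

variable {n m : ℕ}

/-! ### The ground states of the cone Laplacian -/

lemma extCov_extCov_flat_eq_zero {a : Cov n} {z : Coord n} {j : Fin (n + n)}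
    (h : extCov (dx j) a = 0) : extCov (dx j) (extCov (flat z) a) = 0 := by
  rw [extCov_anticomm, h, map_zero, neg_zero]

lemma intCov_intCov_eq_zero {a : Cov n} {y z : Coord n}
    (h : intCov y a = 0) : intCov y (intCov z a) = 0 := by
  rw [intCov_anticomm, h, map_zero, neg_zero]

lemma extCov_intCov_of_extCov {a : Cov n} {z : Coord n} {j : Fin (n + n)}
    (h : extCov (dx j) a = 0) : extCov (dx j) (intCov z a) = z j • a := by
  have := intCov_extCov z (dx j) a
  rw [h, map_zero] at this
  exact (sub_eq_zero.1 this.symm).symm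

lemma intCov_extCov_of_intCov {a : Cov n} {z : Coord n} {j : Fin (n + n)}
    (h : intCov (ee j) a = 0) : intCov (ee j) (extCov (flat z) a) = z j • a := by
  rw [intCov_extCov, h, map_zero, sub_zero, flat_apply_ee]

lemma extCov_flat_eq (r : ℝ) (j : Fin (n + n)) (a : Cov n) :
    extCov (flat (r • ee j)) a = r • extCov (dx j) a := by
  have : flat (r • ee j : Coord n) = r • dx j := by
    rw [← flat_ee]; exact (flatHom n).map_smul r _
  rw [this, extCov_smul]; rfl

lemma extCov_flat_zero (a : Cov n) : extCov (flat 0) a = 0 := by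
  have : flat (0 : Coord n) = 0 := (flatHom n).map_zero
  rw [this]
  exact congrArg (fun T : Module.End ℝ (Cov n) => T a) (extHom n).map_zero

lemma intCov_zero (a : Cov n) : intCov 0 a = 0 :=
  congrArg (fun T : Module.End ℝ (Cov n) => T a) (intHom n).map_zero

lemma intCov_smul_apply (r : ℝ) (z : Coord n) (a : Cov n) :
    intCov (r • z) a = r • intCov z a := by
  rw [intCov_smul]; rfl

/-- The exterior derivative of the one-form dual to `skew P` is `ω` in the planes selected by `P`:
the two coordinates of a plane contribute one half each. In the other planes the summand of `ω` dies
on `a` by hypothesis. -/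
lemma sum_extCov_skew (P : Fin n → Prop) [DecidablePred P] (a : Cov n)
    (h : ∀ i, ¬ P i → extCov (dx (Fin.castAdd n i)) a = 0) :
    ∑ j, extCov (dx j) (extCov (flat (skew P (ee j))) a) = omegaCov a := by
  rw [omegaCov_apply, Fin.sum_univ_add, ← Finset.sum_add_distrib]
  refine Finset.sum_congr rfl fun i _ => ?_
  rw [skew_ee_castAdd, skew_ee_natAdd]
  split_ifs with hi
  · rw [extCov_flat_eq, extCov_flat_eq, map_smul, map_smul,
      extCov_anticomm (dx (Fin.natAdd n i)), ← neg_one_smul ℝ (extCov _ _), smul_smul, ← add_smul]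
    norm_num
  · rw [extCov_flat_zero, map_zero, map_zero, add_zero, extCov_anticomm, h i hi, map_zero,
      neg_zero]

/-- The same computation for contractions. The sign is opposite because `Λ` contracts with `∂_i`
before `∂_{i+n}`. -/
lemma sum_intCov_skew (P : Fin n → Prop) [DecidablePred P] (a : Cov n)
    (h : ∀ i, ¬ P i → intCov (ee (Fin.natAdd n i)) a = 0) :
    ∑ j, intCov (ee j) (intCov (skew P (ee j)) a) = -lamCov a := by
  rw [lamCov_apply, Fin.sum_univ_add, ← Finset.sum_add_distrib, ← Finset.sum_neg_distrib]
  refine Finset.sum_congr rfl fun i _ => ?_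
  rw [skew_ee_castAdd, skew_ee_natAdd]
  split_ifs with hi
  · rw [intCov_smul_apply, intCov_smul_apply, map_smul, map_smul,
      intCov_anticomm (ee (Fin.castAdd n i)), ← neg_one_smul ℝ (intCov _ _), smul_smul, ← add_smul]
    norm_num
  · rw [intCov_zero, map_zero, map_zero, add_zero, intCov_anticomm, h i hi, map_zero]
    simp

/-- The linear terms of the ground states. -/
def groundLin (n m : ℕ) : Fin 2 → Coord n →L[ℝ] ConeSpace n :=
  ![LinearMap.toContinuousLinearMap ((coneEquiv n).toLinearMap ∘ₗ LinearMap.inr ℝ _ _ ∘ₗ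
      (intHom n).flip (lowCov n m) ∘ₗ skew fun i => (i : ℕ) + n < m),
    LinearMap.toContinuousLinearMap ((coneEquiv n).toLinearMap ∘ₗ LinearMap.inl ℝ _ _ ∘ₗ
      (-((extHom n).flip (lowCov n m) ∘ₗ flatHom n ∘ₗ skew fun i => m ≤ (i : ℕ))))]

/-- The vector field `Z`. -/
abbrev rotZ (n m : ℕ) : Coord n →ₗ[ℝ] Coord n := skew fun i => (i : ℕ) + n < m

/-- The dual of the one-form `τ`, up to terms that vanish on `dx_1 ∧ … ∧ dx_m`. -/
abbrev rotY (n m : ℕ) : Coord n →ₗ[ℝ] Coord n := skew fun i => m ≤ (i : ℕ)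

lemma groundLin_zero (x : Coord n) :
    groundLin n m 0 x = coneEquiv n (0, intCov (rotZ n m x) (lowCov n m)) := rfl

lemma groundLin_one (x : Coord n) :
    groundLin n m 1 x = coneEquiv n (-extCov (flat (rotY n m x)) (lowCov n m), 0) := rfl

lemma groundCov_add_groundLin_zero (x : Coord n) : groundCov m 0 + groundLin n m 0 x
    = coneEquiv n (lowCov n m, intCov (rotZ n m x) (lowCov n m)) := by
  rw [groundLin_zero, groundCov, Matrix.cons_val_zero, ← map_add, Prod.mk_add_mk, add_zero,
    zero_add]

lemma groundCov_add_groundLin_one (x : Coord n) : groundCov m 1 + groundLin n m 1 x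
    = coneEquiv n (-extCov (flat (rotY n m x)) (lowCov n m), lowCov n m) := by
  rw [groundLin_one, groundCov, Matrix.cons_val_one, Matrix.cons_val_zero, ← map_add,
    Prod.mk_add_mk, add_zero, zero_add]

lemma rotZ_apply_of_le {j : Fin (n + n)} (h : m ≤ (j : ℕ)) (x : Coord n) : rotZ n m x j = 0 := by
  revert h
  refine Fin.addCases (fun i h => ?_) (fun i h => ?_) j
  · rw [skew_castAdd, if_neg]
    rw [Fin.val_castAdd] at h; omega
  · rw [skew_natAdd, if_neg]
    rw [Fin.val_natAdd] at h; omega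

lemma rotY_apply_of_lt {j : Fin (n + n)} (h : (j : ℕ) < m) (x : Coord n) : rotY n m x j = 0 := by
  revert h
  refine Fin.addCases (fun i h => ?_) (fun i h => ?_) j
  · rw [skew_castAdd, if_neg]
    rw [Fin.val_castAdd] at h; omega
  · rw [skew_natAdd, if_neg]
    rw [Fin.val_natAdd] at h; omega

lemma rotZ_eq_zero (h : m ≤ n) : rotZ n m = 0 := skew_eq_zero _ fun i => by omega

lemma rotY_eq_zero (h : n ≤ m) : rotY n m = 0 := skew_eq_zero _ fun i => by omega

lemma rotZ_ee_of_le {j : Fin (n + n)} (h : m ≤ (j : ℕ)) : rotZ n m (ee j) = 0 := by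
  revert h
  refine Fin.addCases (fun i h => ?_) (fun i h => ?_) j
  · rw [Fin.val_castAdd] at h
    rw [skew_ee_castAdd, if_neg (by omega)]
  · rw [Fin.val_natAdd] at h
    rw [skew_ee_natAdd, if_neg (by omega)]

lemma rotY_ee_of_lt {j : Fin (n + n)} (h : (j : ℕ) < m) : rotY n m (ee j) = 0 := by
  revert h
  refine Fin.addCases (fun i h => ?_) (fun i h => ?_) j
  · rw [Fin.val_castAdd] at h
    rw [skew_ee_castAdd, if_neg (by omega)]
  · rw [Fin.val_natAdd] at h
    rw [skew_ee_natAdd, if_neg (by omega)]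

/-- If `j < m`, then `dx_j` kills the ground covector and only the diagonal entry of `Z` at `j`
remains, which is zero; otherwise `Z` does not involve the direction `j`. -/
lemma extCov_rotZ_ee (j : Fin (n + n)) :
    extCov (dx j) (intCov (rotZ n m (ee j)) (lowCov n m)) = 0 := by
  rcases lt_or_ge (j : ℕ) m with h | h
  · rw [extCov_intCov_of_extCov (extCov_lowCov h), skew_ee_self, zero_smul]
  · rw [rotZ_ee_of_le h, intCov_zero, map_zero]

lemma intCov_rotY_ee (j : Fin (n + n)) :
    intCov (ee j) (extCov (flat (rotY n m (ee j))) (lowCov n m)) = 0 := by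
  rcases lt_or_ge (j : ℕ) m with h | h
  · rw [rotY_ee_of_lt h, extCov_flat_zero, map_zero]
  · rw [intCov_extCov_of_intCov (intCov_lowCov h), skew_ee_self, zero_smul]

/-- For `m > n` every `dx_i` of the first half divides the ground covector. If `dx_{i+n}` divides it
too, then `dx_{i+n} ∧ ι_Z` only rescales it and `dx_i` kills the result; otherwise `Z` has no
component along `∂_i`. -/
lemma omegaCov_intCov_rotZ (x : Coord n) :
    omegaCov (intCov (rotZ n m x) (lowCov n m)) = 0 := by
  rcases le_or_gt m n with hmn | hmn
  · rw [rotZ_eq_zero hmn, LinearMap.zero_apply, intCov_zero, map_zero]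
  rw [omegaCov_apply]
  refine Finset.sum_eq_zero fun i _ => ?_
  have hi : ((Fin.castAdd n i : Fin (n + n)) : ℕ) < m := by rw [Fin.val_castAdd]; omega
  rcases lt_or_ge (n + (i : ℕ)) m with h | h
  · rw [extCov_intCov_of_extCov (extCov_lowCov (by rwa [Fin.val_natAdd])), map_smul,
      extCov_lowCov hi, smul_zero]
  · rw [extCov_anticomm, extCov_intCov_of_extCov (extCov_lowCov hi), skew_castAdd,
      if_neg (by omega), zero_smul, map_zero, neg_zero]

/-- The mirror image, with contraction and multiplication exchanged: for `m < n` every `∂_{i+n}`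
annihilates the ground covector, and the dual of `τ` has no component in the planes with `i < m`. -/
lemma lamCov_extCov_rotY (x : Coord n) :
    lamCov (extCov (flat (rotY n m x)) (lowCov n m)) = 0 := by
  rcases le_or_gt n m with hmn | hmn
  · rw [rotY_eq_zero hmn, LinearMap.zero_apply, extCov_flat_zero, map_zero]
  rw [lamCov_apply]
  refine Finset.sum_eq_zero fun i _ => ?_
  have hi : m ≤ ((Fin.natAdd n i : Fin (n + n)) : ℕ) := by rw [Fin.val_natAdd]; omega
  rcases lt_or_ge (i : ℕ) m with h | h
  · rw [intCov_anticomm, intCov_extCov_of_intCov (intCov_lowCov hi), skew_natAdd,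
      if_neg (by omega), zero_smul, map_zero, neg_zero]
  · rw [intCov_extCov_of_intCov (intCov_lowCov (by rwa [Fin.val_castAdd])), map_smul,
      intCov_lowCov hi, smul_zero]

lemma norm_groundLin_le (i : Fin 2) (x : Coord n) : ‖groundLin n m i x‖ ≤ ‖x‖ := by
  refine le_of_sq_le_sq ?_ (norm_nonneg x)
  have hsq : ∀ (P : Fin n → Prop) [DecidablePred P], ‖skew P x‖ ^ 2 ≤ ‖x‖ ^ 2 := fun P _ =>
    pow_le_pow_left₀ (norm_nonneg _) (norm_skew_le P x) 2
  have key : ∀ z : Coord n, covPair (intCov z (lowCov n m)) (intCov z (lowCov n m)) ≤ ‖z‖ ^ 2 ∧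
      covPair (extCov (flat z) (lowCov n m)) (extCov (flat z) (lowCov n m)) ≤ ‖z‖ ^ 2 := fun z => by
    have h := covPair_int_add_ext z (lowCov n m)
    rw [covPair_lowCov, mul_one] at h
    have h1 := covPair_self_nonneg (intCov z (lowCov n m))
    have h2 := covPair_self_nonneg (extCov (flat z) (lowCov n m))
    constructor <;> linarith
  fin_cases i
  · change ‖groundLin n m 0 x‖ ^ 2 ≤ _
    rw [groundLin_zero, norm_sq_coneEquiv, conePair, covPair_zero_left, zero_add]
    exact (key _).1.trans (hsq _)
  · change ‖groundLin n m 1 x‖ ^ 2 ≤ _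
    rw [groundLin_one, norm_sq_coneEquiv, conePair, covPair_zero_left, add_zero,
      covPair_neg_left, covPair_neg_right, neg_neg]
    exact (key _).2.trans (hsq _)

/-- Both contributions pair the ground covector with a contraction of itself. Along each `∂_j` this
is zero, since either `dx_j ∧` or `ι_{∂_j}` annihilates the ground covector. -/
lemma inner_groundStates (x : Coord n) :
    ⟪groundCov m 0 + groundLin n m 0 x, groundCov m 1 + groundLin n m 1 x⟫ = 0 := by
  rw [groundCov_add_groundLin_zero, groundCov_add_groundLin_one, inner_coneEquiv, conePair,
    covPair_neg_right, covPair_comm, covPair_extCov_flat, covPair_comm _ (lowCov n m)]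
  have h : ∀ j : Fin (n + n), (rotY n m x j * covPair (lowCov n m) (intCov (ee j) (lowCov n m)) = 0)
      ∧ (rotZ n m x j * covPair (lowCov n m) (intCov (ee j) (lowCov n m)) = 0) := fun j => by
    rcases lt_or_ge (j : ℕ) m with hj | hj
    · rw [← covPair_extCov, extCov_lowCov hj, covPair_zero_left]; simp
    · rw [intCov_lowCov hj, covPair_zero_right]; simp
  have e : ∀ z : Coord n, covPair (lowCov n m) (intCov z (lowCov n m))
      = ∑ j, z j * covPair (lowCov n m) (intCov (ee j) (lowCov n m)) := fun z => by
    have : intCov z (lowCov n m) = ∑ j, z j • intCov (ee j) (lowCov n m) := by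
      change intHom n z _ = _
      conv_lhs => rw [← sum_smul_ee z]
      rw [map_sum, LinearMap.sum_apply]
      simp only [map_smul]; rfl
    rw [this, covPair_sum_right]
    simp only [covPair_smul_right]
  rw [e, e, Finset.sum_eq_zero fun j _ => (h j).1, Finset.sum_eq_zero fun j _ => (h j).2]
  simp

/-- Where `skew P x` is non-zero the weight is the constant `c`, and `x` is orthogonal to `skew P
x`. This disposes of the quadratic terms that come from differentiating the Gaussian. -/
lemma sum_smul_eq_zero_of_skew {E : Type*} [AddCommGroup E] [Module ℝ E] (P : Fin n → Prop)
    [DecidablePred P] (r : Fin (n + n) → ℝ) (c : ℝ) (x : Coord n) (a : E)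
    (h : ∀ j, r j = c ∨ skew P x j = 0) : ∑ j, (r j * x j) • skew P x j • a = 0 := by
  simp only [smul_smul, ← Finset.sum_smul]
  rw [Finset.sum_congr rfl fun j _ => show r j * x j * skew P x j = c * (x j * skew P x j) by
    rcases h j with h | h <;> rw [h] <;> ring, ← Finset.mul_sum, sum_mul_skew, mul_zero, zero_smul]

theorem hasGroundStates (n m : ℕ) :
    HasGroundStates (morseSign (n := n) m) (fun j => coneEnd (coneExt j))
      (fun j => coneEnd (coneInt j)) (coneEnd coneOmega) (coneEnd coneLam) (groundCov m)
      (groundLin n m) where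
  norm_le := norm_groundLin_le
  orthogonal := inner_groundStates
  closed t i := by
    funext x
    rw [modelD, firstOrder_gaussAffine, Pi.zero_apply, smul_eq_zero]
    refine Or.inr ?_
    fin_cases i
    · change ∑ j, coneEnd (coneExt j) (groundLin n m 0 (ee j)) + ∑ j, ((t * morseSign m j - t) * x j) •
        coneEnd (coneExt j) (groundCov m 0 + groundLin n m 0 x)
        + coneEnd coneOmega (groundCov m 0 + groundLin n m 0 x) = 0
      have h0 : ∑ j, ((t * morseSign m j - t) * x j) • coneEnd (coneExt j)
          (groundCov m 0 + groundLin n m 0 x) = 0 := by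
        rw [← sum_smul_eq_zero_of_skew (fun i => (i : ℕ) + n < m) (fun j => t * morseSign m j - t)
          -- The Gaussian shift `t s_j - t` is `-2t` for `j < m` and zero otherwise. For `j < m`
          -- only `-dx_j ∧ ι_Z` survives, equal to `-Z_j` times the ground covector, and `∑ x_j Z_j
          -- = 0`.
          (-(2 * t)) x (coneEquiv n (0, -lowCov n m)) fun j => ?_]
        · refine Finset.sum_congr rfl fun j _ => ?_
          rcases lt_or_ge (j : ℕ) m with h | h
          · rw [groundCov_add_groundLin_zero, coneEnd_coneEquiv, coneExt_apply, extCov_lowCov h,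
              extCov_intCov_of_extCov (extCov_lowCov h), ← map_smul, ← map_smul,
              ← map_smul, Prod.smul_mk, Prod.smul_mk, Prod.smul_mk, smul_zero, smul_zero, smul_neg,
              smul_neg, smul_neg, smul_zero]
          · rw [morseSign_eq_one.2 h]; simp
        · rcases lt_or_ge (j : ℕ) m with h | h
          · left; rw [morseSign_eq_neg_one.2 h]; ring
          · right; exact rotZ_apply_of_le h x
      rw [h0, groundCov_add_groundLin_zero]
      simp only [groundLin_zero, coneEnd_coneEquiv, coneExt_apply, coneOmega_apply,
        extCov_rotZ_ee, omegaCov_intCov_rotZ, map_zero, neg_zero, Prod.mk_zero_zero,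
        Finset.sum_const_zero, add_zero]
    · change ∑ j, coneEnd (coneExt j) (groundLin n m 1 (ee j)) + ∑ j, ((t * morseSign m j - t) * x j) •
        coneEnd (coneExt j) (groundCov m 1 + groundLin n m 1 x)
        + coneEnd coneOmega (groundCov m 1 + groundLin n m 1 x) = 0
      have h0 : ∑ j, ((t * morseSign m j - t) * x j) • coneEnd (coneExt j)
          (groundCov m 1 + groundLin n m 1 x) = 0 := by
        refine Finset.sum_eq_zero fun j _ => ?_
        rcases lt_or_ge (j : ℕ) m with h | h
        · rw [groundCov_add_groundLin_one, coneEnd_coneEquiv, coneExt_apply, map_neg,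
            extCov_extCov_flat_eq_zero (extCov_lowCov h), extCov_lowCov h]
          simp
        · rw [morseSign_eq_one.2 h]; simp
      -- The derivative of `-τ` contributes `-ω`, which cancels the coupling applied to the second
      -- component.
      have h1 := sum_extCov_skew (fun i : Fin n => m ≤ (i : ℕ)) (lowCov n m) fun i hi =>
        extCov_lowCov (by rw [Fin.val_castAdd]; omega)
      rw [h0, groundCov_add_groundLin_one]
      simp only [groundLin_one, coneEnd_coneEquiv, coneExt_apply, coneOmega_apply,
        ← map_sum (coneEquiv n), ← map_add (coneEquiv n), add_zero, map_zero, neg_zero, map_neg]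
      rw [← map_zero (coneEquiv n)]
      congr 1
      refine Prod.ext ?_ ?_
      · rw [Prod.fst_add, Prod.fst_sum]
        simp only [Finset.sum_neg_distrib]
        rw [h1]; exact neg_add_cancel _
      · rw [Prod.snd_add, Prod.snd_sum]; simp
  coclosed t i := by
    funext x
    rw [modelDstar, firstOrder_gaussAffine, Pi.zero_apply, smul_eq_zero]
    refine Or.inr ?_
    fin_cases i
    · change ∑ j, -coneEnd (coneInt j) (groundLin n m 0 (ee j))
        + ∑ j, ((-(t * morseSign m j) - t) * x j) •
          -coneEnd (coneInt j) (groundCov m 0 + groundLin n m 0 x)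
        + coneEnd coneLam (groundCov m 0 + groundLin n m 0 x) = 0
      have h0 : ∑ j, ((-(t * morseSign m j) - t) * x j) • -coneEnd (coneInt j)
          (groundCov m 0 + groundLin n m 0 x) = 0 := by
        refine Finset.sum_eq_zero fun j _ => ?_
        rcases lt_or_ge (j : ℕ) m with h | h
        · rw [morseSign_eq_neg_one.2 h]; simp
        · rw [groundCov_add_groundLin_zero, coneEnd_coneEquiv, coneInt_apply,
            intCov_intCov_eq_zero (intCov_lowCov h), intCov_lowCov h]
          simp
      -- The codifferential of `ι_Z` of the ground covector enters the second component as `-Λ` and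
      -- cancels the coupling `Λ`.
      have h1 := sum_intCov_skew (fun i : Fin n => (i : ℕ) + n < m) (lowCov n m) fun i hi =>
        intCov_lowCov (by rw [Fin.val_natAdd]; omega)
      rw [h0, groundCov_add_groundLin_zero]
      simp only [groundLin_zero, coneEnd_coneEquiv, coneInt_apply, coneLam_apply,
        ← map_neg (coneEquiv n), ← map_sum (coneEquiv n), ← map_add (coneEquiv n), add_zero, map_zero]
      rw [← map_zero (coneEquiv n)]
      congr 1
      refine Prod.ext ?_ ?_
      · rw [Prod.fst_add, Prod.fst_sum]; simp
      · rw [Prod.snd_add, Prod.snd_sum]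
        simp only [Prod.snd_neg, neg_neg]
        rw [h1]; exact neg_add_cancel _
    · change ∑ j, -coneEnd (coneInt j) (groundLin n m 1 (ee j))
        + ∑ j, ((-(t * morseSign m j) - t) * x j) •
          -coneEnd (coneInt j) (groundCov m 1 + groundLin n m 1 x)
        + coneEnd coneLam (groundCov m 1 + groundLin n m 1 x) = 0
      have h0 : ∑ j, ((-(t * morseSign m j) - t) * x j) • -coneEnd (coneInt j)
          (groundCov m 1 + groundLin n m 1 x) = 0 := by
        -- For the codifferential the Gaussian shift is `-2t` on `j ≥ m` and zero otherwise; there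
        -- `ι_j` of the correction is a component of a vector orthogonal to `x`.
        rw [← sum_smul_eq_zero_of_skew (fun i => m ≤ (i : ℕ))
          (fun j => -(t * morseSign m j) - t) (-(2 * t)) x (coneEquiv n (lowCov n m, 0))
          fun j => ?_]
        · refine Finset.sum_congr rfl fun j _ => ?_
          rcases lt_or_ge (j : ℕ) m with h | h
          · rw [morseSign_eq_neg_one.2 h]; simp
          · rw [groundCov_add_groundLin_one, coneEnd_coneEquiv, coneInt_apply, intCov_lowCov h,
              map_neg, intCov_extCov_of_intCov (intCov_lowCov h), ← map_neg, ← map_smul (coneEquiv n),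
              Prod.neg_mk, neg_neg, neg_zero, neg_zero, ← map_smul, ← map_smul]
            simp only [Prod.smul_mk, smul_zero]
        · rcases lt_or_ge (j : ℕ) m with h | h
          · right; exact rotY_apply_of_lt h x
          · left; rw [morseSign_eq_one.2 h]; ring
      rw [h0, groundCov_add_groundLin_one]
      simp only [groundLin_one, coneEnd_coneEquiv, coneInt_apply, coneLam_apply, map_neg,
        intCov_rotY_ee, lamCov_extCov_rotY, map_zero, neg_zero, Prod.mk_zero_zero,
        Finset.sum_const_zero, add_zero]

end GroundStates

end ConeLaplacian

end

open MeasureTheory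
open scoped ContDiff

noncomputable section

namespace ConeLaplacian

/-! ### Dictionary between cone forms and functions with values in `ConeSpace`. -/

section Transport

open scoped RealInnerProductSpace

variable {n m : ℕ}

/-! ### Cone forms as functions with values in cone covectors -/

/-- A cone form as a function with values in the Euclidean space of cone covectors. -/
def coneFun (n : ℕ) : ConeForm n →ₗ[ℝ] Coord n → ConeSpace n where
  toFun σ x := coneEquiv n (fun k => σ.1 k x, fun k => σ.2 k x)
  map_add' σ τ := by
    funext x
    exact map_add (coneEquiv n) (fun k => σ.1 k x, fun k => σ.2 k x)
      (fun k => τ.1 k x, fun k => τ.2 k x)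
  map_smul' r σ := by
    funext x
    exact map_smul (coneEquiv n) r (fun k => σ.1 k x, fun k => σ.2 k x)

lemma coneFun_apply (σ : ConeForm n) (x : Coord n) :
    coneFun n σ x = coneEquiv n (fun k => σ.1 k x, fun k => σ.2 k x) := rfl

lemma coneFun_injective : Function.Injective (coneFun n) := fun σ τ h => by
  have h1 : ∀ x, ((fun k => σ.1 k x, fun k => σ.2 k x) : ConeCov n)
      = (fun k => τ.1 k x, fun k => τ.2 k x) := fun x => (coneEquiv n).injective (congrFun h x)
  refine Prod.ext ?_ ?_
  · funext k x; exact congrFun (congrArg Prod.fst (h1 x)) k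
  · funext k x; exact congrFun (congrArg Prod.snd (h1 x)) k

/-- The components of degree `k` of a cone covector, as a continuous linear map. -/
def coneComp₁ (n k : ℕ) : ConeSpace n →L[ℝ] Coord n [⋀^Fin k]→L[ℝ] ℝ :=
  LinearMap.toContinuousLinearMap
    (LinearMap.proj k ∘ₗ LinearMap.fst ℝ (Cov n) (Cov n) ∘ₗ (coneEquiv n).symm.toLinearMap)

/-- The components of degree `k` of a cone covector, as a continuous linear map. -/
def coneComp₂ (n k : ℕ) : ConeSpace n →L[ℝ] Coord n [⋀^Fin k]→L[ℝ] ℝ :=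
  LinearMap.toContinuousLinearMap
    (LinearMap.proj k ∘ₗ LinearMap.snd ℝ (Cov n) (Cov n) ∘ₗ (coneEquiv n).symm.toLinearMap)

lemma coneComp₁_coneEquiv (k : ℕ) (y : ConeCov n) : coneComp₁ n k (coneEquiv n y) = y.1 k := by
  simp [coneComp₁]

lemma coneComp₂_coneEquiv (k : ℕ) (y : ConeCov n) : coneComp₂ n k (coneEquiv n y) = y.2 k := by
  simp [coneComp₂]

lemma coneComp₁_comp_coneFun (σ : ConeForm n) (k : ℕ) :
    (fun x => coneComp₁ n k (coneFun n σ x)) = σ.1 k :=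
  funext fun _ => coneComp₁_coneEquiv _ _

lemma coneComp₂_comp_coneFun (σ : ConeForm n) (k : ℕ) :
    (fun x => coneComp₂ n k (coneFun n σ x)) = σ.2 k :=
  funext fun _ => coneComp₂_coneEquiv _ _

lemma coneEquiv_coneComp (v : ConeSpace n) :
    coneEquiv n (fun k => coneComp₁ n k v, fun k => coneComp₂ n k v) = v := by
  obtain ⟨y, rfl⟩ := (coneEquiv n).surjective v
  simp only [coneComp₁_coneEquiv, coneComp₂_coneEquiv]

/-- Smoothness and square integrability of a form are stated degree by degree. A finite expansion of
`coneEquiv` in coefficients carries them over to the vector-valued function. -/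
lemma exists_coneEquiv_eq_sum (n : ℕ) : ∃ b b' : Idx n → ConeSpace n, ∀ y : ConeCov n,
    coneEquiv n y = ∑ i, coeff i y.1 • b i + ∑ i, coeff i y.2 • b' i := by
  obtain ⟨T, hT⟩ := (ConeSpace n).subtype.exists_leftInverse_of_injective
    (LinearMap.ker_eq_bot.2 (ConeSpace n).injective_subtype)
  refine ⟨fun i => T (EuclideanSpace.single (Sum.inl i) 1),
    fun i => T (EuclideanSpace.single (Sum.inr i) 1), fun y => ?_⟩
  have h : coneCoords n y = ∑ i, coeff i y.1 • EuclideanSpace.single (Sum.inl i) (1 : ℝ)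
      + ∑ i, coeff i y.2 • EuclideanSpace.single (Sum.inr i) (1 : ℝ) := by
    ext (i | i) <;> simp [coneCoords, Pi.single_apply]
  have h2 : coneEquiv n y = T (coneCoords n y) :=
    (LinearMap.congr_fun hT (coneEquiv n y)).symm
  rw [h2, h]
  simp only [map_add, map_sum, map_smul]

lemma contDiff_coneFun {σ : ConeForm n} (hσ : IsSmooth σ) : ContDiff ℝ ∞ (coneFun n σ) := by
  obtain ⟨b, b', hb⟩ := exists_coneEquiv_eq_sum n
  have : coneFun n σ = fun x => ∑ i : Idx n, σ.1 i.1 x (fun l => ee (i.2 l)) • b i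
      + ∑ i : Idx n, σ.2 i.1 x (fun l => ee (i.2 l)) • b' i := funext fun x => hb _
  rw [this]
  refine (ContDiff.sum fun i _ => ?_).add (ContDiff.sum fun i _ => ?_)
  · exact (((ContinuousAlternatingMap.apply ℝ (Coord n) ℝ fun l => ee (i.2 l)).contDiff.comp
      (hσ i.1).1)).smul contDiff_const
  · exact (((ContinuousAlternatingMap.apply ℝ (Coord n) ℝ fun l => ee (i.2 l)).contDiff.comp
      (hσ i.1).2)).smul contDiff_const

lemma memLp_coneFun {σ : ConeForm n} (hσ : IsL2 σ) : MemLp (coneFun n σ) 2 := by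
  obtain ⟨b, b', hb⟩ := exists_coneEquiv_eq_sum n
  have : coneFun n σ = fun x => ∑ i : Idx n, σ.1 i.1 x (fun l => ee (i.2 l)) • b i
      + ∑ i : Idx n, σ.2 i.1 x (fun l => ee (i.2 l)) • b' i := funext fun x => hb _
  rw [this]
  refine (memLp_finsetSum _ fun i _ => ?_).add (memLp_finsetSum _ fun i _ => ?_)
  · exact ((ContinuousLinearMap.toSpanSingleton ℝ (b i)).comp
      (ContinuousAlternatingMap.apply ℝ (Coord n) ℝ fun l => ee (i.2 l))).comp_memLp' (hσ i.1).1
  · exact ((ContinuousLinearMap.toSpanSingleton ℝ (b' i)).comp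
      (ContinuousAlternatingMap.apply ℝ (Coord n) ℝ fun l => ee (i.2 l))).comp_memLp' (hσ i.1).2

lemma isSmooth_iff {σ : ConeForm n} : IsSmooth σ ↔ ContDiff ℝ ∞ (coneFun n σ) := by
  refine ⟨contDiff_coneFun, fun h k => ⟨?_, ?_⟩⟩
  · rw [← coneComp₁_comp_coneFun]; exact (coneComp₁ n k).contDiff.comp h
  · rw [← coneComp₂_comp_coneFun]; exact (coneComp₂ n k).contDiff.comp h

lemma isL2_iff {σ : ConeForm n} : IsL2 σ ↔ MemLp (coneFun n σ) 2 := by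
  refine ⟨memLp_coneFun, fun h k => ⟨?_, ?_⟩⟩
  · rw [← coneComp₁_comp_coneFun]; exact (coneComp₁ n k).comp_memLp' h
  · rw [← coneComp₂_comp_coneFun]; exact (coneComp₂ n k).comp_memLp' h

lemma fderiv_coneFun {σ : ConeForm n} (hσ : IsSmooth σ) (x v : Coord n) :
    fderiv ℝ (coneFun n σ) x v
      = coneEquiv n (fun k => fderiv ℝ (σ.1 k) x v, fun k => fderiv ℝ (σ.2 k) x v) := by
  have hd : DifferentiableAt ℝ (coneFun n σ) x :=
    (contDiff_coneFun hσ).differentiable (by simp) x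
  rw [← coneEquiv_coneComp (fderiv ℝ (coneFun n σ) x v)]
  congr 1
  refine Prod.ext ?_ ?_ <;> funext k
  · change _ = fderiv ℝ (σ.1 k) x v
    rw [← coneComp₁_comp_coneFun σ k]
    exact (DFunLike.congr_fun ((coneComp₁ n k).hasFDerivAt.comp x hd.hasFDerivAt).fderiv v).symm
  · change _ = fderiv ℝ (σ.2 k) x v
    rw [← coneComp₂_comp_coneFun σ k]
    exact (DFunLike.congr_fun ((coneComp₂ n k).hasFDerivAt.comp x hd.hasFDerivAt).fderiv v).symm

/-! ### The differential operators -/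

lemma wedge_apply (α : Coord n → Coord n →L[ℝ] ℝ) (η : Form n) (x : Coord n) :
    (fun k => wedge α η k x) = extCov (α x) fun k => η k x := by
  funext k
  cases k <;> rfl

lemma contract_apply (Z : Coord n → Coord n) (η : Form n) (x : Coord n) :
    (fun k => contract Z η k x) = intCov (Z x) fun k => η k x := rfl

lemma omegaWedge_apply (η : Form n) (x : Coord n) :
    (fun k => omegaWedge η k x) = omegaCov fun k => η k x := by
  rw [omegaCov_apply]
  funext k
  rw [omegaWedge, Finset.sum_apply, Finset.sum_apply, Finset.sum_apply]
  refine Finset.sum_congr rfl fun i _ => ?_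
  rw [← wedge_apply (fun _ => dx (Fin.natAdd n i)), ← wedge_apply (fun _ => dx (Fin.castAdd n i))]

lemma Lam_apply (η : Form n) (x : Coord n) :
    (fun k => Lam η k x) = lamCov fun k => η k x := by
  rw [lamCov_apply]
  funext k
  rw [Lam, Finset.sum_apply, Finset.sum_apply, Finset.sum_apply]
  rfl

/-- `extDeriv` alternates the full derivative; expanding its direction in coordinates gives `d = ∑
dx_j ∧ ∂_j`. -/
lemma extD_apply (η : Form n) (x : Coord n) :
    (fun k => extD η k x) = ∑ j, extCov (dx j) fun k => fderiv ℝ (η k) x (ee j) := by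
  funext k
  rw [Finset.sum_apply]
  cases k with
  | zero => exact (Finset.sum_eq_zero fun j _ => rfl).symm
  | succ k =>
    have h : ∀ v, fderiv ℝ (η k) x v = ∑ j, v j • fderiv ℝ (η k) x (ee j) := fun v => by
      conv_lhs => rw [← sum_smul_ee v]
      simp only [map_sum, map_smul]
    ext v
    change ContinuousAlternatingMap.alternatizeUncurryFin (fderiv ℝ (η k) x) v = _
    rw [ContinuousAlternatingMap.sum_apply]
    simp only [extCov_succ_apply]
    rw [Finset.sum_comm, ContinuousAlternatingMap.alternatizeUncurryFin_apply]
    refine Finset.sum_congr rfl fun i _ => ?_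
    rw [h (v i), ContinuousAlternatingMap.sum_apply, Finset.smul_sum]
    refine Finset.sum_congr rfl fun j _ => ?_
    simp [dx]

lemma coD_apply (η : Form n) (x : Coord n) :
    (fun k => coD η k x) = -∑ j, intCov (ee j) fun k => fderiv ℝ (η k) x (ee j) := by
  funext k
  rw [Pi.neg_apply, Finset.sum_apply]
  rfl

lemma IsMorseForm.hasFDerivAt {f : Coord n → ℝ} (hf : IsMorseForm m f) (x : Coord n) :
    HasFDerivAt f (∑ j, (morseSign m j * x j) • dx j : Coord n →L[ℝ] ℝ) x := by
  have h : f = fun x => f 0 + (1 / 2 : ℝ) * ∑ l : Fin (n + n), morseSign m l * x l ^ 2 := funext hf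
  rw [h]
  have h1 : ∀ l : Fin (n + n), HasFDerivAt (fun x : Coord n => morseSign m l * x l ^ 2)
      (morseSign m l • ((2 : ℕ) • x l ^ (2 - 1)) • dx l : Coord n →L[ℝ] ℝ) x := fun l =>
    (((dx l).hasFDerivAt (x := x)).pow 2).const_mul _
  refine (((HasFDerivAt.fun_sum fun l _ => h1 l).const_mul (1 / 2 : ℝ)).const_add (f 0)).congr_fderiv ?_
  rw [Finset.smul_sum]
  refine Finset.sum_congr rfl fun l _ => ?_
  rw [smul_smul, smul_smul]
  congr 1
  simp
  ring

lemma IsMorseForm.gradient_eq {f : Coord n → ℝ} (hf : IsMorseForm m f) (x : Coord n) :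
    gradient f x = ∑ j, (morseSign m j * x j) • ee j := by
  rw [gradient, (hf.hasFDerivAt x).fderiv, LinearIsometryEquiv.symm_apply_eq]
  ext v
  simp [dx, ee, PiLp.inner_apply]

/-- Since `df = ∑ s_j x_j dx_j`, the deformation is absorbed into the derivatives as `∂_j + t s_j
x_j`, the form required by `twist`. -/
lemma dT_apply {f : Coord n → ℝ} (hf : IsMorseForm m f) (t : ℝ) (η : Form n) (x : Coord n) :
    (fun k => dT f t η k x) = ∑ j, extCov (dx j)
      ((fun k => fderiv ℝ (η k) x (ee j)) + (t * morseSign m j * x j) • fun k => η k x) := by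
  have h : (fun k => dT f t η k x)
      = (fun k => extD η k x) + t • fun k => wedge (fun x => fderiv ℝ f x) η k x := rfl
  have h2 : extCov (fderiv ℝ f x) (fun k => η k x)
      = ∑ j, (morseSign m j * x j) • extCov (dx j) fun k => η k x := by
    change extHom n _ _ = _
    rw [(hf.hasFDerivAt x).fderiv, map_sum, LinearMap.sum_apply]
    simp only [map_smul]
    rfl
  rw [h, extD_apply, wedge_apply, h2, Finset.smul_sum, ← Finset.sum_add_distrib]
  simp only [map_add, map_smul, smul_smul, mul_assoc]

/-- Because `d^*` is minus the sum of the `ι_j ∂_j`, adding `t ι_{∇f}` changes each derivative to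
`∂_j - t s_j x_j`. -/
lemma dTstar_apply {f : Coord n → ℝ} (hf : IsMorseForm m f) (t : ℝ) (η : Form n) (x : Coord n) :
    (fun k => dTstar f t η k x) = -∑ j, intCov (ee j)
      ((fun k => fderiv ℝ (η k) x (ee j)) + (-(t * morseSign m j) * x j) • fun k => η k x) := by
  have h : (fun k => dTstar f t η k x)
      = (fun k => coD η k x) + t • fun k => contract (fun x => gradient f x) η k x := rfl
  have h2 : intCov (gradient f x) (fun k => η k x)
      = ∑ j, (morseSign m j * x j) • intCov (ee j) fun k => η k x := by
    change intHom n _ _ = _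
    rw [hf.gradient_eq, map_sum, LinearMap.sum_apply]
    simp only [map_smul]
    rfl
  rw [h, coD_apply, contract_apply, h2, Finset.smul_sum, ← Finset.sum_neg_distrib,
    ← Finset.sum_neg_distrib, ← Finset.sum_add_distrib]
  refine Finset.sum_congr rfl fun j _ => ?_
  rw [map_add, map_smul, neg_add]
  congr 1
  rw [show -(t * morseSign m j) * x j = -(t * (morseSign m j * x j)) by ring, smul_smul]
  refine cov_ext fun k v => ?_
  simp only [Pi.neg_apply, Pi.smul_apply, ContinuousAlternatingMap.neg_apply,
    ContinuousAlternatingMap.smul_apply, smul_eq_mul]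
  ring

lemma coneFun_coneD {f : Coord n → ℝ} (hf : IsMorseForm m f) (t : ℝ) {σ : ConeForm n}
    (hσ : IsSmooth σ) : coneFun n (coneD f t σ)
      = modelD (morseSign m) (fun j => coneEnd (coneExt j)) (coneEnd coneOmega) t (coneFun n σ) := by
  funext x
  have h : ∀ j, twist (t * morseSign m j) j (coneFun n σ) x = coneEquiv n
      ((fun k => fderiv ℝ (σ.1 k) x (ee j)) + (t * morseSign m j * x j) • fun k => σ.1 k x,
       (fun k => fderiv ℝ (σ.2 k) x (ee j)) + (t * morseSign m j * x j) • fun k => σ.2 k x) :=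
    fun j => by
      rw [twist, fderiv_coneFun hσ, coneFun_apply, ← map_smul, ← map_add]; rfl
  simp only [modelD, firstOrder, h, coneEnd_coneEquiv]
  rw [coneFun_apply σ, coneEnd_coneEquiv, ← map_sum, ← map_add, coneFun_apply]
  congr 1
  refine Prod.ext ?_ ?_
  · rw [Prod.fst_add, Prod.fst_sum]
    refine Eq.trans ?_ (congrArg₂ (· + ·) (dT_apply hf t σ.1 x) (omegaWedge_apply σ.2 x))
    rfl
  · rw [Prod.snd_add, Prod.snd_sum]
    simp only [coneExt_apply, coneOmega_apply, Finset.sum_neg_distrib, add_zero]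
    rw [← dT_apply hf t σ.2 x]
    rfl

lemma coneFun_coneDstar {f : Coord n → ℝ} (hf : IsMorseForm m f) (t : ℝ) {σ : ConeForm n}
    (hσ : IsSmooth σ) : coneFun n (coneDstar f t σ)
      = modelDstar (morseSign m) (fun j => coneEnd (coneInt j)) (coneEnd coneLam) t
        (coneFun n σ) := by
  funext x
  have h : ∀ j, twist (-(t * morseSign m j)) j (coneFun n σ) x = coneEquiv n
      ((fun k => fderiv ℝ (σ.1 k) x (ee j)) + (-(t * morseSign m j) * x j) • fun k => σ.1 k x,
       (fun k => fderiv ℝ (σ.2 k) x (ee j)) + (-(t * morseSign m j) * x j) • fun k => σ.2 k x) :=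
    fun j => by
      rw [twist, fderiv_coneFun hσ, coneFun_apply, ← map_smul, ← map_add]; rfl
  simp only [modelDstar, firstOrder, h, _root_.neg_apply, coneEnd_coneEquiv]
  rw [coneFun_apply σ, coneEnd_coneEquiv, Finset.sum_neg_distrib, ← map_sum, ← map_neg, ← map_add,
    coneFun_apply]
  congr 1
  refine Prod.ext ?_ ?_
  · rw [Prod.fst_add, Prod.fst_neg, Prod.fst_sum]
    simp only [coneInt_apply, coneLam_apply, add_zero]
    rw [← dTstar_apply hf t σ.1 x]
    rfl
  · rw [Prod.snd_add, Prod.snd_neg, Prod.snd_sum]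
    simp only [coneInt_apply, coneLam_apply, Finset.sum_neg_distrib]
    rw [← dTstar_apply hf t σ.2 x, ← Lam_apply, add_comm, ← sub_eq_add_neg]
    rfl

lemma coneFun_coneLap {f : Coord n → ℝ} (hf : IsMorseForm m f) (t : ℝ) {σ : ConeForm n}
    (hσ : IsSmooth σ) : coneFun n (coneLap f t σ)
      = modelLap (morseSign m) (fun j => coneEnd (coneExt j)) (fun j => coneEnd (coneInt j))
        (coneEnd coneOmega) (coneEnd coneLam) t (coneFun n σ) := by
  have h1 : IsSmooth (coneD f t σ) := isSmooth_iff.2 <| by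
    rw [coneFun_coneD hf t hσ]; exact contDiff_modelD (contDiff_coneFun hσ)
  have h2 : IsSmooth (coneDstar f t σ) := isSmooth_iff.2 <| by
    rw [coneFun_coneDstar hf t hσ]; exact contDiff_modelDstar (contDiff_coneFun hσ)
  rw [coneLap, map_add, coneFun_coneD hf t h2, coneFun_coneDstar hf t h1, coneFun_coneD hf t hσ,
    coneFun_coneDstar hf t hσ]
  rfl

/-! ### The inner product -/

lemma formInner_eq (η η' : Form n) :
    formInner η η' = ∫ x, covPair (fun k => η k x) fun k => η' k x := rfl

lemma integrable_covPair {η η' : Form n} (hη : ∀ k, MemLp (η k) 2) (hη' : ∀ k, MemLp (η' k) 2) :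
    Integrable fun x => covPair (fun k => η k x) fun k => η' k x := by
  have h0 : ∀ k, MemLp (fun _ : Coord n => (0 : Coord n [⋀^Fin k]→L[ℝ] ℝ)) 2 := fun k => by
    have := (hη k).sub (hη k)
    rwa [sub_self] at this
  -- Forms are viewed as cone forms with zero second component, so that integrability follows from
  -- the Euclidean case.
  have h1 : IsL2 ((η, 0) : ConeForm n) := fun k => ⟨hη k, h0 k⟩
  have h2 : IsL2 ((η', 0) : ConeForm n) := fun k => ⟨hη' k, h0 k⟩
  have h3 : ∀ x, ⟪coneFun n ((η, 0) : ConeForm n) x, coneFun n ((η', 0) : ConeForm n) x⟫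
      = covPair (fun k => η k x) fun k => η' k x := fun x => by
    rw [coneFun_apply, coneFun_apply, inner_coneEquiv]
    exact (congrArg (_ + ·) (covPair_zero_left (0 : Cov n))).trans (add_zero _)
  have := integrable_inner_of_memLp (memLp_coneFun h1) (memLp_coneFun h2)
  simpa only [h3] using this

lemma coneInner_eq {σ σ' : ConeForm n} (hσ : IsL2 σ) (hσ' : IsL2 σ') :
    coneInner σ σ' = ∫ x, ⟪coneFun n σ x, coneFun n σ' x⟫ := by
  rw [coneInner, formInner_eq, formInner_eq, ← integral_add (integrable_covPair (fun k => (hσ k).1)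
    fun k => (hσ' k).1) (integrable_covPair (fun k => (hσ k).2) fun k => (hσ' k).2)]
  congr 1
  funext x
  rw [coneFun_apply, coneFun_apply, inner_coneEquiv, conePair]

end Transport

end ConeLaplacian

end

open MeasureTheory
open scoped ContDiff

noncomputable section

namespace ConeLaplacian

/-! ### Identification of the generators with the ground states, and the kernel. -/

section Generators

open scoped RealInnerProductSpace

variable {n m : ℕ}

/-! ### The generators -/

lemma dxList_apply (L : List (Fin (n + n))) (x : Coord n) :
    (fun k => dxList L k x) = covList L := by
  induction L with
  | nil => funext k; cases k <;> rfl
  | cons l L ih =>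
    rw [covList_cons, ← ih]
    exact wedge_apply (fun _ => dx l) (dxList L) x

lemma zeta_apply (t : ℝ) (x : Coord n) :
    (fun k => zeta t m k x) = gauss t x • lowCov n m := by
  rw [lowCov, ← dxList_apply _ x]
  rfl

lemma vecZ_eq (x : Coord n) : vecZ m x = rotZ n m x := by
  rw [← sum_smul_ee (rotZ n m x), Fin.sum_univ_add, ← Finset.sum_add_distrib, vecZ]
  refine Finset.sum_congr rfl fun i _ => ?_
  rw [skew_castAdd, skew_natAdd]
  split_ifs
  · module
  · simp

/-- For `m < n` the extra summands `-x_{i+n} dx_i` of `τ`, with `i ≤ m`, vanish on `dx_1 ∧ … ∧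
dx_m`; the rest is the half-rotation. For `m ≥ n` both sides are zero. -/
lemma extCov_tau (x : Coord n) :
    extCov (tau m x) (lowCov n m) = extCov (flat (rotY n m x)) (lowCov n m) := by
  rcases le_or_gt n m with h | h
  · rw [tau, if_neg (by omega), rotY_eq_zero h, LinearMap.zero_apply, extCov_flat_zero]
    exact congrArg (fun T : Module.End ℝ (Cov n) => T _) (extHom n).map_zero
  · change extHom n _ _ = extHom n _ _
    rw [tau, if_pos h, flat_eq_sum, Fin.sum_univ_add, ← Finset.sum_add_distrib, map_sum, map_sum,
      LinearMap.sum_apply, LinearMap.sum_apply]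
    refine Finset.sum_congr rfl fun i _ => ?_
    rw [skew_castAdd, skew_natAdd]
    rcases lt_or_ge (i : ℕ) m with hi | hi
    · rw [if_pos hi, if_neg (not_le.2 hi), if_neg (not_le.2 hi), zero_smul, zero_smul, add_zero,
        map_zero, map_smul, LinearMap.smul_apply]
      change _ • extCov _ _ = _
      rw [extCov_lowCov (by rwa [Fin.val_castAdd]), smul_zero]
      rfl
    · rw [if_neg (not_lt.2 hi), if_pos hi, if_pos hi]
      congr 2
      module

lemma coneFun_gen₁ (t : ℝ) :
    coneFun n (gen₁ t m) = gaussAffine t (groundCov m 0) (groundLin n m 0) := by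
  funext x
  rw [gaussAffine, groundCov_add_groundLin_zero, ← map_smul, coneFun_apply]
  congr 1
  refine Prod.ext (zeta_apply t x) ?_
  change intCov (vecZ m x) (fun k => zeta t m k x) = _
  rw [zeta_apply, map_smul, vecZ_eq]
  rfl

lemma coneFun_gen₂ (t : ℝ) :
    coneFun n (gen₂ t m) = gaussAffine t (groundCov m 1) (groundLin n m 1) := by
  funext x
  rw [gaussAffine, groundCov_add_groundLin_one, ← map_smul, coneFun_apply]
  congr 1
  refine Prod.ext ?_ (zeta_apply t x)
  change -(fun k => wedge (tau m) (zeta t m) k x) = _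
  rw [wedge_apply, zeta_apply, map_smul, extCov_tau]
  exact (smul_neg _ _).symm

lemma covList_apply_eq_zero {L : List (Fin (n + n))} {k : ℕ} (h : k ≠ L.length) :
    covList L k = 0 := by
  induction L generalizing k with
  | nil =>
    cases k with
    | zero => exact absurd rfl h
    | succ k => rfl
  | cons l L ih =>
    rw [covList_cons]
    cases k with
    | zero => rfl
    | succ k =>
      ext v
      have : covList L k = 0 := ih fun h' => h (by rw [h', List.length_cons])
      rw [extCov_succ_apply, this]
      simp

/-- The bound on `m` matters here: only then does the truncated list of indices have length exactly
`m`. -/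
lemma zeta_eq_zero (hm : m ≤ n + n) (t : ℝ) {k : ℕ} (h : k ≠ m) : zeta (n := n) t m k = 0 := by
  funext x
  have h1 : lowCov n m k = 0 := covList_apply_eq_zero (by simpa [hm] using h)
  have h2 := congrFun (zeta_apply (n := n) (m := m) t x) k
  rw [Pi.smul_apply, h1, smul_zero] at h2
  exact h2

lemma hasConeDegree_gen₁ (hm : m ≤ n + n) (t : ℝ) : HasConeDegree m (gen₁ (n := n) t m) := by
  refine ⟨fun j hj => zeta_eq_zero hm t hj, fun j hj => ?_⟩
  funext x
  change (zeta t m (j + 1) x).curryLeft (vecZ m x) = 0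
  rw [zeta_eq_zero hm t hj]
  rfl

lemma hasConeDegree_gen₂ (hm : m ≤ n + n) (t : ℝ) :
    HasConeDegree (m + 1) (gen₂ (n := n) t m) := by
  refine ⟨fun j hj => ?_, fun j hj => zeta_eq_zero hm t fun h => hj (by rw [h])⟩
  funext x
  change -wedge (tau m) (zeta t m) j x = 0
  cases j with
  | zero => exact neg_zero
  | succ j =>
    change -ContinuousAlternatingMap.alternatizeUncurryFin
      ((tau m x).smulRight (zeta t m j x)) = 0
    rw [zeta_eq_zero hm t fun h => hj (by rw [h])]
    ext v
    simp [ContinuousAlternatingMap.alternatizeUncurryFin_apply]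

/-- At the origin the linear corrections vanish and the generators take the orthonormal values
`groundCov m`. -/
lemma linearIndependent_gen (t : ℝ) :
    LinearIndependent ℝ ![gen₁ (n := n) t m, gen₂ t m] := by
  rw [LinearIndependent.pair_iff]
  intro a b hab
  have h := congrFun (congrArg (coneFun n) hab) 0
  rw [map_add, map_smul, map_smul, coneFun_gen₁, coneFun_gen₂, map_zero] at h
  have hg : gauss t (0 : Coord n) = 1 := by simp [gauss]
  simp only [Pi.add_apply, Pi.smul_apply, gaussAffine, map_zero, add_zero, hg, one_smul,
    Pi.zero_apply] at h
  have hp := (isConeModel (n := n) m).orthonormal.linearIndependent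
  rw [Fintype.linearIndependent_iff] at hp
  have := hp ![a, b] (by simpa [Fin.sum_univ_two] using h)
  exact ⟨this 0, this 1⟩

lemma isL2_gen₁ {t : ℝ} (ht : 0 < t) : IsL2 (gen₁ (n := n) t m) := isL2_iff.2 <| by
  rw [coneFun_gen₁]; exact memLp_gaussAffine ht _ (norm_groundLin_le 0)

lemma isL2_gen₂ {t : ℝ} (ht : 0 < t) : IsL2 (gen₂ (n := n) t m) := isL2_iff.2 <| by
  rw [coneFun_gen₂]; exact memLp_gaussAffine ht _ (norm_groundLin_le 1)

/-- The space of smooth square integrable harmonic cone forms is spanned by the generators. -/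
theorem isHarmonic_iff_mem_span {f : Coord n → ℝ} (hf : IsMorseForm m f) {t : ℝ} (ht : 0 < t)
    (htC : lossConst n (omegaBound n) < gapConst n * t) (σ : ConeForm n) :
    (IsSmooth σ ∧ IsL2 σ ∧ coneLap f t σ = 0)
      ↔ σ ∈ Submodule.span ℝ ({gen₁ t m, gen₂ t m} : Set (ConeForm n)) := by
  rw [Submodule.mem_span_pair]
  have hG := hasGroundStates n m
  constructor
  · rintro ⟨h1, h2, h3⟩
    obtain ⟨a, b, hab⟩ := (isConeModel m).mem_span_of_modelLap_eq_zero hG ht htC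
      (isSmooth_iff.1 h1) (isL2_iff.1 h2) (by rw [← coneFun_coneLap hf t h1, h3, map_zero])
    refine ⟨a, b, coneFun_injective ?_⟩
    rw [hab, map_add, map_smul, map_smul, coneFun_gen₁, coneFun_gen₂]
  · rintro ⟨a, b, rfl⟩
    -- Written as a difference so that `firstOrder_sub` applies.
    have e : coneFun n (a • gen₁ t m + b • gen₂ t m)
        = a • gaussAffine t (groundCov m 0) (groundLin n m 0)
          - (-b) • gaussAffine t (groundCov m 1) (groundLin n m 1) := by
      rw [map_add, map_smul, map_smul, coneFun_gen₁, coneFun_gen₂, neg_smul, sub_neg_eq_add]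
    have c0 := contDiff_gaussAffine t (groundCov m 0) (groundLin n m 0)
    have c1 := contDiff_gaussAffine t (groundCov m 1) (groundLin n m 1)
    have c0' : ContDiff ℝ ∞ (a • gaussAffine t (groundCov m 0) (groundLin n m 0)) :=
      c0.const_smul a
    have c1' : ContDiff ℝ ∞ ((-b) • gaussAffine t (groundCov m 1) (groundLin n m 1)) :=
      c1.const_smul (-b)
    have hs : IsSmooth (a • gen₁ t m + b • gen₂ t m : ConeForm n) := isSmooth_iff.2 <| by
      rw [e]; exact c0'.sub c1'
    refine ⟨hs, isL2_iff.2 ?_, coneFun_injective ?_⟩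
    · rw [e]
      exact ((memLp_gaussAffine ht _ (norm_groundLin_le 0)).const_smul a).sub
        ((memLp_gaussAffine ht _ (norm_groundLin_le 1)).const_smul (-b))
    · have hD : ∀ (c : Fin (n + n) → ℝ) (A : Fin (n + n) → ConeSpace n →L[ℝ] ConeSpace n)
          (W : ConeSpace n →L[ℝ] ConeSpace n),
          firstOrder c A W (gaussAffine t (groundCov m 0) (groundLin n m 0)) = 0 →
          firstOrder c A W (gaussAffine t (groundCov m 1) (groundLin n m 1)) = 0 →
          firstOrder c A W (coneFun n (a • gen₁ t m + b • gen₂ t m)) = 0 := fun c A W h0 h1 => by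
        rw [e, firstOrder_sub c0' c1', firstOrder_const_smul c0,
          firstOrder_const_smul c1, h0, h1, smul_zero, smul_zero, sub_zero]
      have hzero : ∀ (c : Fin (n + n) → ℝ) (A : Fin (n + n) → ConeSpace n →L[ℝ] ConeSpace n)
          (W : ConeSpace n →L[ℝ] ConeSpace n), firstOrder c A W 0 = 0 := fun c A W => by
        have := firstOrder_const_smul (c := c) (A := A) (W := W) c0 0
        rwa [zero_smul, zero_smul] at this
      rw [coneFun_coneLap hf t hs, map_zero, modelLap, modelD, modelDstar,
        hD _ _ _ (hG.closed t 0) (hG.closed t 1), hD _ _ _ (hG.coclosed t 0) (hG.coclosed t 1),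
        hzero, hzero, add_zero]

end Generators

end ConeLaplacian

end

/-! ### The local eigenvalue bound. -/

theorem mainTheorem5 (n : ℕ) :
    -- the bound, up to terms independent of `t`
    (∃ c C : ℝ, 0 < c ∧ ∀ (m : ℕ) (f : ConeLaplacian.Coord n → ℝ), m ≤ n + n →
      ConeLaplacian.IsMorseForm m f → ∀ t : ℝ, 0 < t → ∀ σ : ConeLaplacian.ConeForm n,
        ConeLaplacian.IsSmooth σ → ConeLaplacian.IsL2 σ →
        ConeLaplacian.IsL2 (ConeLaplacian.coneLap f t σ) →
        ConeLaplacian.coneInner σ (ConeLaplacian.gen₁ t m) = 0 →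
        ConeLaplacian.coneInner σ (ConeLaplacian.gen₂ t m) = 0 →
        c * t * ConeLaplacian.coneInner σ σ
            - C * (ConeLaplacian.formInner σ.1 σ.1 + ConeLaplacian.formInner σ.2 σ.2)
          ≤ ConeLaplacian.coneInner (ConeLaplacian.coneLap f t σ) σ) ∧
    -- the eigenvalues and the kernel, for all large `t`
    (∃ c' t₀ : ℝ, 0 < c' ∧ 0 < t₀ ∧ ∀ (m : ℕ) (f : ConeLaplacian.Coord n → ℝ), m ≤ n + n →
      ConeLaplacian.IsMorseForm m f → ∀ t : ℝ, t₀ ≤ t →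
        (∀ (σ : ConeLaplacian.ConeForm n) (lam : ℝ),
          ConeLaplacian.IsSmooth σ → ConeLaplacian.IsL2 σ →
          ConeLaplacian.coneLap f t σ = lam • σ → ConeLaplacian.coneLap f t σ ≠ 0 →
          c' * t < lam) ∧
        (∀ σ : ConeLaplacian.ConeForm n,
          (ConeLaplacian.IsSmooth σ ∧ ConeLaplacian.IsL2 σ ∧ ConeLaplacian.coneLap f t σ = 0) ↔
            σ ∈ Submodule.span ℝ
              ({ConeLaplacian.gen₁ t m, ConeLaplacian.gen₂ t m} :
                Set (ConeLaplacian.ConeForm n))) ∧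
        Module.finrank ℝ (Submodule.span ℝ
          ({ConeLaplacian.gen₁ t m, ConeLaplacian.gen₂ t m} :
            Set (ConeLaplacian.ConeForm n))) = 2 ∧
        ConeLaplacian.HasConeDegree m (ConeLaplacian.gen₁ (n := n) t m) ∧
        ConeLaplacian.HasConeDegree (m + 1) (ConeLaplacian.gen₂ (n := n) t m)) := by
  open ConeLaplacian in
  have hg := gapConst_pos (n := n)
  -- The threshold ensures `2 * lossConst < gapConst * t`, so at least half of the gap survives. The
  -- absolute value and the added 1 keep the threshold positive and the inequality strict.
  refine ⟨⟨gapConst n, lossConst n (omegaBound n), hg, ?_⟩,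
    gapConst n / 2, 2 * |lossConst n (omegaBound n)| / gapConst n + 1, by positivity,
    by positivity, ?_⟩
  · intro m f _ hf t ht σ hs h2 hL2 h1 h3
    have key := (isConeModel m).bound_of_orthogonal (hasGroundStates n m) ht (isSmooth_iff.1 hs)
      (isL2_iff.1 h2) (by rw [← coneFun_coneLap hf t hs]; exact isL2_iff.1 hL2) (fun i => by
        fin_cases i
        · change ∫ x, inner ℝ (coneFun n σ x)
            (gaussAffine t (groundCov m 0) (groundLin n m 0) x) = 0
          rw [← coneFun_gen₁, ← coneInner_eq h2 (isL2_gen₁ ht), h1]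
        · change ∫ x, inner ℝ (coneFun n σ x)
            (gaussAffine t (groundCov m 1) (groundLin n m 1) x) = 0
          rw [← coneFun_gen₂, ← coneInner_eq h2 (isL2_gen₂ ht), h3])
    have hσσ : ∫ x, ‖coneFun n σ x‖ ^ 2 = coneInner σ σ := by
      rw [coneInner_eq h2 h2]
      simp only [real_inner_self_eq_norm_sq]
    rw [← coneFun_coneLap hf t hs, ← coneInner_eq hL2 h2, hσσ] at key
    change gapConst n * t * coneInner σ σ - lossConst n (omegaBound n) * coneInner σ σ ≤ _
    rwa [← sub_mul]
  · intro m f hm hf t ht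
    have ht0 : 0 < t := lt_of_lt_of_le (by positivity) ht
    have htC : 2 * |lossConst n (omegaBound n)| < gapConst n * t := by
      rw [← div_lt_iff₀' hg]
      linarith
    have habs := le_abs_self (lossConst n (omegaBound n))
    have habs0 := abs_nonneg (lossConst n (omegaBound n))
    refine ⟨fun σ lam hs h2 heig hne => ?_,
      isHarmonic_iff_mem_span hf ht0 (by linarith), ?_, hasConeDegree_gen₁ hm t,
      hasConeDegree_gen₂ hm t⟩
    · refine (isConeModel m).eigenvalue_gt (hasGroundStates n m) ht0 (by linarith)
        (isSmooth_iff.1 hs) (isL2_iff.1 h2) (lam := lam) ?_ ?_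
      · rw [← coneFun_coneLap hf t hs, heig, map_smul]
      · rw [← coneFun_coneLap hf t hs]
        exact fun h => hne (coneFun_injective (h.trans (map_zero _).symm))
    · have := finrank_span_eq_card (linearIndependent_gen (n := n) (m := m) t)
      rwa [Matrix.range_cons_cons_empty, Fintype.card_fin] at this
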